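/- Let $\mathbf k$ be a field of characteristic zero and let $m$ be a natural number or $\infty$. All vector spaces are $\mathbb Z$-graded, $\chi(\sigma)=\operatorname{sgn}(\sigma)\,\epsilon(\sigma)$ where $\epsilon(\sigma)$ is the Koszul sign, and the Koszul sign rule is used throughout. An $L(m)$-algebra is a graded vector space $L$ with linear maps $l_k:L^{\otimes k}\to L$ ($1\le k\le m$, $k<\infty$) of degree $k-2$, antisymmetric in the sense that $l_k(x_{\sigma(1)},\dots,x_{\sigma(k)})=\chi(\sigma)\,l_k(x_1,\dots,x_k)$, such that for all finite $1\le n\le m$ and all homogeneous $x_1,\dots,x_n$ $$\sum_{i+j=n+1}\ \sum_{\sigma}\chi(\sigma)(-1)^{i(j-1)}\,l_j\bigl(l_i(x_{\sigma(1)},\dots,x_{\sigma(i)}),x_{\sigma(i+1)},\dots,x_{\sigma(n)}\bigr)=0,$$ where $i,j\ge1$ and $\sigma$ runs over the $(i,n-i)$-unshuffles. Strict homomorphisms are the degree $0$ linear maps commuting with all $l_k$. Let $\mathcal F_m$ be the free graded $\Sigma$-operad generated by operations $\xi_k$ ($1\le k\le m$, $k<\infty$) of arity $k$ and degree $k-2$,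 each spanning the signum representation of $\Sigma_k$, and let $\mathcal L_m$ be the quotient of $\mathcal F_m$ by the operadic ideal generated by the Jacobi relations above, written for the $\xi_k$. An $n$-tree is a rooted (non-planar) tree whose $n$ input legs are labelled by $1,\dots,n$ and whose vertices have between $1$ and $m$ inputs; the tree without vertices is allowed for $n=1$. A choice of a planar representative turns an $n$-tree into an element of $\mathcal F_m(n)$, well defined up to sign. An $n$-tree is admissible if every vertex with exactly one input has an input leg as that input. Fix a planar representative of every admissible tree. Then the following hold. 1. For every $n\ge1$ the classes of the admissible $n$-trees form a basis of the vector space $\mathcal L_m(n)$. Consequently, each planar $n$-tree $T$ has a unique normal form $\Omega(T)$, a linear combination of admissible $n$-trees with $\Omega(T)\equiv T$ in $\mathcal L_m(n)$. 2. Let $Y$ be a graded vector space and put $$\mathfrak L_m(Y)=\bigoplus_{n\ge1}\mathcal L_m(n)\otimes_{\Sigma_n}Y^{\otimes n},$$ graded by the sum of the degrees of the tree, $\deg T=\sum_{v}(\mathrm{val}(v)-2)$ with $\mathrm{val}(v)$ the number of inputs of the vertex $v$, and of the elements of $Y$. There are unique multilinear operations $l_k$ on $\mathfrak L_m(Y)$,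 $1\le k\le m$, $k<\infty$, such that $$l_k(T_1\otimes v_1,\dots,T_k\otimes v_k)=(-1)^{\sum_{a<b}|v_a|\deg T_b}\;\Omega(\xi_k(T_1,\dots,T_k))\otimes(v_1\otimes\cdots\otimes v_k)$$ for all admissible trees $T_j$ with $k_j$ input legs and all homogeneous $v_j\in Y^{\otimes k_j}$. Here $\xi_k(T_1,\dots,T_k)$ is obtained by grafting $T_1,\dots,T_k$ onto the $k$-corolla and shifting the labels to consecutive blocks. 3. With these operations $\mathfrak L_m(Y)$ is the free $L(m)$-algebra on $Y$: it is an $L(m)$-algebra, the map $\eta:Y\to\mathfrak L_m(Y)$, $y\mapsto |\otimes y$ (where $|$ is the tree without vertices), is linear of degree $0$, and for every $L(m)$-algebra $A$ and every degree $0$ linear map $\varphi:Y\to A$ there is a unique strict homomorphism $\Phi:\mathfrak L_m(Y)\to A$ with $\Phi\circ\eta=\varphi$. -/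

import Mathlib

open scoped TensorProduct DirectSum

noncomputable section

namespace HomotopyLie

/-! ### Signs -/

/-- The Koszul sign `ε(σ; x₀, …, x_{n-1})` for homogeneous `xᵢ` of degree `d i`, determined by
`x₀ ⋯ x_{n-1} = ε(σ) x_{σ 0} ⋯ x_{σ (n-1)}` in the free graded commutative algebra:
each inversion of `σ` contributes `(-1)^{|x||x'|}`. -/
def koszulSign {n : ℕ} (σ : Equiv.Perm (Fin n)) (d : Fin n → ℤ) : ℤˣ :=
  ∏ a : Fin n, ∏ b : Fin n, if a < b ∧ σ b < σ a then Int.negOnePow (d (σ a) * d (σ b)) else 1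

/-- The sign `χ(σ) = sgn(σ) · ε(σ)`. -/
def chi {n : ℕ} (σ : Equiv.Perm (Fin n)) (d : Fin n → ℤ) : ℤˣ :=
  Equiv.Perm.sign σ * koszulSign σ d

/-- `σ` is an `(i, n - i)`-unshuffle: it is increasing on the first `i` positions and on
the last `n - i` positions. -/
def IsUnshuffle {n : ℕ} (i : ℕ) (σ : Equiv.Perm (Fin n)) : Prop :=
  ∀ a b : Fin n, a < b → ((b : ℕ) < i ∨ i ≤ (a : ℕ)) → σ a < σ b

instance {n : ℕ} (i : ℕ) (σ : Equiv.Perm (Fin n)) : Decidable (IsUnshuffle i σ) :=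
  inferInstanceAs (Decidable
    (∀ a b : Fin n, a < b → ((b : ℕ) < i ∨ i ≤ (a : ℕ)) → σ a < σ b))

/-! ### Arities and nested operations -/

/-- The arities of the operations: `1 ≤ j ≤ m`, `j < ∞`. -/
abbrev Arity (m : ℕ∞) : Type := {j : ℕ // 1 ≤ j ∧ (j : ℕ∞) ≤ m}

/-- The inner arity `i = p + 1` of the `p`-th group of terms of the `n`-th Jacobi identity. -/
def innerArity {m : ℕ∞} (n : Arity m) (p : Fin n.1) : Arity m :=
  ⟨p + 1, by omega, le_trans (by exact_mod_cast p.2) n.2.2⟩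

/-- The outer arity `j = n - p`, so that `i + j = n + 1`. -/
def outerArity {m : ℕ∞} (n : Arity m) (p : Fin n.1) : Arity m :=
  ⟨n.1 - p, by have := p.2; omega,
    le_trans (by exact_mod_cast Nat.sub_le n.1 p) n.2.2⟩

/-- `nest op n p x = op_j (op_i (x₁, …, x_i), x_{i+1}, …, x_n)` with `i = p + 1`, `j = n - p`. -/
def nest {m : ℕ∞} {X : Type*} (op : (j : Arity m) → (Fin j.1 → X) → X)
    (n : Arity m) (p : Fin n.1) (x : Fin n.1 → X) : X :=
  op (outerArity n p) fun b =>
    if (b : ℕ) = 0 then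
      op (innerArity n p) fun a =>
        x ⟨a, lt_of_lt_of_le a.2 (Nat.succ_le_of_lt p.2)⟩
    else x ⟨p + b, by have h := b.2; simp only [outerArity] at h; omega⟩

/-- The sign `(-1)^{i(j-1)}` with `i = p + 1`, `j = n - p`. -/
def jacobiSign (n p : ℕ) : ℤˣ := (-1) ^ ((p + 1) * (n - p - 1))

/-! ### L(m)-algebras -/

section Algebra

variable {k : Type*} [Field k] {V : Type*} [AddCommGroup V] [Module k V]
  {W : Type*} [AddCommGroup W] [Module k W]

/-- An L(m)-algebra structure `l = (l_j)_{1 ≤ j ≤ m}` on the vector space `V` which is graded by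
the subspaces `𝒱 d`, `d ∈ ℤ`. -/
structure IsLAlgebra (m : ℕ∞) (𝒱 : ℤ → Submodule k V)
    (l : (j : Arity m) → MultilinearMap k (fun _ : Fin j.1 => V) V) : Prop where
  isInternal : DirectSum.IsInternal 𝒱
  degree : ∀ (j : Arity m) (x : Fin j.1 → V) (d : Fin j.1 → ℤ), (∀ a, x a ∈ 𝒱 (d a)) →
    l j x ∈ 𝒱 ((j.1 : ℤ) - 2 + ∑ a, d a)
  antisymm : ∀ (j : Arity m) (x : Fin j.1 → V) (d : Fin j.1 → ℤ), (∀ a, x a ∈ 𝒱 (d a)) →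
    ∀ σ : Equiv.Perm (Fin j.1), l j (fun a => x (σ a)) = chi σ d • l j x
  jacobi : ∀ (n : Arity m) (x : Fin n.1 → V) (d : Fin n.1 → ℤ), (∀ a, x a ∈ 𝒱 (d a)) →
    ∑ p : Fin n.1, ∑ σ : Equiv.Perm (Fin n.1) with IsUnshuffle (p + 1) σ,
      (chi σ d * jacobiSign n.1 p) • nest (fun j y => l j y) n p (fun a => x (σ a)) = 0

/-- Strict homomorphisms: degree zero linear maps commuting with all operations. -/
structure IsStrictHom {m : ℕ∞} (𝒱 : ℤ → Submodule k V)
    (l : (j : Arity m) → MultilinearMap k (fun _ : Fin j.1 => V) V)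
    (𝒲 : ℤ → Submodule k W)
    (l' : (j : Arity m) → MultilinearMap k (fun _ : Fin j.1 => W) W)
    (f : V →ₗ[k] W) : Prop where
  degree : ∀ d, ∀ x ∈ 𝒱 d, f x ∈ 𝒲 d
  map_op : ∀ (j : Arity m) (x : Fin j.1 → V), f (l j x) = l' j (fun a => f (x a))

end Algebra

/-! ### Trees -/

/-- Planar rooted trees whose vertices have between `1` and `m` input edges (unary vertices are
allowed) and whose input legs are labelled by elements of `α`. A `leaf` is the tree without
vertices, and `node j c` is the tree `ξ_j(c_1, …, c_j)`. -/
inductive Tr (m : ℕ∞) (α : Type) : Type where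
  | leaf (a : α) : Tr m α
  | node (j : Arity m) (c : Fin j.1 → Tr m α) : Tr m α

namespace Tr

variable {m : ℕ∞} {α β : Type}

/-- `deg T = ∑_v (val v - 2)`. -/
def deg : Tr m α → ℤ
  | leaf _ => 0
  | node j c => (j.1 : ℤ) - 2 + ∑ i, deg (c i)

/-- Relabelling of the input legs. -/
def map (f : α → β) : Tr m α → Tr m β
  | leaf a => leaf (f a)
  | node j c => node j fun i => map f (c i)

/-- The number of input legs labelled `a`. -/
def occ [DecidableEq α] (a : α) : Tr m α → ℕ
  | leaf b => if b = a then 1 else 0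
  | node _ c => ∑ i, occ a (c i)

/-- The tree has no vertices. -/
def IsLeaf : Tr m α → Prop
  | leaf _ => True
  | node _ _ => False

/-- A tree is admissible if all its unary vertices are input vertices. -/
def Admissible : Tr m α → Prop
  | leaf _ => True
  | node j c => (j.1 = 1 → ∀ i, IsLeaf (c i)) ∧ ∀ i, Admissible (c i)

/-- Two planar labelled trees have the same underlying non-planar labelled tree: they differ by
permutations of the input edges of the vertices. -/
inductive Same : Tr m α → Tr m α → Prop where
  | leaf (a : α) : Same (.leaf a) (.leaf a)
  | node (j : Arity m) (σ : Equiv.Perm (Fin j.1)) (c c' : Fin j.1 → Tr m α) :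
      (∀ i, Same (c (σ i)) (c' i)) → Same (.node j c) (.node j c')

theorem Same.refl (T : Tr m α) : Same T T := by
  induction T with
  | leaf a => exact .leaf a
  | node j c ih => exact .node j 1 c c ih

theorem Same.symm {T S : Tr m α} (h : Same T S) : Same S T := by
  induction h with
  | leaf a => exact .leaf a
  | node j σ c c' _ ih =>
    refine .node j σ⁻¹ c' c fun i => ?_
    simpa using ih (σ⁻¹ i)

theorem Same.trans {T S : Tr m α} (h : Same T S) : ∀ {R : Tr m α}, Same S R → Same T R := by
  induction h with
  | leaf a => exact fun h' => h'
  | node j σ c c' _ ih =>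
    intro R h'
    cases h' with
    | node _ τ _ c'' h'' => exact .node j (σ * τ) c c'' fun i => ih (τ i) (h'' i)

theorem occ_map_of_injective [DecidableEq α] [DecidableEq β] {f : α → β}
    (hf : Function.Injective f) (a : α) (T : Tr m α) : occ (f a) (map f T) = occ a T := by
  induction T with
  | leaf b => simp [map, occ, hf.eq_iff]
  | node j c ih => simp [map, occ, ih]

theorem occ_map_of_notMem [DecidableEq β] {f : α → β} {b : β}
    (hb : ∀ a, f a ≠ b) (T : Tr m α) : occ b (map f T) = 0 := by
  induction T with
  | leaf a => simp [map, occ, hb]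
  | node j c ih => simp [map, occ, ih]

end Tr

/-- Planar `n`-trees: the input legs are labelled bijectively by `Fin n = {0, …, n - 1}`. -/
abbrev LTree (m : ℕ∞) (n : ℕ) : Type := {T : Tr m (Fin n) // ∀ a, Tr.occ a T = 1}

/-- Relabelling of the input legs of an `n`-tree by a permutation. -/
def LTree.relabel {m : ℕ∞} {n : ℕ} (σ : Equiv.Perm (Fin n)) (T : LTree m n) : LTree m n :=
  ⟨T.1.map σ, fun a => by
    have h := Tr.occ_map_of_injective σ.injective (σ⁻¹ a) T.1
    rw [T.2] at h
    simpa using h⟩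

/-- The tree without vertices. -/
def LTree.unit (m : ℕ∞) : LTree m 1 := ⟨.leaf 0, fun a => by simp [Tr.occ, Subsingleton.elim a 0]⟩

/-- The grafting `ξ_j(T_1, …, T_j)` onto the `j`-corolla; the labels of the trees `T_i` are
shifted so as to form consecutive blocks. -/
def LTree.graft {m : ℕ∞} (j : Arity m) (n : Fin j.1 → ℕ) (T : (i : Fin j.1) → LTree m (n i)) :
    LTree m (∑ i, n i) :=
  ⟨.node j fun i => (T i).1.map fun a => finSigmaFinEquiv ⟨i, a⟩, fun b => by
    obtain ⟨⟨i, a⟩, rfl⟩ := finSigmaFinEquiv.surjective b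
    rw [Tr.occ, Finset.sum_eq_single i]
    · rw [Tr.occ_map_of_injective (f := fun a => finSigmaFinEquiv ⟨i, a⟩)
        (fun x y h => by simpa using h) a (T i).1, (T i).2]
    · intro i' _ hi
      exact Tr.occ_map_of_notMem
        (fun a' h => hi (congrArg Sigma.fst (finSigmaFinEquiv.injective h))) _
    · intro h
      exact absurd (Finset.mem_univ i) h⟩

/-- Planar admissible `n`-trees that have the same underlying non-planar tree. -/
instance admSetoid (m : ℕ∞) (n : ℕ) : Setoid {T : LTree m n // T.1.Admissible} where
  r T S := Tr.Same T.1.1 S.1.1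
  iseqv := ⟨fun _ => .refl _, fun h => h.symm, fun h h' => h.trans h'⟩

/-- The set of admissible non-planar labelled `n`-trees. -/
def AdmTree (m : ℕ∞) (n : ℕ) : Type := Quotient (admSetoid m n)

/-! ### The operad -/

section Operad

variable (k : Type*) [Field k]

/-- The expression of the antisymmetry of the generators, with trees grafted on the inputs:
`ξ_j(T_{σ 1}, …, T_{σ j}) - χ(σ; T) ξ_j(T_1, …, T_j)`. -/
inductive IsAntisymm {m : ℕ∞} {α : Type} : (Tr m α →₀ k) → Prop where
  | mk (j : Arity m) (T : Fin j.1 → Tr m α) (σ : Equiv.Perm (Fin j.1)) :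
      IsAntisymm (Finsupp.single (Tr.node j fun a => T (σ a)) 1 -
        chi σ (fun a => (T a).deg) • Finsupp.single (Tr.node j T) 1)

/-- The defining relation of L(m)-algebras in the language of trees, with trees `T_1, …, T_n`
grafted on the inputs:
`∑_{i+j=n+1} ∑_σ χ(σ; T) (-1)^{i(j-1)} ξ_j(ξ_i(T_{σ 1}, …, T_{σ i}), T_{σ (i+1)}, …, T_{σ n})`. -/
inductive IsJacobi {m : ℕ∞} {α : Type} : (Tr m α →₀ k) → Prop where
  | mk (n : Arity m) (T : Fin n.1 → Tr m α) :
      IsJacobi (∑ p : Fin n.1, ∑ σ : Equiv.Perm (Fin n.1) with IsUnshuffle (p + 1) σ,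
        (chi σ (fun a => (T a).deg) * jacobiSign n.1 p) •
          Finsupp.single (nest Tr.node n p fun a => T (σ a)) 1)

/-- The combinations of trees obtained from those satisfying `P` by iterated grafting onto an
input of a corolla, the remaining inputs of which carry arbitrary trees. -/
inductive InContext {m : ℕ∞} {α : Type} (P : (Tr m α →₀ k) → Prop) : (Tr m α →₀ k) → Prop where
  | base (r : Tr m α →₀ k) : P r → InContext P r
  | graft (j : Arity m) (T : Fin j.1 → Tr m α) (i : Fin j.1) (r : Tr m α →₀ k) :
      InContext P r →
      InContext P (Finsupp.mapDomain (fun S => Tr.node j (Function.update T i S)) r)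

/-- The span, inside the span of the planar `n`-trees, of the relations `P` in all contexts. -/
def relSpan (m : ℕ∞) (n : ℕ) (P : (Tr m (Fin n) →₀ k) → Prop) :
    Submodule k (LTree m n →₀ k) :=
  Submodule.span k {r | InContext k P (Finsupp.mapDomain Subtype.val r)}

/-- The component of arity `n` of the free graded `Σ`-operad generated by operations `ξ_j`
of arity `j` and degree `j - 2`, `1 ≤ j ≤ m`, spanning the signum representations.
A planar tree represents the composite of the operations at its vertices, the operation at the
root coming first, followed by the subtrees from left to right; hence a permutation of the input
edges of a vertex produces its signature and the Koszul sign of permuting the subtrees. -/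
def FreeOperad (m : ℕ∞) (n : ℕ) : Type _ :=
  (LTree m n →₀ k) ⧸ relSpan k m n (IsAntisymm k)

instance (m : ℕ∞) (n : ℕ) : AddCommGroup (FreeOperad k m n) :=
  inferInstanceAs (AddCommGroup ((LTree m n →₀ k) ⧸ relSpan k m n (IsAntisymm k)))

instance (m : ℕ∞) (n : ℕ) : Module k (FreeOperad k m n) :=
  inferInstanceAs (Module k ((LTree m n →₀ k) ⧸ relSpan k m n (IsAntisymm k)))

/-- The element of the free operad represented by a combination of planar trees. -/
def FreeOperad.mk (m : ℕ∞) (n : ℕ) : (LTree m n →₀ k) →ₗ[k] FreeOperad k m n :=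
  (relSpan k m n (IsAntisymm k)).mkQ

/-- The component of arity `n` of the operadic ideal generated by the Jacobi relations: the span
of all their two-sided composites with trees, with all labellings. -/
def jacobiIdeal (m : ℕ∞) (n : ℕ) : Submodule k (FreeOperad k m n) :=
  (relSpan k m n (IsJacobi k)).map (FreeOperad.mk k m n)

/-- The component of arity `n` of the operad for L(m)-algebras. -/
def LOperad (m : ℕ∞) (n : ℕ) : Type _ := FreeOperad k m n ⧸ jacobiIdeal k m n

instance (m : ℕ∞) (n : ℕ) : AddCommGroup (LOperad k m n) :=
  inferInstanceAs (AddCommGroup (FreeOperad k m n ⧸ jacobiIdeal k m n))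

instance (m : ℕ∞) (n : ℕ) : Module k (LOperad k m n) :=
  inferInstanceAs (Module k (FreeOperad k m n ⧸ jacobiIdeal k m n))

/-- The projection of the free operad onto the operad for L(m)-algebras. -/
def LOperad.mk (m : ℕ∞) (n : ℕ) : FreeOperad k m n →ₗ[k] LOperad k m n :=
  (jacobiIdeal k m n).mkQ

/-- The class of a planar tree in the operad for L(m)-algebras. -/
def treeClass {m : ℕ∞} {n : ℕ} (T : LTree m n) : LOperad k m n :=
  LOperad.mk k m n (FreeOperad.mk k m n (Finsupp.single T 1))

/-- The element of the operad given by a linear combination of admissible non-planar trees,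
where `s` chooses a planar representative (that is, an orientation) of each of them. -/
def admClass {m : ℕ∞} (s : (n : ℕ) → AdmTree m n → {T : LTree m n // T.1.Admissible}) (n : ℕ) :
    (AdmTree m n →₀ k) →ₗ[k] LOperad k m n :=
  Finsupp.linearCombination k fun τ => treeClass k (s n τ).1

/-- `Ω` rewrites each tree, modulo the Jacobi relations, as a linear combination of
admissible trees. -/
def IsNormalization {m : ℕ∞} (s : (n : ℕ) → AdmTree m n → {T : LTree m n // T.1.Admissible})
    (Ω : (n : ℕ) → LTree m n → (AdmTree m n →₀ k)) : Prop :=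
  ∀ (n : ℕ) (T : LTree m n), admClass k s n (Ω n T) = treeClass k T

end Operad

/-! ### The free algebra -/

section Free

variable {k : Type*} [Field k] {Y : Type*} [AddCommGroup Y] [Module k Y]

/-- The subspace of `L(n) ⊗ Y^{⊗ n}` spanned by the elements `σT ⊗ y - T ⊗ yσ` for `n`-trees
`T`, homogeneous `y` and permutations `σ`, where `Σ_n` acts on `L(n)` by relabelling the legs and
on `Y^{⊗ n}` by permuting the factors with the Koszul sign. -/
def coinvRel (m : ℕ∞) (𝒴 : ℤ → Submodule k Y) (n : ℕ) :
    Submodule k (LOperad k m n ⊗[k] (⨂[k] _ : Fin n, Y)) :=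
  Submodule.span k {z | ∃ (T : LTree m n) (y : Fin n → Y) (d : Fin n → ℤ)
    (σ : Equiv.Perm (Fin n)), (∀ a, y a ∈ 𝒴 (d a)) ∧
    z = treeClass k (T.relabel σ) ⊗ₜ[k] PiTensorProduct.tprod k y -
      koszulSign σ d • (treeClass k T ⊗ₜ[k] PiTensorProduct.tprod k fun a => y (σ a))}

/-- `L(n) ⊗_{Σ_n} Y^{⊗ n}`. -/
def FreePart (m : ℕ∞) (𝒴 : ℤ → Submodule k Y) (n : ℕ) : Type _ :=
  (LOperad k m n ⊗[k] (⨂[k] _ : Fin n, Y)) ⧸ coinvRel m 𝒴 n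

instance (m : ℕ∞) (𝒴 : ℤ → Submodule k Y) (n : ℕ) : AddCommGroup (FreePart m 𝒴 n) :=
  inferInstanceAs (AddCommGroup ((LOperad k m n ⊗[k] (⨂[k] _ : Fin n, Y)) ⧸ coinvRel m 𝒴 n))

instance (m : ℕ∞) (𝒴 : ℤ → Submodule k Y) (n : ℕ) : Module k (FreePart m 𝒴 n) :=
  inferInstanceAs (Module k ((LOperad k m n ⊗[k] (⨂[k] _ : Fin n, Y)) ⧸ coinvRel m 𝒴 n))

/-- The projection `L(n) ⊗ Y^{⊗ n} → L(n) ⊗_{Σ_n} Y^{⊗ n}`. -/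
def FreePart.mk (m : ℕ∞) (𝒴 : ℤ → Submodule k Y) (n : ℕ) :
    (LOperad k m n ⊗[k] (⨂[k] _ : Fin n, Y)) →ₗ[k] FreePart m 𝒴 n :=
  (coinvRel m 𝒴 n).mkQ


/-- `⨁_{n ≥ 1} L(n) ⊗_{Σ_n} Y^{⊗ n}`. -/
abbrev FreeL (m : ℕ∞) (𝒴 : ℤ → Submodule k Y) : Type _ :=
  ⨁ n : ℕ+, FreePart m 𝒴 n

/-- The element `f ⊗_{Σ_n} (y_1 ⊗ ⋯ ⊗ y_n)`. -/
def elt (m : ℕ∞) (𝒴 : ℤ → Submodule k Y) (n : ℕ+) (f : LOperad k m n) (y : Fin n → Y) :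
    FreeL m 𝒴 :=
  DirectSum.lof k ℕ+ (fun n : ℕ+ => FreePart m 𝒴 n) n
    (FreePart.mk m 𝒴 n (f ⊗ₜ[k] PiTensorProduct.tprod k y))

/-- The degree of `T ⊗ (y_1 ⊗ ⋯ ⊗ y_n)` is `deg T + |y_1| + ⋯ + |y_n|`. -/
def freeGrading (m : ℕ∞) (𝒴 : ℤ → Submodule k Y) (e : ℤ) : Submodule k (FreeL m 𝒴) :=
  Submodule.span k {z | ∃ (n : ℕ+) (T : LTree m n) (y : Fin n → Y) (d : Fin n → ℤ),
    (∀ a, y a ∈ 𝒴 (d a)) ∧ T.1.deg + ∑ a, d a = e ∧ z = elt m 𝒴 n (treeClass k T) y}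

/-- A sum of positively many positive integers. -/
def sumPos {m : ℕ∞} (j : Arity m) (n : Fin j.1 → ℕ+) : ℕ+ :=
  ⟨∑ i, (n i : ℕ), Finset.sum_pos (fun i _ => (n i).pos) ⟨⟨0, j.2.1⟩, Finset.mem_univ _⟩⟩

/-- The concatenation of `j` words of lengths `n_1, …, n_j`. -/
def concat {X : Type*} {m : ℕ∞} (j : Arity m) (n : Fin j.1 → ℕ+)
    (x : (i : Fin j.1) → Fin (n i) → X) : Fin (sumPos j n) → X :=
  fun a => let p := (finSigmaFinEquiv (n := fun i => (n i : ℕ))).symm a; x p.1 p.2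

/-- The Koszul sign of
`T_1 ⊗ v_1 ⊗ ⋯ ⊗ T_j ⊗ v_j ↦ T_1 ⊗ ⋯ ⊗ T_j ⊗ v_1 ⊗ ⋯ ⊗ v_j` for `T_i` of degree `t i` and
`v_i` of degree `e i`: each `T_b` passes all `v_a` with `a < b`. -/
def shuffleSign {j : ℕ} (t e : Fin j → ℤ) : ℤˣ :=
  ∏ a : Fin j, ∏ b : Fin j, if a < b then Int.negOnePow (e a * t b) else 1

/-- The rule `l_j(T_1 ⊗ v_1, …, T_j ⊗ v_j) = ± Ω(ξ_j(T_1, …, T_j)) ⊗ (v_1 ⊗ ⋯ ⊗ v_j)` for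
admissible trees `T_i` and tensors `v_i` of homogeneous elements, with the Koszul sign. -/
def IsGraftingRule {m : ℕ∞} (𝒴 : ℤ → Submodule k Y)
    (s : (n : ℕ) → AdmTree m n → {T : LTree m n // T.1.Admissible})
    (Ω : (n : ℕ) → LTree m n → (AdmTree m n →₀ k))
    (l : (j : Arity m) → MultilinearMap k (fun _ : Fin j.1 => FreeL m 𝒴) (FreeL m 𝒴)) : Prop :=
  ∀ (j : Arity m) (n : Fin j.1 → ℕ+) (T : (i : Fin j.1) → LTree m (n i))
    (v : (i : Fin j.1) → Fin (n i) → Y) (d : (i : Fin j.1) → Fin (n i) → ℤ),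
    (∀ i, (T i).1.Admissible) → (∀ i a, v i a ∈ 𝒴 (d i a)) →
    l j (fun i => elt m 𝒴 (n i) (treeClass k (T i)) (v i)) =
      shuffleSign (fun i => (T i).1.deg) (fun i => ∑ a, d i a) •
        elt m 𝒴 (sumPos j n)
          (admClass k s (sumPos j n) (Ω (sumPos j n) (LTree.graft j (fun i => (n i : ℕ)) T)))
          (concat j n v)

end Free

end HomotopyLie

end

open scoped TensorProduct DirectSum

noncomputable section

namespace HomotopyLie

/-! Spanning. In the `n`-th Jacobi identity the term with `i = n` is, up to sign, a unary vertex
whose input is `ξ_n(T_1, …, T_n)`. It is therefore a combination of trees whose root has at least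
two inputs, and in these a new unary vertex appears only for `i = 1`, with one of the smaller trees
`T_a` as its input. Induction on the tree pushes all unary vertices to the leaves
(`of_mem_span_admissible`).

Independence. It suffices to find an L(m)-algebra in which the admissible trees take independent
values. By décalage (`lAxioms_decOp`) such a structure amounts to graded symmetric operations `l` of
degree `-1` whose quadratic Jacobi sums vanish. They can be manufactured from symmetric operations
`f` of degree `0` with `f(b) = b` and a differential `D`: the equation `D f(w) = ∑ ± f(l(I), K)`,
summed over the splittings of `w`, determines `l` recursively, and `D² = 0` forces the Jacobi
identities (`usum_perturb_perturb`). In the language of coalgebras, `l` is `D` conjugated by the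
automorphism of the symmetric coalgebra with components `f`. Here `f` creates an unmarked vertex and
`D` marks the root. For two or more distinct inputs `l(w)` is then, up to sign, the marked vertex
over `w` plus trees that contain an unmarked vertex, while `l(b) = D b`. So an admissible tree with
distinct labels evaluates, modulo trees with an unmarked vertex, to plus or minus a single decorated
tree, from which it can be recovered (`Tr.decEval_sub_mem`, `Tr.same_of_decorate_eq`).

Free algebra. For a homogeneous basis `b` of `Y`, trees with leaves coloured by the basis, modulo
antisymmetry and Jacobi in all contexts, form a free L(m)-algebra almost by construction
(`ColAlg.existsUnique_hom`). The map sending `T ⊗ (b_{w 1} ⊗ ⋯ ⊗ b_{w n})` to the coloured tree,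
times the Koszul sign `Tr.sgn` of separating leaves from vertices and sorting the leaves, identifies
it with `𝔏_m(Y)` (`freeEquiv`). It is well defined because relations between labelled trees become
relations between coloured trees, and invertible because every coloured relation lifts to one with
distinct labels. Transporting the operations gives the grafting rule by `LTree.sgn_graft`; `Ω` plays
no further role, since `Ω(T)` and `T` have the same class in the operad.

Characteristic zero enters twice: to divide by `2` in the proof of the Jacobi identities, and to
separate degrees by the eigenvalues `2 ^ d`. -/

/-! ### Signs of permutations as products over pairs -/

/-- The product of `s a b` over all `a < b`. -/
def pairProd {n : ℕ} (s : Fin n → Fin n → ℤˣ) : ℤˣ :=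
  ∏ a, ∏ b, if a < b then s a b else 1

/-- The product of `κ x y` over the pairs that are inverted by `σ`. -/
def invProd {n : ℕ} (σ : Equiv.Perm (Fin n)) (κ : Fin n → Fin n → ℤˣ) : ℤˣ :=
  ∏ a, ∏ b, if a < b ∧ σ b < σ a then κ (σ a) (σ b) else 1

theorem invProd_congr {n : ℕ} (σ : Equiv.Perm (Fin n)) {κ κ' : Fin n → Fin n → ℤˣ}
    (h : ∀ x y, x ≠ y → κ x y = κ' x y) : invProd σ κ = invProd σ κ' := by
  refine Finset.prod_congr rfl fun a _ => Finset.prod_congr rfl fun b _ => ?_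
  split_ifs with hab
  · exact h _ _ hab.2.ne'
  · rfl

theorem invProd_mul {n : ℕ} (σ : Equiv.Perm (Fin n)) (κ κ' : Fin n → Fin n → ℤˣ) :
    invProd σ (fun x y => κ x y * κ' x y) = invProd σ κ * invProd σ κ' := by
  simp only [invProd, ← Finset.prod_mul_distrib]
  refine Finset.prod_congr rfl fun a _ => Finset.prod_congr rfl fun b _ => ?_
  split_ifs <;> simp

theorem pairProd_congr {n : ℕ} {s s' : Fin n → Fin n → ℤˣ}
    (h : ∀ x y, x < y → s x y = s' x y) : pairProd s = pairProd s' := by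
  refine Finset.prod_congr rfl fun a _ => Finset.prod_congr rfl fun b _ => ?_
  split_ifs with hab
  · exact h _ _ hab
  · rfl

theorem pairProd_mul {n : ℕ} (s s' : Fin n → Fin n → ℤˣ) :
    pairProd (fun x y => s x y * s' x y) = pairProd s * pairProd s' := by
  simp only [pairProd, ← Finset.prod_mul_distrib]
  refine Finset.prod_congr rfl fun a _ => Finset.prod_congr rfl fun b _ => ?_
  split_ifs <;> simp

/-- Reordering the arguments replaces `s x y` by `s y x` exactly for the inverted pairs. As signs
square to `1`, this is multiplication by `s x y * s y x` over those pairs. -/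
theorem pairProd_comp {n : ℕ} (σ : Equiv.Perm (Fin n)) (s : Fin n → Fin n → ℤˣ) :
    pairProd (fun a b => s (σ a) (σ b)) = pairProd s * invProd σ fun x y => s x y * s y x := by
  have reindex : ∀ g : Fin n → Fin n → Fin n → Fin n → ℤˣ,
      ∏ a, ∏ b, g a b (σ a) (σ b) = ∏ x, ∏ y, g (σ.symm x) (σ.symm y) x y := by
    intro g
    rw [← Equiv.prod_comp σ fun x => ∏ y, g (σ.symm x) (σ.symm y) x y]
    refine Finset.prod_congr rfl fun a _ => ?_
    rw [← Equiv.prod_comp σ fun y => g (σ.symm (σ a)) (σ.symm y) (σ a) y]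
    simp
  have h1 := reindex fun a b x y => if a < b then s x y else 1
  have h2 := reindex fun a b x y => if a < b ∧ y < x then s x y else 1
  have h3 := reindex fun a b x y => if a < b ∧ y < x then s y x else 1
  rw [invProd_mul, pairProd, invProd, invProd, h1, h2, h3, Finset.prod_comm
    (f := fun x y => if σ.symm x < σ.symm y ∧ y < x then s y x else 1)]
  simp only [pairProd, ← Finset.prod_mul_distrib]
  refine Finset.prod_congr rfl fun x _ => Finset.prod_congr rfl fun y _ => ?_
  have hs : s x y * s x y = 1 := Int.units_mul_self _
  rcases lt_trichotomy x y with h | rfl | h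
  · rcases lt_trichotomy (σ.symm x) (σ.symm y) with h' | h' | h'
    · simp [h, h', h.not_gt, h'.not_gt]
    · exact absurd (σ.symm.injective h') h.ne
    · simp [h, h', h.not_gt, h'.not_gt, hs]
  · simp
  · rcases lt_trichotomy (σ.symm x) (σ.symm y) with h' | h' | h'
    · simp [h, h', h.not_gt, h'.not_gt]
    · exact absurd (σ.symm.injective h') h.ne'
    · simp [h, h', h.not_gt, h'.not_gt]

theorem koszulSign_eq_invProd {n : ℕ} (σ : Equiv.Perm (Fin n)) (d : Fin n → ℤ) :
    koszulSign σ d = invProd σ fun x y => Int.negOnePow (d x * d y) := rfl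

theorem sign_eq_invProd {n : ℕ} (σ : Equiv.Perm (Fin n)) :
    Equiv.Perm.sign σ = invProd σ fun _ _ => -1 := by
  rw [Equiv.Perm.sign_eq_prod_prod_Ioi, invProd]
  refine Finset.prod_congr rfl fun a _ => ?_
  rw [← Finset.prod_filter_mul_prod_filter_not Finset.univ (fun b => a < b),
    Finset.prod_eq_one (s := Finset.univ.filter fun b => ¬ a < b) (by
      intro b hb; simp at hb; simp [hb.not_gt]), mul_one]
  refine Finset.prod_congr (by ext; simp) fun b hb => ?_
  have hab : a < b := by simpa using hb
  rcases lt_trichotomy (σ a) (σ b) with h | h | h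
  · simp [h, h.not_gt]
  · exact absurd (σ.injective h) hab.ne
  · simp [h, h.not_gt, hab]

theorem chi_eq_invProd {n : ℕ} (σ : Equiv.Perm (Fin n)) (d : Fin n → ℤ) :
    chi σ d = invProd σ fun x y => Int.negOnePow (1 + d x * d y) := by
  rw [chi, sign_eq_invProd, koszulSign_eq_invProd, ← invProd_mul]
  simp [Int.negOnePow_add]

/-- Changing the commutation rule by a factor `s` on ordered pairs. -/
theorem invProd_mul_pairProd_comp {n : ℕ} (σ : Equiv.Perm (Fin n)) {κ κ' s : Fin n → Fin n → ℤˣ}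
    (h : ∀ x y, x ≠ y → s x y * s y x = κ x y * κ' x y) :
    invProd σ κ * pairProd (fun a b => s (σ a) (σ b)) = invProd σ κ' * pairProd s := by
  rw [pairProd_comp, invProd_congr σ h, invProd_mul, mul_comm (pairProd s), ← mul_assoc,
    ← mul_assoc, Int.units_mul_self, one_mul]

theorem negOnePow_congr {a b : ℤ} (h : Even (a - b)) : a.negOnePow = b.negOnePow :=
  (Int.negOnePow_eq_iff a b).2 h

/-! ### Signs acting on vector spaces -/

section UnitSMul

variable {k : Type*} [Field k] {V W : Type*} [AddCommGroup V] [Module k V] [AddCommGroup W]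
  [Module k W]

theorem map_unit_smul (f : V →ₗ[k] W) (u : ℤˣ) (v : V) : f (u • v) = u • f v := by
  rcases Int.units_eq_one_or u with rfl | rfl <;> simp [Units.smul_def]

theorem unit_smul_mem (N : Submodule k V) (u : ℤˣ) {v : V} (h : v ∈ N) : u • v ∈ N := by
  rcases Int.units_eq_one_or u with rfl | rfl
  · simpa
  · simpa [Units.smul_def] using N.neg_mem h

theorem unit_smul_comm (u : ℤˣ) (c : k) (v : V) : u • c • v = c • u • v := by
  rcases Int.units_eq_one_or u with rfl | rfl <;> simp [Units.smul_def]

theorem multilinear_unit_smul {ι : Type*} [DecidableEq ι]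
    (f : MultilinearMap k (fun _ : ι => V) W) (x : ι → V) (i : ι) (u : ℤˣ) (v : V) :
    f (Function.update x i (u • v)) = u • f (Function.update x i v) :=
  map_unit_smul (f.toLinearMap x i) u v

theorem unit_smul_smul_self (u : ℤˣ) (v : V) : u • u • v = v := by
  rw [smul_smul, Int.units_mul_self, one_smul]

end UnitSMul

/-! ### Multilinear maps and spanning sets -/

section Multilinear

variable {k : Type*} [Field k] {V W : Type*} [AddCommGroup V] [Module k V] [AddCommGroup W]
  [Module k W]

/-- Induction on the set of slots whose argument is only known to lie in the span; linearity frees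
one slot at a time. The sets `S i` may vary with the slot, so that each argument can have its own
prescribed degree. -/
theorem multilinear_mem_of_span {ι : Type*} [Finite ι] (F : MultilinearMap k (fun _ : ι => V) W)
    (S : ι → Set V) (N : Submodule k W) (h : ∀ x, (∀ i, x i ∈ S i) → F x ∈ N) (x : ι → V)
    (hx : ∀ i, x i ∈ Submodule.span k (S i)) : F x ∈ N := by
  classical
  have := Fintype.ofFinite ι
  suffices H : ∀ (s : Finset ι) (x : ι → V), (∀ i ∈ s, x i ∈ Submodule.span k (S i)) →
      (∀ i ∉ s, x i ∈ S i) → F x ∈ N from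
    H Finset.univ x (fun i _ => hx i) fun i hi => absurd (Finset.mem_univ i) hi
  intro s
  induction s using Finset.induction_on with
  | empty => exact fun x _ hx => h x fun i => hx i (by simp)
  | insert i s his ih =>
    intro x hx hx'
    suffices H : ∀ v ∈ Submodule.span k (S i), F (Function.update x i v) ∈ N by
      simpa using H (x i) (hx i (by simp))
    intro v hv
    induction hv using Submodule.span_induction with
    | mem v hv =>
      refine ih _ (fun a ha => ?_) fun a ha => ?_
      · rw [Function.update_of_ne (by rintro rfl; exact his ha)]
        exact hx a (by simp [ha])
      · rcases eq_or_ne a i with rfl | hai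
        · simpa
        · rw [Function.update_of_ne hai]
          exact hx' a (by simp [ha, hai])
    | zero => rw [F.map_update_zero]; exact N.zero_mem
    | add u v _ _ hu hv => rw [F.map_update_add]; exact N.add_mem hu hv
    | smul c v _ hv => rw [F.map_update_smul]; exact N.smul_mem c hv

theorem multilinear_eq_of_span {ι : Type*} [Finite ι] {F G : MultilinearMap k (fun _ : ι => V) W}
    (S : ι → Set V) (h : ∀ x, (∀ i, x i ∈ S i) → F x = G x) (x : ι → V)
    (hx : ∀ i, x i ∈ Submodule.span k (S i)) : F x = G x := by
  have := multilinear_mem_of_span (F - G) S ⊥ (fun x hx => by simp [h x hx]) x hx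
  simpa [sub_eq_zero] using this

/-- The multilinear map with given values on the tuples of elements of a basis. -/
def basisMultilinear {κ : Type*} (b : Module.Basis κ k V) {n : ℕ} (g : (Fin n → κ) → W) :
    MultilinearMap k (fun _ : Fin n => V) W :=
  ((Basis.piTensorProduct fun _ : Fin n => b).constr k g).compMultilinearMap
    (PiTensorProduct.tprod k)

theorem basisMultilinear_apply {κ : Type*} (b : Module.Basis κ k V) {n : ℕ} (g : (Fin n → κ) → W)
    (i : Fin n → κ) : basisMultilinear b g (fun a => b (i a)) = g i := by
  rw [basisMultilinear, LinearMap.compMultilinearMap_apply]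
  have := Basis.piTensorProduct_apply (R := k) (fun _ : Fin n => b) i
  rw [← this, Module.Basis.constr_basis]

end Multilinear

/-! ### Nested operations -/

section Nest

variable {m : ℕ∞} {X Z : Type*}

theorem nest_map (f : X → Z) (op : (j : Arity m) → (Fin j.1 → X) → X)
    (op' : (j : Arity m) → (Fin j.1 → Z) → Z) (n : Arity m) (p : Fin n.1) (x : Fin n.1 → X)
    (h : ∀ j y, f (op j y) = op' j fun a => f (y a)) :
    f (nest op n p x) = nest op' n p fun a => f (x a) := by
  rw [nest, h, nest]
  congr 1
  funext b
  split_ifs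
  · rw [h]
  · rfl

/-- The position of the `c`-th argument of `nest` among those of the inner operation. -/
def innerIdx (n : Arity m) (p : Fin n.1) (c : Fin n.1) (h : (c : ℕ) < p + 1) :
    Fin (innerArity n p).1 := ⟨c, h⟩

/-- The first argument of the outer operation. -/
def outerZero (n : Arity m) (p : Fin n.1) : Fin (outerArity n p).1 :=
  ⟨0, (outerArity n p).2.1⟩

/-- The position of the `c`-th argument of `nest` among those of the outer operation. -/
def outerIdx (n : Arity m) (p : Fin n.1) (c : Fin n.1) (_ : ¬ (c : ℕ) < p + 1) :
    Fin (outerArity n p).1 := ⟨c - p, by have := c.2; simp only [outerArity]; omega⟩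

/-- The arguments of the inner operation in `nest`. -/
def innerArgs (n : Arity m) (p : Fin n.1) (x : Fin n.1 → X) : Fin (innerArity n p).1 → X :=
  fun a => x ⟨a, lt_of_lt_of_le a.2 (Nat.succ_le_of_lt p.2)⟩

/-- The arguments of the outer operation in `nest`. -/
def outerArgs (n : Arity m) (p : Fin n.1) (v : X) (x : Fin n.1 → X) :
    Fin (outerArity n p).1 → X :=
  fun b => if (b : ℕ) = 0 then v
    else x ⟨p + b, by have h := b.2; simp only [outerArity] at h; omega⟩

theorem nest_eq (op : (j : Arity m) → (Fin j.1 → X) → X) (n : Arity m) (p : Fin n.1)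
    (x : Fin n.1 → X) :
    nest op n p x = op (outerArity n p) (outerArgs n p (op (innerArity n p) (innerArgs n p x)) x) :=
  rfl

theorem innerArgs_update_lt (n : Arity m) (p : Fin n.1) (x : Fin n.1 → X) (c : Fin n.1)
    (h : (c : ℕ) < p + 1) (v : X) :
    innerArgs n p (Function.update x c v) =
      Function.update (innerArgs n p x) (innerIdx n p c h) v := by
  funext a
  simp only [innerArgs, Function.update_apply, innerIdx, Fin.ext_iff]

theorem innerArgs_update_ge (n : Arity m) (p : Fin n.1) (x : Fin n.1 → X) (c : Fin n.1)
    (h : ¬ (c : ℕ) < p + 1) (v : X) :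
    innerArgs n p (Function.update x c v) = innerArgs n p x := by
  funext a
  have := a.2
  simp only [innerArity] at this
  simp only [innerArgs, Function.update_apply, Fin.ext_iff]
  rw [if_neg]
  omega

theorem outerArgs_update_lt (n : Arity m) (p : Fin n.1) (x : Fin n.1 → X) (c : Fin n.1)
    (h : (c : ℕ) < p + 1) (v u : X) :
    outerArgs n p u (Function.update x c v) = outerArgs n p u x := by
  funext b
  simp only [outerArgs, Function.update_apply, Fin.ext_iff]
  split_ifs
  · rfl
  · omega
  · rfl

theorem outerArgs_update_ge (n : Arity m) (p : Fin n.1) (x : Fin n.1 → X) (c : Fin n.1)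
    (h : ¬ (c : ℕ) < p + 1) (v u : X) :
    outerArgs n p u (Function.update x c v) =
      Function.update (outerArgs n p u x) (outerIdx n p c h) v := by
  funext b
  simp only [outerArgs, Function.update_apply, Fin.ext_iff, outerIdx]
  split_ifs <;> first | rfl | omega

/-- Exhibits the inner value as the content of one slot of the outer operation, which is what allows
linearity in that slot to be applied. -/
theorem outerArgs_eq_update (n : Arity m) (p : Fin n.1) (x : Fin n.1 → X) (v u : X) :
    outerArgs n p u x = Function.update (outerArgs n p v x) (outerZero n p) u := by
  funext b
  simp only [outerArgs, Function.update_apply, Fin.ext_iff, outerZero]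
  split_ifs <;> rfl

variable {k : Type*} [Field k] {V : Type*} [AddCommGroup V] [Module k V]

/-- A nested operation as a multilinear map. -/
def nestMultilinear (l : (j : Arity m) → MultilinearMap k (fun _ : Fin j.1 => V) V) (n : Arity m)
    (p : Fin n.1) : MultilinearMap k (fun _ : Fin n.1 => V) V :=
  MultilinearMap.mk' (fun x => nest (fun j y => l j y) n p x)
    (by
      intro x c u v
      -- An argument enters either the inner operation, and then the outer one through its first
      -- slot, or only the outer operation.
      by_cases h : (c : ℕ) < p + 1
      · simp only [nest_eq, innerArgs_update_lt n p _ c h, outerArgs_update_lt n p _ c h,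
          MultilinearMap.map_update_add]
        rw [outerArgs_eq_update n p x 0, outerArgs_eq_update n p x 0 (l _ _),
          outerArgs_eq_update n p x 0 (l _ (Function.update _ _ v)),
          MultilinearMap.map_update_add]
      · simp only [nest_eq, innerArgs_update_ge n p _ c h, outerArgs_update_ge n p _ c h,
          MultilinearMap.map_update_add])
    (by
      intro x c u v
      by_cases h : (c : ℕ) < p + 1
      · simp only [nest_eq, innerArgs_update_lt n p _ c h, outerArgs_update_lt n p _ c h,
          MultilinearMap.map_update_smul]
        rw [outerArgs_eq_update n p x 0, outerArgs_eq_update n p x 0 (l _ _),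
          MultilinearMap.map_update_smul]
      · simp only [nest_eq, innerArgs_update_ge n p _ c h, outerArgs_update_ge n p _ c h,
          MultilinearMap.map_update_smul])

/-- The left hand side of a Jacobi identity with prescribed degrees as a multilinear map. -/
def jacobiMultilinear (l : (j : Arity m) → MultilinearMap k (fun _ : Fin j.1 => V) V) (n : Arity m)
    (d : Fin n.1 → ℤ) : MultilinearMap k (fun _ : Fin n.1 => V) V :=
  -- The signs depend on degrees, not linearly on the arguments; freezing `d` makes the expression
  -- multilinear.
  ∑ p : Fin n.1, ∑ σ : Equiv.Perm (Fin n.1) with IsUnshuffle (p + 1) σ,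
    (((chi σ d * jacobiSign n.1 p : ℤˣ) : ℤ) : k) • (nestMultilinear l n p).domDomCongr σ

theorem unit_smul_eq_intCast_smul (u : ℤˣ) (v : V) : u • v = ((u : ℤ) : k) • v := by
  rw [Units.smul_def, Int.cast_smul_eq_zsmul]

theorem jacobiMultilinear_apply (l : (j : Arity m) → MultilinearMap k (fun _ : Fin j.1 => V) V)
    (n : Arity m) (d : Fin n.1 → ℤ) (x : Fin n.1 → V) :
    jacobiMultilinear l n d x =
      ∑ p : Fin n.1, ∑ σ : Equiv.Perm (Fin n.1) with IsUnshuffle (p + 1) σ,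
        (chi σ d * jacobiSign n.1 p) • nest (fun j y => l j y) n p (fun a => x (σ a)) := by
  simp only [jacobiMultilinear, sum_apply, smul_apply]
  refine Finset.sum_congr rfl fun p _ => Finset.sum_congr rfl fun σ _ => ?_
  rw [unit_smul_eq_intCast_smul (k := k)]
  rfl

/-- The axioms of an `L(m)`-algebra, apart from the decomposition into homogeneous components. -/
structure LAxioms (m : ℕ∞) (𝒱 : ℤ → Submodule k V)
    (l : (j : Arity m) → MultilinearMap k (fun _ : Fin j.1 => V) V) : Prop where
  degree : ∀ (j : Arity m) (x : Fin j.1 → V) (d : Fin j.1 → ℤ), (∀ a, x a ∈ 𝒱 (d a)) →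
    l j x ∈ 𝒱 ((j.1 : ℤ) - 2 + ∑ a, d a)
  antisymm : ∀ (j : Arity m) (x : Fin j.1 → V) (d : Fin j.1 → ℤ), (∀ a, x a ∈ 𝒱 (d a)) →
    ∀ σ : Equiv.Perm (Fin j.1), l j (fun a => x (σ a)) = chi σ d • l j x
  jacobi : ∀ (n : Arity m) (x : Fin n.1 → V) (d : Fin n.1 → ℤ), (∀ a, x a ∈ 𝒱 (d a)) →
    ∑ p : Fin n.1, ∑ σ : Equiv.Perm (Fin n.1) with IsUnshuffle (p + 1) σ,
      (chi σ d * jacobiSign n.1 p) • nest (fun j y => l j y) n p (fun a => x (σ a)) = 0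

theorem IsLAlgebra.lAxioms {𝒱 : ℤ → Submodule k V}
    {l : (j : Arity m) → MultilinearMap k (fun _ : Fin j.1 => V) V} (h : IsLAlgebra m 𝒱 l) :
    LAxioms m 𝒱 l := ⟨h.degree, h.antisymm, h.jacobi⟩

/-- It suffices to check the axioms on homogeneous generators. -/
theorem LAxioms.of_span {S : ℤ → Set V}
    {l : (j : Arity m) → MultilinearMap k (fun _ : Fin j.1 => V) V}
    (hdeg : ∀ (j : Arity m) (x : Fin j.1 → V) (d : Fin j.1 → ℤ), (∀ a, x a ∈ S (d a)) →
      l j x ∈ Submodule.span k (S ((j.1 : ℤ) - 2 + ∑ a, d a)))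
    (hanti : ∀ (j : Arity m) (x : Fin j.1 → V) (d : Fin j.1 → ℤ), (∀ a, x a ∈ S (d a)) →
      ∀ σ : Equiv.Perm (Fin j.1), l j (fun a => x (σ a)) = chi σ d • l j x)
    (hjac : ∀ (n : Arity m) (x : Fin n.1 → V) (d : Fin n.1 → ℤ), (∀ a, x a ∈ S (d a)) →
      ∑ p : Fin n.1, ∑ σ : Equiv.Perm (Fin n.1) with IsUnshuffle (p + 1) σ,
        (chi σ d * jacobiSign n.1 p) • nest (fun j y => l j y) n p (fun a => x (σ a)) = 0) :
    LAxioms m (fun d => Submodule.span k (S d)) l where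
  degree j x d hx := multilinear_mem_of_span (l j) (fun a => S (d a)) _ (fun x hx => hdeg j x d hx)
    x hx
  antisymm j x d hx σ := by
    have := multilinear_eq_of_span (F := (l j).domDomCongr σ)
      (G := (((chi σ d : ℤˣ) : ℤ) : k) • l j) (fun a => S (d a)) (fun x hx => by
        rw [smul_apply, ← unit_smul_eq_intCast_smul]
        exact hanti j x d hx σ) x hx
    rw [smul_apply, ← unit_smul_eq_intCast_smul] at this
    exact this
  jacobi n x d hx := by
    rw [← jacobiMultilinear_apply]
    exact multilinear_eq_of_span (G := 0) (fun a => S (d a)) (fun x hx => by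
      rw [jacobiMultilinear_apply]; exact hjac n x d hx) x hx

end Nest

/-! ### Sums over the arguments of nested operations -/

section NestSum

variable {m : ℕ∞}

/-- The inner operation takes the first `p + 1` arguments and its total occupies the first outer
slot; the other outer slots hold the remaining arguments. Passing to sums over ranges of naturals
avoids comparing the different `Fin` types. -/
theorem sum_outerArgs_sum_innerArgs {M : Type*} [AddCommMonoid M] (n : Arity m) (p : Fin n.1)
    (g : Fin n.1 → M) :
    ∑ b, outerArgs n p (∑ a, innerArgs n p g a) g b = ∑ a, g a := by
  obtain ⟨q, hq⟩ : ∃ q, n.1 = p + 1 + q := ⟨n.1 - (p + 1), by have := p.2; omega⟩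
  let g' : ℕ → M := fun i => if h : i < n.1 then g ⟨i, h⟩ else 0
  have hg : ∀ a : Fin n.1, g a = g' a := fun a => by simp [g']
  have h1 : ∑ a, innerArgs n p g a = ∑ i ∈ Finset.range (p + 1), g' i := by
    rw [Finset.sum_range]
    exact Finset.sum_congr rfl fun a _ => hg _
  have h2 : ∑ b, outerArgs n p (∑ a, innerArgs n p g a) g b =
      ∑ i ∈ Finset.range (q + 1), if i = 0 then (∑ a, innerArgs n p g a) else g' (p + i) := by
    have : (outerArity n p).1 = q + 1 := by simp only [outerArity]; omega
    rw [← this, Finset.sum_range]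
    refine Finset.sum_congr rfl fun b _ => ?_
    rw [outerArgs]
    split_ifs
    · rfl
    · exact hg _
  have h3 : ∑ i ∈ Finset.range n.1, g' i = ∑ i ∈ Finset.range (p + 1 + q), g' i := by rw [← hq]
  rw [h2, Finset.sum_range_succ', h1, Finset.sum_congr rfl fun a _ => hg a,
    ← Finset.sum_range (f := g'), h3, Finset.sum_range_add _ (p + 1) q, add_comm]
  simp [add_assoc, add_comm 1]

variable {X M : Type*} [AddCommMonoid M] {nd : (j : Arity m) → (Fin j.1 → X) → X} {ν : X → M}
  {c : ℕ → M}

/-- Applied to the degree (weight `j - 2` per vertex) and to the number of occurrences of a label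
(weight `0`): all terms of a Jacobi relation agree in these invariants. -/
theorem additive_nest (hν : ∀ (j : Arity m) T, ν (nd j T) = c j.1 + ∑ a, ν (T a))
    (n : Arity m) (p : Fin n.1) (T : Fin n.1 → X) :
    ν (nest nd n p T) = c (n.1 - p) + c (p + 1) + ∑ a, ν (T a) := by
  rw [nest_eq, hν, ← sum_outerArgs_sum_innerArgs n p]
  have h : ∀ v : X, (fun b => ν (outerArgs n p v T b)) =
      outerArgs n p (ν v) (fun a => ν (T a)) := fun v => by
    funext b; simp only [outerArgs]; split_ifs <;> rfl
  rw [h, hν]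
  have h' : ∀ u v : M, ∑ b, outerArgs n p (u + v) (fun a => ν (T a)) b =
      u + ∑ b, outerArgs n p v (fun a => ν (T a)) b := by
    intro u v
    rw [← Finset.add_sum_erase _ _ (Finset.mem_univ (outerZero n p)),
      ← Finset.add_sum_erase _ _ (Finset.mem_univ (outerZero n p)), ← add_assoc]
    congr 1
    refine Finset.sum_congr rfl fun b hb => ?_
    have : (b : ℕ) ≠ 0 := by
      intro h0
      exact (Finset.mem_erase.1 hb).1 (Fin.ext h0)
    simp [outerArgs, this]
  rw [h', ← add_assoc]
  rfl

end NestSum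

/-! ### The algebra generated by trees with relations -/

section Generic

variable (k : Type*) [Field k] {m : ℕ∞} {X : Type*} (nd : (j : Arity m) → (Fin j.1 → X) → X)
  (dg : X → ℤ)

/-- The antisymmetry relation. -/
def antisymmRel (j : Arity m) (T : Fin j.1 → X) (σ : Equiv.Perm (Fin j.1)) : X →₀ k :=
  Finsupp.single (nd j fun a => T (σ a)) 1 -
    chi σ (fun a => dg (T a)) • Finsupp.single (nd j T) 1

/-- The Jacobi relation. -/
def jacobiRel (n : Arity m) (T : Fin n.1 → X) : X →₀ k :=
  ∑ p : Fin n.1, ∑ σ : Equiv.Perm (Fin n.1) with IsUnshuffle (p + 1) σ,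
    (chi σ (fun a => dg (T a)) * jacobiSign n.1 p) •
      Finsupp.single (nest nd n p fun a => T (σ a)) 1

/-- The antisymmetry and Jacobi relations and all their composites with operations. -/
inductive GRel : (X →₀ k) → Prop
  | anti (j : Arity m) (T : Fin j.1 → X) (σ : Equiv.Perm (Fin j.1)) :
      GRel (antisymmRel k nd dg j T σ)
  | jac (n : Arity m) (T : Fin n.1 → X) : GRel (jacobiRel k nd dg n T)
  | graft (j : Arity m) (T : Fin j.1 → X) (i : Fin j.1) (r : X →₀ k) : GRel r →
      GRel (Finsupp.mapDomain (fun S => nd j (Function.update T i S)) r)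

/-- The span of all relations. -/
def relations : Submodule k (X →₀ k) := Submodule.span k {r | GRel k nd dg r}

/-- The quotient by all relations. -/
abbrev GenAlg : Type _ := (X →₀ k) ⧸ relations k nd dg

/-- The class of an element in the quotient by all relations. -/
def GenAlg.of (T : X) : GenAlg k nd dg := (relations k nd dg).mkQ (Finsupp.single T 1)

variable {k nd dg}

theorem span_range_single : Submodule.span k (Set.range fun T : X => Finsupp.single T (1 : k)) = ⊤ := by
  simpa using (Finsupp.basisSingleOne (R := k) (ι := X)).span_eq

theorem GRel.nonempty {r : X →₀ k} (hr : GRel k nd dg r) : Nonempty X := by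
  cases hr with
  | anti j T => exact ⟨nd j T⟩
  | jac n T => exact ⟨nd n T⟩
  | graft j T => exact ⟨nd j T⟩

theorem GenAlg.span_range_of : Submodule.span k (Set.range (GenAlg.of k nd dg)) = ⊤ := by
  have : Set.range (GenAlg.of k nd dg) =
      (relations k nd dg).mkQ '' Set.range fun T => Finsupp.single T 1 := by
    rw [← Set.range_comp]; rfl
  rw [this, Submodule.span_image, span_range_single, Submodule.map_top,
    Submodule.range_mkQ]

theorem single_mem_supported_level {N : Type*} {ν : X → N} {e : N} {T : X} (h : ν T = e) :
    Finsupp.single T (1 : k) ∈ Finsupp.supported k k {S | ν S = e} :=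
  Finsupp.single_mem_supported k _ h

theorem antisymmRel_mem_supported {M : Type*} [AddCommMonoid M] {ν : X → M} {c : ℕ → M}
    (hν : ∀ (j : Arity m) T, ν (nd j T) = c j.1 + ∑ a, ν (T a))
    (j : Arity m) (T : Fin j.1 → X) (σ : Equiv.Perm (Fin j.1)) :
    antisymmRel k nd dg j T σ ∈ Finsupp.supported k k {S | ν S = c j.1 + ∑ a, ν (T a)} := by
  refine Submodule.sub_mem _ (single_mem_supported_level ?_)
    (unit_smul_mem _ _ (single_mem_supported_level (hν j T)))
  rw [hν, Equiv.sum_comp σ fun a => ν (T a)]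

/-- The two arities `n - p` and `p + 1` have the constant sum `n + 1`, so `hc` holds for every
weight that is affine in the arity. -/
theorem jacobiRel_mem_supported {M : Type*} [AddCommMonoid M] {ν : X → M} {c : ℕ → M}
    (hν : ∀ (j : Arity m) T, ν (nd j T) = c j.1 + ∑ a, ν (T a))
    (hc : ∀ n p : ℕ, p < n → c (n - p) + c (p + 1) = c n + c 1) (n : Arity m) (T : Fin n.1 → X) :
    jacobiRel k nd dg n T ∈ Finsupp.supported k k {S | ν S = c n.1 + c 1 + ∑ a, ν (T a)} := by
  refine Submodule.sum_mem _ fun p _ => Submodule.sum_mem _ fun σ _ =>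
    unit_smul_mem _ _ (single_mem_supported_level ?_)
  rw [additive_nest hν, hc n.1 p p.2, Equiv.sum_comp σ fun a => ν (T a)]

theorem mapDomain_mem_supported_level {N N' : Type*} {ν : X → N} {ν' : X → N'} {e : N} {e' : N'}
    {f : X → X}
    (hf : ∀ S, ν S = e → ν' (f S) = e') {r : X →₀ k}
    (hr : r ∈ Finsupp.supported k k {S | ν S = e}) :
    Finsupp.mapDomain f r ∈ Finsupp.supported k k {S | ν' S = e'} := by
  classical
  rw [Finsupp.mem_supported] at hr ⊢
  intro S hS
  obtain ⟨S', hS', rfl⟩ := Finset.mem_image.1 (Finsupp.mapDomain_support hS)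
  exact hf _ (hr hS')

theorem additive_nd_update {M : Type*} [AddCommMonoid M] {ν : X → M} {c : ℕ → M}
    (hν : ∀ (j : Arity m) T, ν (nd j T) = c j.1 + ∑ a, ν (T a))
    (j : Arity m) (T : Fin j.1 → X) (i : Fin j.1) (S : X) :
    ν (nd j (Function.update T i S)) =
      c j.1 + (ν S + ∑ a ∈ Finset.univ.erase i, ν (T a)) := by
  rw [hν, ← Finset.add_sum_erase _ _ (Finset.mem_univ i), Function.update_self]
  congr 2
  refine Finset.sum_congr rfl fun a ha => ?_
  rw [Function.update_of_ne (Finset.ne_of_mem_erase ha)]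

/-- Relations are homogeneous with respect to additive invariants. -/
theorem GRel.exists_level {M : Type*} [AddCommMonoid M] {ν : X → M} {c : ℕ → M}
    (hν : ∀ (j : Arity m) T, ν (nd j T) = c j.1 + ∑ a, ν (T a))
    (hc : ∀ n p : ℕ, p < n → c (n - p) + c (p + 1) = c n + c 1) {r : X →₀ k}
    (hr : GRel k nd dg r) : ∃ e, r ∈ Finsupp.supported k k {S | ν S = e} := by
  induction hr with
  | anti j T σ => exact ⟨_, antisymmRel_mem_supported hν j T σ⟩
  | jac n T => exact ⟨_, jacobiRel_mem_supported hν hc n T⟩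
  | graft j T i r _ ih =>
    obtain ⟨e, he⟩ := ih
    exact ⟨_, mapDomain_mem_supported_level
      (fun S (hS : ν S = e) => by rw [additive_nd_update hν j T i S, hS]) he⟩

/-- Evaluation of relations in an algebra. -/
theorem GRel.linearCombination_eq_zero {A : Type*} [AddCommGroup A] [Module k A]
    {𝒜 : ℤ → Submodule k A} {l : (j : Arity m) → MultilinearMap k (fun _ : Fin j.1 => A) A}
    (hl : LAxioms m 𝒜 l) {f : X → A} (hf : ∀ j T, f (nd j T) = l j fun a => f (T a))
    (hdeg : ∀ T, f T ∈ 𝒜 (dg T)) {r : X →₀ k} (hr : GRel k nd dg r) :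
    Finsupp.linearCombination k f r = 0 := by
  induction hr with
  | anti j T σ =>
    rw [antisymmRel, map_sub, map_unit_smul, Finsupp.linearCombination_single,
      Finsupp.linearCombination_single, one_smul, one_smul, hf, hf,
      hl.antisymm j (fun a => f (T a)) _ (fun a => hdeg (T a)) σ, sub_self]
  | jac n T =>
    rw [← hl.jacobi n (fun a => f (T a)) _ fun a => hdeg (T a), jacobiRel, map_sum]
    refine Finset.sum_congr rfl fun p _ => ?_
    rw [map_sum]
    refine Finset.sum_congr rfl fun σ _ => ?_
    rw [map_unit_smul, Finsupp.linearCombination_single, one_smul,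
      nest_map f nd (fun j y => l j y) n p _ hf]
  | graft j T i r _ ih =>
    -- Evaluation turns grafting into the `i`-th slot into the linear map obtained from `l j` by
    -- fixing the other arguments, and linear maps preserve zero.
    have : (Finsupp.linearCombination k f).comp
        (Finsupp.lmapDomain k k fun S => nd j (Function.update T i S)) =
        ((l j).toLinearMap (fun a => f (T a)) i).comp (Finsupp.linearCombination k f) := by
      ext S
      simp only [LinearMap.comp_apply, Finsupp.lsingle_apply, Finsupp.lmapDomain_apply,
        Finsupp.mapDomain_single, Finsupp.linearCombination_single, one_smul, hf,
        MultilinearMap.toLinearMap_apply]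
      congr 1
      funext a
      rcases eq_or_ne a i with rfl | h
      · simp
      · simp [h]
    have := LinearMap.congr_fun this r
    simp only [LinearMap.comp_apply, Finsupp.lmapDomain_apply] at this
    rw [this, ih, map_zero]

theorem graft_mem_relations (j : Arity m) (T : Fin j.1 → X) (i : Fin j.1) {r : X →₀ k}
    (hr : r ∈ relations k nd dg) :
    Finsupp.mapDomain (fun S => nd j (Function.update T i S)) r ∈ relations k nd dg := by
  have : relations k nd dg ≤ (relations k nd dg).comap
      (Finsupp.lmapDomain k k fun S => nd j (Function.update T i S)) := by
    rw [relations, Submodule.span_le]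
    exact fun r hr => Submodule.subset_span (.graft j T i r hr)
  exact this hr

variable (k nd) in
/-- The operations on combinations of trees. -/
def freeOp (j : Arity m) : MultilinearMap k (fun _ : Fin j.1 => X →₀ k) (X →₀ k) :=
  basisMultilinear Finsupp.basisSingleOne fun T => Finsupp.single (nd j T) 1

theorem freeOp_single (j : Arity m) (T : Fin j.1 → X) :
    freeOp k nd j (fun a => Finsupp.single (T a) 1) = Finsupp.single (nd j T) 1 := by
  have := basisMultilinear_apply (Finsupp.basisSingleOne (R := k))
    (fun T => Finsupp.single (nd j T) (1 : k)) T
  simpa [freeOp] using this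

/-- The relations form an ideal: by multilinearity the other arguments may be taken to be single
trees and `x i` a generating relation, and then the operation is one of the graftings that `GRel`
allows. -/
theorem freeOp_mem_relations (j : Arity m) (x : Fin j.1 → X →₀ k) (i : Fin j.1)
    (hx : x i ∈ relations k nd dg) : freeOp k nd j x ∈ relations k nd dg := by
  classical
  refine multilinear_mem_of_span (freeOp k nd j)
    (fun a => if a = i then {r | GRel k nd dg r} else Set.range fun T => Finsupp.single T 1) _
    ?_ x ?_
  · intro x hx
    have hi : GRel k nd dg (x i) := by simpa using hx i
    -- In slot `i` any tree serves as a filler, since it is overwritten by the relation below; one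
    -- exists because a relation can only be written down if `X` is nonempty.
    have : ∀ a, ∃ T, a ≠ i → x a = Finsupp.single T 1 := fun a => by
      rcases eq_or_ne a i with rfl | h
      · exact ⟨hi.nonempty.some, fun h => absurd rfl h⟩
      · have := hx a
        rw [if_neg h] at this
        obtain ⟨T, hT⟩ := this
        exact ⟨T, fun _ => hT.symm⟩
    choose T hT using this
    have key : (freeOp k nd j).toLinearMap (fun a => Finsupp.single (T a) 1) i =
        Finsupp.lmapDomain k k fun S => nd j (Function.update T i S) := by
      refine Finsupp.lhom_ext' fun S => LinearMap.ext_ring ?_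
      simp only [LinearMap.comp_apply, Finsupp.lsingle_apply, Finsupp.lmapDomain_apply,
        Finsupp.mapDomain_single, MultilinearMap.toLinearMap_apply, ← freeOp_single]
      congr 1
      funext a
      rcases eq_or_ne a i with rfl | h
      · simp
      · simp [h]
    have hx' : x = Function.update (fun a => Finsupp.single (T a) 1) i (x i) := by
      funext a
      rcases eq_or_ne a i with rfl | h
      · simp
      · rw [Function.update_of_ne h, hT a h]
    rw [hx', ← MultilinearMap.toLinearMap_apply, key]
    exact Submodule.subset_span (.graft j T i _ hi)
  · intro a
    by_cases h : a = i
    · subst h; simpa [relations] using hx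
    · simp only [if_neg h, span_range_single, Submodule.mem_top]

/-- Telescoping: `y` is exchanged for `x` one slot at a time, and each exchange contributes a value
of `F` with an argument in `R`. -/
theorem multilinear_sub_mem {ι V W : Type*} [Finite ι] [AddCommGroup V] [Module k V]
    [AddCommGroup W] [Module k W] (F : MultilinearMap k (fun _ : ι => V) W) (R : Submodule k V)
    (N : Submodule k W) (hF : ∀ x i, x i ∈ R → F x ∈ N) (x y : ι → V)
    (h : ∀ i, x i - y i ∈ R) : F x - F y ∈ N := by
  classical
  have := Fintype.ofFinite ι
  suffices H : ∀ s : Finset ι, F (s.piecewise x y) - F y ∈ N by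
    simpa using H Finset.univ
  intro s
  induction s using Finset.induction_on with
  | empty => simp
  | insert i s his ih =>
    rw [← sub_add_sub_cancel _ (F (s.piecewise x y))]
    refine N.add_mem ?_ ih
    rw [Finset.piecewise_insert]
    nth_rw 2 [← Function.update_eq_self i (s.piecewise x y)]
    rw [← F.map_update_sub]
    refine hF _ i ?_
    simpa [his] using h i

variable (k nd dg) in
/-- The operations on the quotient by all relations. -/
def GenAlg.op (j : Arity m) :
    MultilinearMap k (fun _ : Fin j.1 => GenAlg k nd dg) (GenAlg k nd dg) :=
  -- A linear section of the projection picks representatives; `GenAlg.op_mkQ` shows that the choice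
  -- is irrelevant.
  (relations k nd dg).mkQ.compMultilinearMap ((freeOp k nd j).compLinearMap fun _ =>
    ((relations k nd dg).mkQ.exists_rightInverse_of_surjective (Submodule.range_mkQ _)).choose)

theorem GenAlg.op_mkQ (j : Arity m) (x : Fin j.1 → X →₀ k) :
    GenAlg.op k nd dg j (fun a => (relations k nd dg).mkQ (x a)) =
      (relations k nd dg).mkQ (freeOp k nd j x) := by
  have hs := ((relations k nd dg).mkQ.exists_rightInverse_of_surjective
    (Submodule.range_mkQ _)).choose_spec
  rw [GenAlg.op, LinearMap.compMultilinearMap_apply, MultilinearMap.compLinearMap_apply,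
    ← sub_eq_zero, ← map_sub, Submodule.mkQ_apply, Submodule.Quotient.mk_eq_zero]
  refine multilinear_sub_mem _ (relations k nd dg) _ (freeOp_mem_relations j) _ _ fun i => ?_
  rw [← Submodule.Quotient.mk_eq_zero, ← Submodule.mkQ_apply, map_sub, sub_eq_zero]
  exact LinearMap.congr_fun hs _

theorem GenAlg.op_of (j : Arity m) (T : Fin j.1 → X) :
    GenAlg.op k nd dg j (fun a => GenAlg.of k nd dg (T a)) = GenAlg.of k nd dg (nd j T) := by
  rw [GenAlg.of, ← freeOp_single, ← GenAlg.op_mkQ]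
  rfl

variable (k nd dg) in
/-- The generators of degree `d`. -/
def GenAlg.homogeneousGens (d : ℤ) : Set (GenAlg k nd dg) := GenAlg.of k nd dg '' {T | dg T = d}

variable (k nd dg) in
/-- The grading by the degree of trees. -/
def GenAlg.grading (d : ℤ) : Submodule k (GenAlg k nd dg) :=
  Submodule.span k (GenAlg.homogeneousGens k nd dg d)

theorem GenAlg.of_mem_grading (T : X) : GenAlg.of k nd dg T ∈ GenAlg.grading k nd dg (dg T) :=
  Submodule.subset_span ⟨T, rfl, rfl⟩

theorem GenAlg.mkQ_eq_zero {r : X →₀ k} (hr : GRel k nd dg r) : (relations k nd dg).mkQ r = 0 := by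
  rw [Submodule.mkQ_apply, Submodule.Quotient.mk_eq_zero]
  exact Submodule.subset_span hr

theorem GenAlg.lAxioms (hdg : ∀ (j : Arity m) T, dg (nd j T) = (j.1 : ℤ) - 2 + ∑ a, dg (T a)) :
    LAxioms m (GenAlg.grading k nd dg) (GenAlg.op k nd dg) := by
  have choice : ∀ {n : ℕ} {x : Fin n → GenAlg k nd dg} {d : Fin n → ℤ},
      (∀ a, x a ∈ GenAlg.homogeneousGens k nd dg (d a)) →
      ∃ T : Fin n → X, (x = fun a => GenAlg.of k nd dg (T a)) ∧ d = fun a => dg (T a) := by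
    intro n x d hx
    choose T hT hT' using hx
    exact ⟨T, funext fun a => (hT' a).symm, funext fun a => (hT a).symm⟩
  refine LAxioms.of_span ?_ ?_ ?_
  · intro j x d hx
    obtain ⟨T, rfl, rfl⟩ := choice hx
    rw [GenAlg.op_of, ← hdg]
    exact GenAlg.of_mem_grading _
  · intro j x d hx σ
    obtain ⟨T, rfl, rfl⟩ := choice hx
    rw [GenAlg.op_of j fun a => T (σ a), GenAlg.op_of, GenAlg.of, GenAlg.of, ← map_unit_smul,
      ← sub_eq_zero, ← map_sub]
    exact GenAlg.mkQ_eq_zero (.anti j T σ)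
  · intro n x d hx
    obtain ⟨T, rfl, rfl⟩ := choice hx
    rw [← GenAlg.mkQ_eq_zero (.jac n T : GRel k nd dg _), jacobiRel, map_sum]
    refine Finset.sum_congr rfl fun p _ => ?_
    rw [map_sum]
    refine Finset.sum_congr rfl fun σ _ => ?_
    rw [map_unit_smul, ← nest_map (GenAlg.of k nd dg) nd _ n p (fun a => T (σ a))
      fun j y => (GenAlg.op_of j y).symm]
    rfl

variable [CharZero k]

/-- Multiplying each tree of degree `d` by `2 ^ d` preserves the homogeneous relations, so it acts
on the quotient. The graded pieces lie in eigenspaces of this operator, which are independent. -/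
theorem GenAlg.isInternal
    (hdg : ∀ (j : Arity m) T, dg (nd j T) = (j.1 : ℤ) - 2 + ∑ a, dg (T a)) :
    DirectSum.IsInternal (GenAlg.grading k nd dg) := by
  let φ : (X →₀ k) →ₗ[k] (X →₀ k) :=
    Finsupp.linearCombination k fun T => (2 : k) ^ dg T • Finsupp.single T 1
  have hφ : ∀ e, ∀ r ∈ Finsupp.supported k k {S | dg S = e}, φ r = (2 : k) ^ e • r := by
    intro e r hr
    rw [Finsupp.supported_eq_span_single] at hr
    induction hr using Submodule.span_induction with
    | mem r hr =>
      obtain ⟨T, hT, rfl⟩ := hr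
      rw [← show dg T = e from hT]
      simp [φ]
    | zero => simp
    | add r s _ _ hr hs => rw [map_add, hr, hs, smul_add]
    | smul c r _ hr => rw [map_smul, hr, smul_comm]
  have hrel : relations k nd dg ≤ (relations k nd dg).comap φ := by
    conv_lhs => rw [relations]
    rw [Submodule.span_le]
    intro r hr
    obtain ⟨e, he⟩ := GRel.exists_level (c := fun n => (n : ℤ) - 2) hdg
      (fun n p hp => by push_cast [Nat.cast_sub hp.le]; ring) hr
    rw [SetLike.mem_coe, Submodule.mem_comap, hφ e r he]
    exact Submodule.smul_mem _ _ (Submodule.subset_span hr)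
  let Φ : Module.End k (GenAlg k nd dg) := (relations k nd dg).mapQ (relations k nd dg) φ hrel
  have hle : ∀ d, GenAlg.grading k nd dg d ≤ Module.End.eigenspace Φ ((2 : k) ^ d) := by
    intro d
    rw [GenAlg.grading, Submodule.span_le]
    rintro _ ⟨T, hT, rfl⟩
    rw [SetLike.mem_coe, Module.End.mem_eigenspace_iff]
    have : Φ (GenAlg.of k nd dg T) = (relations k nd dg).mkQ (φ (Finsupp.single T 1)) := rfl
    rw [this, hφ d _ (single_mem_supported_level hT), map_smul]
    rfl
  rw [DirectSum.isInternal_submodule_iff_iSupIndep_and_iSup_eq_top]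
  constructor
  · refine iSupIndep.mono ?_ hle
    refine (Module.End.eigenspaces_iSupIndep Φ).comp (f := fun d : ℤ => (2 : k) ^ d) ?_
    intro a b hab
    -- The powers of `2` are distinct in `ℚ`, hence in any field of characteristic zero.
    have h2 : ((2 : ℚ) : k) ^ a = ((2 : ℚ) : k) ^ b := by simpa using hab
    rw [← Rat.cast_zpow, ← Rat.cast_zpow, Rat.cast_inj] at h2
    exact zpow_right_injective₀ (by norm_num) (by norm_num) h2
  · rw [eq_top_iff, ← GenAlg.span_range_of, Submodule.span_le]
    rintro _ ⟨T, rfl⟩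
    exact Submodule.mem_iSup_of_mem (dg T) (GenAlg.of_mem_grading T)

theorem GenAlg.isLAlgebra
    (hdg : ∀ (j : Arity m) T, dg (nd j T) = (j.1 : ℤ) - 2 + ∑ a, dg (T a)) :
    IsLAlgebra m (GenAlg.grading k nd dg) (GenAlg.op k nd dg) :=
  ⟨GenAlg.isInternal hdg, (GenAlg.lAxioms hdg).degree, (GenAlg.lAxioms hdg).antisymm,
    (GenAlg.lAxioms hdg).jacobi⟩

end Generic

/-! ### Sums over unshuffles of words -/

section Unshuffle

variable {B : Type*} (e : B → ℤ) {M N : Type*} [AddCommGroup M] [AddCommGroup N]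

/-- The total degree of a word. -/
def wdeg (w : List B) : ℤ := (w.map e).sum

@[simp] theorem wdeg_nil : wdeg e [] = 0 := rfl

@[simp] theorem wdeg_cons (x : B) (w : List B) : wdeg e (x :: w) = e x + wdeg e w := by
  simp [wdeg]

@[simp] theorem wdeg_append (u w : List B) : wdeg e (u ++ w) = wdeg e u + wdeg e w := by
  simp [wdeg]

theorem wdeg_perm {u w : List B} (h : u.Perm w) : wdeg e u = wdeg e w :=
  (h.map e).sum_eq

/-- The sum, with Koszul signs, of the values of `Φ` on all decompositions of a word into two
complementary subwords. -/
def usum : List B → (List B → List B → M) → M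
  | [], Φ => Φ [] []
  | x :: w, Φ => usum w (fun A C => Φ (x :: A) C) +
      usum w fun A C => (e x * wdeg e A).negOnePow • Φ A (x :: C)

variable {e}

theorem usum_congr {w : List B} {Φ Φ' : List B → List B → M}
    (h : ∀ A C, (A ++ C).Perm w → Φ A C = Φ' A C) : usum e w Φ = usum e w Φ' := by
  induction w generalizing Φ Φ' with
  | nil => exact h [] [] (by simp)
  | cons x w ih =>
    rw [usum, usum, ih fun A C hp => h (x :: A) C (hp.cons x),
      ih (Φ := fun A C => (e x * wdeg e A).negOnePow • Φ A (x :: C)) fun A C hp => ?_]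
    rw [h A (x :: C) (List.perm_middle.trans (hp.cons x))]

theorem usum_add (w : List B) (Φ Φ' : List B → List B → M) :
    usum e w (fun A C => Φ A C + Φ' A C) = usum e w Φ + usum e w Φ' := by
  induction w generalizing Φ Φ' with
  | nil => rfl
  | cons x w ih =>
    simp only [usum, smul_add, ih]
    abel

theorem usum_map (f : M →+ N) (w : List B) (Φ : List B → List B → M) :
    f (usum e w Φ) = usum e w fun A C => f (Φ A C) := by
  induction w generalizing Φ with
  | nil => rfl
  | cons x w ih =>
    rw [usum, map_add, ih, ih, usum]
    congr 1
    refine usum_congr fun A C _ => ?_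
    rw [Units.smul_def, map_zsmul, Units.smul_def]

theorem usum_unit_smul (u : ℤˣ) (w : List B) (Φ : List B → List B → M) :
    usum e w (fun A C => u • Φ A C) = u • usum e w Φ :=
  (usum_map (DistribSMul.toAddMonoidHom M u) w Φ).symm

theorem usum_neg (w : List B) (Φ : List B → List B → M) :
    usum e w (fun A C => - Φ A C) = - usum e w Φ :=
  (usum_map (-AddMonoidHom.id M) w Φ).symm

theorem usum_zero (w : List B) : usum e w (fun _ _ => (0 : M)) = 0 :=
  (usum_map (0 : M →+ M) w fun _ _ => 0).symm

theorem usum_right_nil {w : List B} {Φ : List B → List B → M}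
    (h : ∀ A C, C ≠ [] → Φ A C = 0) : usum e w Φ = Φ w [] := by
  induction w generalizing Φ with
  | nil => rfl
  | cons x w ih =>
    rw [usum, ih fun A C hC => h (x :: A) C hC, usum_congr (Φ' := fun _ _ => 0), usum_zero,
      add_zero]
    intro A C _
    rw [h _ _ (by simp), smul_zero]

/-- Coassociativity of the unshuffle coproduct: both sides sum over the decompositions into three
subwords with the same Koszul sign. -/
theorem usum_assoc (w : List B) (Φ : List B → List B → List B → M) :
    usum e w (fun A R => usum e R fun D C => Φ A D C) =
      usum e w fun I C => usum e I fun A D => Φ A D C := by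
  induction w generalizing Φ with
  | nil => rfl
  | cons x w ih =>
    simp only [usum, smul_add, ← usum_unit_smul, usum_add]
    rw [ih, ih, ih, add_assoc]
    congr 2
    refine usum_congr fun I C _ => usum_congr fun A D hp => ?_
    rw [smul_smul, ← Int.negOnePow_add, ← wdeg_perm e hp, wdeg_append]
    congr 2
    ring

/-- Graded cocommutativity of the unshuffle coproduct. -/
theorem usum_comm (w : List B) (Φ : List B → List B → M) :
    usum e w Φ = usum e w fun A C => (wdeg e A * wdeg e C).negOnePow • Φ C A := by
  induction w generalizing Φ with
  | nil => simp [usum]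
  | cons x w ih =>
    rw [usum, usum, ih, ih fun A C => (e x * wdeg e A).negOnePow • Φ A (x :: C), add_comm]
    congr 1
    · refine usum_congr fun A C _ => ?_
      rw [smul_smul, ← Int.negOnePow_add, wdeg_cons]
      congr 2
      ring
    · refine usum_congr fun A C _ => ?_
      rw [smul_smul, ← Int.negOnePow_add, wdeg_cons]
      congr 1
      refine negOnePow_congr ⟨- e x * wdeg e A, ?_⟩
      ring

variable (e) in
/-- Graded symmetry of a function on words. -/
def WordSymm (g : List B → M) : Prop :=
  ∀ u x y v, g (u ++ x :: y :: v) = (e x * e y).negOnePow • g (u ++ y :: x :: v)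

theorem wdeg_swap (u : List B) (x y : B) (v : List B) :
    wdeg e (u ++ x :: y :: v) = wdeg e (u ++ y :: x :: v) := by
  simp; ring

/-- The unshuffle coproduct descends to symmetric words. When the two exchanged letters come first,
splittings that keep them together are matched by the symmetry of `Φ`, and those that separate them
are interchanged. -/
theorem usum_wordSymm {Φ : List B → List B → M} (h1 : ∀ C, WordSymm e fun A => Φ A C)
    (h2 : ∀ A, WordSymm e (Φ A)) : WordSymm e fun w => usum e w Φ := by
  intro u
  induction u generalizing Φ with
  | nil =>
    intro x y v
    simp only [List.nil_append, usum, smul_add, ← usum_unit_smul, ← usum_add]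
    refine usum_congr fun A C _ => ?_
    have a1 := h1 C [] x y A
    have a2 := h2 A [] x y C
    simp only [List.nil_append] at a1 a2
    rw [a1, a2]
    -- The four summands say where `x` and `y` go; exchanging the letters swaps the two mixed
    -- summands.
    have : ∀ a b c d a' b' c' d' : M, a = a' → b = c' → c = b' → d = d' →
        a + b + (c + d) = a' + b' + (c' + d') := by
      rintro _ _ _ _ _ _ _ _ rfl rfl rfl rfl; abel
    refine this _ _ _ _ _ _ _ _ rfl ?_ ?_ ?_
    · simp only [wdeg_cons, smul_smul, ← Int.negOnePow_add]
      congr 1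
      refine negOnePow_congr ⟨- (e x * e y), ?_⟩
      ring
    · simp only [wdeg_cons, smul_smul, ← Int.negOnePow_add]
      congr 2
      ring
    · simp only [smul_smul, ← Int.negOnePow_add]
      congr 2
      ring
  | cons z u ih =>
    intro x y v
    simp only [List.cons_append, usum, smul_add]
    have b1 : ∀ C, WordSymm e fun A => Φ (z :: A) C := fun C u x y v => h1 C (z :: u) x y v
    have b2 : ∀ C, WordSymm e fun A => (e z * wdeg e A).negOnePow • Φ A (z :: C) :=
      fun C u x y v => by
        have := h1 (z :: C) u x y v
        simp only at this ⊢
        rw [this, wdeg_swap, smul_comm]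
    have b3 : ∀ A, WordSymm e fun C => (e z * wdeg e A).negOnePow • Φ A (z :: C) :=
      fun A u x y v => by
        have := h2 A (z :: u) x y v
        simp only [List.cons_append] at this ⊢
        rw [this, smul_comm]
    congr 1
    · exact ih b1 (fun A => h2 (z :: A)) x y v
    · exact ih b2 b3 x y v

theorem usum_mem {k : Type*} [Field k] [Module k M] (N : Submodule k M) {w : List B}
    {Φ : List B → List B → M} (h : ∀ A C, (A ++ C).Perm w → Φ A C ∈ N) : usum e w Φ ∈ N := by
  induction w generalizing Φ with
  | nil => exact h [] [] (by simp)
  | cons x w ih =>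
    exact N.add_mem (ih fun A C hp => h _ _ (hp.cons x)) (ih fun A C hp =>
      unit_smul_mem N _ (h _ _ (List.perm_middle.trans (hp.cons x))))

end Unshuffle

/-! ### The perturbation of a differential by symmetric operations -/

section Perturbation

variable {k : Type*} [Field k] {B : Type*} {e : B → ℤ}

variable (k e) in
/-- The combinations of basis elements of degree `n`. -/
def homog (n : ℤ) : Submodule k (B →₀ k) := Finsupp.supported k k {b | e b = n}

/-- The extension of `g (b :: K)` to linear combinations of letters `b`. -/
def headExt (g : List B → B →₀ k) (v : B →₀ k) (K : List B) : B →₀ k :=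
  Finsupp.linearCombination k (fun b => g (b :: K)) v

theorem headExt_add (g : List B → B →₀ k) (u v : B →₀ k) (K : List B) :
    headExt g (u + v) K = headExt g u K + headExt g v K := map_add _ _ _

theorem headExt_sub (g : List B → B →₀ k) (u v : B →₀ k) (K : List B) :
    headExt g (u - v) K = headExt g u K - headExt g v K := map_sub _ _ _

theorem headExt_zero (g : List B → B →₀ k) (K : List B) : headExt g 0 K = 0 := map_zero _

theorem headExt_unit_smul (g : List B → B →₀ k) (u : ℤˣ) (v : B →₀ k) (K : List B) :
    headExt g (u • v) K = u • headExt g v K := map_unit_smul _ _ _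

theorem headExt_single (g : List B → B →₀ k) (b : B) (K : List B) :
    headExt g (Finsupp.single b 1) K = g (b :: K) := by
  simp [headExt]

theorem homog_induction {n : ℤ} {p : (v : B →₀ k) → v ∈ homog k e n → Prop}
    (hs : ∀ b (hb : e b = n), p (Finsupp.single b 1) (Finsupp.single_mem_supported k 1 hb))
    (h0 : p 0 (Submodule.zero_mem _))
    (ha : ∀ u v hu hv, p u hu → p v hv → p (u + v) (Submodule.add_mem _ hu hv))
    (hc : ∀ (c : k) v hv, p v hv → p (c • v) (Submodule.smul_mem _ c hv))
    {v : B →₀ k} (hv : v ∈ homog k e n) : p v hv := by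
  suffices H : ∃ h, p v h from H.choose_spec
  rw [homog, Finsupp.supported_eq_span_single] at hv
  induction hv using Submodule.span_induction with
  | mem v hv => obtain ⟨b, hb, rfl⟩ := hv; exact ⟨_, hs b hb⟩
  | zero => exact ⟨_, h0⟩
  | add u v _ _ hu hv => exact ⟨_, ha u v _ _ hu.choose_spec hv.choose_spec⟩
  | smul c v _ hv => exact ⟨_, hc c v _ hv.choose_spec⟩

theorem headExt_mem {g : List B → B →₀ k} {c : ℤ} (hg : ∀ w, g w ∈ homog k e (wdeg e w + c))
    {n : ℤ} {v : B →₀ k} (hv : v ∈ homog k e n) (K : List B) :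
    headExt g v K ∈ homog k e (n + wdeg e K + c) := by
  induction hv using homog_induction with
  | hs b hb =>
    have := hg (b :: K)
    rw [headExt_single]
    rwa [wdeg_cons, hb] at this
  | h0 => rw [headExt_zero]; exact Submodule.zero_mem _
  | ha u v _ _ hu hv => rw [headExt_add]; exact Submodule.add_mem _ hu hv
  | hc c v _ hv => rw [headExt, map_smul]; exact Submodule.smul_mem _ _ hv

theorem headExt_wordSymm {g : List B → B →₀ k} (hg : WordSymm e g) (v : B →₀ k) :
    WordSymm e (headExt g v) := by
  intro u x y w
  rw [headExt, headExt, ← map_unit_smul]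
  induction v using Finsupp.induction_linear with
  | zero => simp
  | add a b ha hb => rw [map_add, ha, hb, smul_add, map_add]
  | single b c =>
    rw [Finsupp.linearCombination_single, map_unit_smul, Finsupp.linearCombination_single,
      unit_smul_comm]
    have := hg (b :: u) x y w
    rw [List.cons_append] at this
    rw [this]
    rfl

variable (e) in
/-- Approximations to `perturb`. -/
def perturbAux (f : List B → B →₀ k) (D : (B →₀ k) →ₗ[k] (B →₀ k)) : ℕ → List B → B →₀ k
  | 0, _ => 0
  | n + 1, w => if w.length = n then
      -- The previous approximation vanishes on words of length at least `n`, so the still unknown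
      -- term `I = w` drops out and only proper subwords are subtracted.
      D (f w) - usum e w fun I K => headExt f (perturbAux f D n I) K
    else perturbAux f D n w

variable (e) in
/-- The operations `l` determined by `D f = ∑ ± f(l(…), …)`. -/
def perturb (f : List B → B →₀ k) (D : (B →₀ k) →ₗ[k] (B →₀ k)) (w : List B) : B →₀ k :=
  perturbAux e f D (w.length + 1) w

variable {f : List B → B →₀ k} {D : (B →₀ k) →ₗ[k] (B →₀ k)}

theorem perturbAux_eq_zero (n : ℕ) (w : List B) (h : n ≤ w.length) : perturbAux e f D n w = 0 := by
  induction n with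
  | zero => rfl
  | succ n ih => rw [perturbAux, if_neg (by omega), ih (by omega)]

theorem perturbAux_eq_perturb (n : ℕ) (w : List B) (h : w.length < n) :
    perturbAux e f D n w = perturb e f D w := by
  induction n with
  | zero => omega
  | succ n ih =>
    rcases eq_or_ne w.length n with rfl | h'
    · rfl
    · rw [perturbAux, if_neg h', ih (by omega)]

theorem perturb_eq (w : List B) : perturb e f D w =
    D (f w) - usum e w fun I K => headExt f (perturbAux e f D w.length I) K := by
  rw [perturb, perturbAux, if_pos rfl]

theorem perturb_nil (hf0 : f [] = 0) : perturb e f D [] = 0 := by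
  rw [perturb_eq, hf0, map_zero, usum]
  simp [perturbAux, headExt_zero]

theorem headExt_nil (hf1 : ∀ b, f [b] = Finsupp.single b 1) (v : B →₀ k) : headExt f v [] = v := by
  rw [headExt, Finsupp.linearCombination_apply]
  simp [hf1]

/-- The recursion omits the summand `I = w`, which equals `l(w)` because `f [b] = b`. Restoring it
gives the equation `D f = ∑ ± f(l(I), K)` that characterises `l`. -/
theorem usum_headExt_perturb (hf1 : ∀ b, f [b] = Finsupp.single b 1) (w : List B) :
    usum e w (fun I K => headExt f (perturb e f D I) K) = D (f w) := by
  have h : usum e w (fun I K =>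
      headExt f (perturb e f D I - perturbAux e f D w.length I) K) = perturb e f D w := by
    rw [usum_congr (Φ' := fun I K => if K = [] then
      headExt f (perturb e f D I - perturbAux e f D w.length I) K else 0), usum_right_nil,
      if_pos rfl, headExt_nil hf1, perturbAux_eq_zero _ _ le_rfl, sub_zero]
    · exact fun A C hC => if_neg hC
    · intro A C hp
      split_ifs with hC
      · rfl
      · have h1 := hp.length_eq
        have h2 := List.length_pos_iff.2 hC
        rw [List.length_append] at h1
        rw [perturbAux_eq_perturb _ _ (by omega), sub_self, headExt_zero]
  have h2 := perturb_eq (e := e) (f := f) (D := D) w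
  rw [eq_sub_iff_add_eq] at h2
  rw [← h2]
  conv_rhs => rw [← h, ← usum_add]
  refine usum_congr fun A C _ => ?_
  rw [headExt_sub, sub_add_cancel]

theorem perturb_mem (hf : ∀ w, f w ∈ homog k e (wdeg e w))
    (hD : ∀ n, ∀ v ∈ homog k e n, D v ∈ homog k e (n - 1)) (w : List B) :
    perturb e f D w ∈ homog k e (wdeg e w - 1) := by
  have : ∀ n w, perturbAux e f D n w ∈ homog k e (wdeg e w - 1) := by
    intro n
    induction n with
    | zero => exact fun w => Submodule.zero_mem _
    | succ n ih =>
      intro w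
      rw [perturbAux]
      split_ifs
      · refine Submodule.sub_mem _ (hD _ _ (hf w)) (usum_mem _ fun A C hp => ?_)
        have := headExt_mem (c := 0) (by simpa using hf) (ih A) C
        rw [← wdeg_perm e hp, wdeg_append]
        convert this using 2
        ring
      · exact ih w
  exact this _ _

theorem perturb_wordSymm (hf : WordSymm e f) : WordSymm e (perturb e f D) := by
  have : ∀ n, WordSymm e (perturbAux e f D n) := by
    intro n
    induction n with
    | zero => exact fun u x y v => by simp [perturbAux]
    | succ n ih =>
      intro u x y v
      have hlen : (u ++ x :: y :: v).length = (u ++ y :: x :: v).length := by simp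
      rw [perturbAux, perturbAux, hlen]
      split_ifs
      · rw [smul_sub, hf u x y v, map_unit_smul]
        congr 1
        refine usum_wordSymm (Φ := fun I K => headExt f (perturbAux e f D n I) K)
          (fun C u x y v => ?_) (fun A => headExt_wordSymm hf _) u x y v
        simp only
        rw [ih u x y v, headExt_unit_smul]
      · exact ih u x y v
  intro u x y v
  have hlen : (u ++ x :: y :: v).length = (u ++ y :: x :: v).length := by simp
  rw [perturb, perturb, hlen]
  exact this _ u x y v

/-- The extension of `f (b :: b' :: C)` to linear combinations of the first two letters. -/
def headExt₂ (f : List B → B →₀ k) (u v : B →₀ k) (C : List B) : B →₀ k :=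
  Finsupp.linearCombination k (fun b => headExt f u (b :: C)) v

/-- The symmetry of `f` in its first two letters, extended bilinearly to homogeneous combinations.
-/
theorem headExt₂_comm (hf : WordSymm e f) {p q : ℤ} {u v : B →₀ k} (hu : u ∈ homog k e p)
    (hv : v ∈ homog k e q) (C : List B) :
    headExt₂ f u v C = (p * q).negOnePow • headExt₂ f v u C := by
  induction hv using homog_induction with
  | hs b hb =>
    rw [headExt₂, Finsupp.linearCombination_single, one_smul]
    induction hu using homog_induction with
    | hs a ha =>
      rw [headExt₂, Finsupp.linearCombination_single, one_smul, headExt_single, headExt_single,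
        ← ha, ← hb]
      exact hf [] a b C
    | h0 => simp [headExt_zero, headExt₂]
    | ha u v _ _ hu hv => rw [headExt_add, hu, hv, headExt₂, headExt₂, headExt₂, map_add, smul_add]
    | hc c v _ hv =>
      rw [headExt₂, map_smul, unit_smul_comm, ← headExt₂, ← hv, headExt, map_smul, ← headExt]
  | h0 => simp [headExt_zero, headExt₂, Finsupp.linearCombination_apply]
  | ha v w _ _ hv hw =>
    have : headExt₂ f (v + w) u C = headExt₂ f v u C + headExt₂ f w u C := by
      simp only [headExt₂, headExt_add, Finsupp.linearCombination_apply, Finsupp.sum, smul_add,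
        Finset.sum_add_distrib]
    rw [this, smul_add, ← hv, ← hw, headExt₂, map_add, ← headExt₂, ← headExt₂]
  | hc c v _ hv =>
    have : headExt₂ f (c • v) u C = c • headExt₂ f v u C := by
      simp only [headExt₂, headExt, map_smul, Finsupp.linearCombination_apply, Finsupp.sum,
        Finset.smul_sum, smul_comm c]
    rw [this, unit_smul_comm, ← hv, headExt₂, map_smul, ← headExt₂]

/-- The leading letter `v` either enters `l` as its first argument or stays outside; in the second
case it is passed by the letters `D`. -/
theorem usum_headExt_cons {l : List B → B →₀ k} (f : List B → B →₀ k) {n : ℤ} (v : B →₀ k)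
    (hv : v ∈ homog k e n) (R : List B) :
    headExt (fun w => usum e w fun I K => headExt f (l I) K) v R =
      usum e R (fun D C => headExt f (headExt l v D) C) +
        usum e R fun D C => (n * wdeg e D).negOnePow • headExt₂ f (l D) v C := by
  induction hv using homog_induction with
  | hs b hb =>
    rw [headExt_single, usum]
    congr 1
    · refine usum_congr fun A C _ => ?_
      rw [headExt_single]
    · refine usum_congr fun A C _ => ?_
      rw [headExt₂, Finsupp.linearCombination_single, one_smul, hb]
  | h0 => simp [headExt_zero, headExt₂, usum_zero]
  | ha v w _ _ hv hw =>
    rw [headExt_add, hv, hw, add_add_add_comm, ← usum_add, ← usum_add]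
    congr 1
    · exact usum_congr fun A C _ => by rw [headExt_add, headExt_add]
    · exact usum_congr fun A C _ => by rw [← smul_add, headExt₂, headExt₂, headExt₂, map_add]
  | hc c v _ hv =>
    have hs : ∀ (g : List B → B →₀ k) (u : B →₀ k) K, headExt g (c • u) K = c • headExt g u K :=
      fun g u K => map_smul _ _ _
    rw [hs, hv, smul_add]
    have key : ∀ Φ : List B → List B → B →₀ k, c • usum e R Φ = usum e R fun A C => c • Φ A C :=
      fun Φ => usum_map (DistribSMul.toAddMonoidHom (B →₀ k) c) R Φ
    rw [key, key]
    congr 1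
    · refine usum_congr fun A C _ => ?_
      rw [hs, hs]
    · refine usum_congr fun A C _ => ?_
      rw [headExt₂, headExt₂, map_smul, unit_smul_comm]

/-- The operations `perturb` satisfy the Jacobi identities. -/
theorem usum_perturb_perturb [CharZero k] (hf1 : ∀ b, f [b] = Finsupp.single b 1)
    (hf : ∀ w, f w ∈ homog k e (wdeg e w)) (hfs : WordSymm e f)
    (hD : ∀ n, ∀ v ∈ homog k e n, D v ∈ homog k e (n - 1)) (hDD : ∀ v, D (D v) = 0) (w : List B) :
    usum e w (fun I K => headExt (perturb e f D) (perturb e f D I) K) = 0 := by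
  set l := perturb e f D with hl
  have hlmem : ∀ w, l w ∈ homog k e (wdeg e w - 1) := perturb_mem hf hD
  have hF : (fun w => usum e w fun I K => headExt f (l I) K) = fun w => D (f w) :=
    funext fun w => usum_headExt_perturb hf1 w
  have hFD : ∀ (v : B →₀ k) R, headExt (fun w => D (f w)) v R = D (headExt f v R) := by
    intro v R
    rw [headExt, headExt, ← LinearMap.comp_apply]
    congr 1
    ext b
    simp
  -- The composite `l ∘ l`, inserted into `f`, vanishes: this is `D (D (f w)) = 0` after expanding
  -- both applications of `D`.
  have step : ∀ w, usum e w (fun I C =>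
      headExt f (usum e I fun I K => headExt l (l I) K) C) = 0 := by
    intro w
    have e1 : usum e w (fun I C => headExt f (usum e I fun I K => headExt l (l I) K) C) =
        usum e w fun A R => usum e R fun D C => headExt f (headExt l (l A) D) C := by
      rw [usum_assoc w fun A D C => headExt f (headExt l (l A) D) C]
      refine usum_congr fun I C _ => ?_
      exact usum_map (Finsupp.linearCombination k fun b => f (b :: C)).toAddMonoidHom I _
    -- The terms in which two disjoint subwords are bracketed separately.
    set T := usum e w fun A R => usum e R fun D C =>
      ((wdeg e A - 1) * wdeg e D).negOnePow • headExt₂ f (l D) (l A) C with hT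
    have e2 : usum e w (fun A R => usum e R fun D C => headExt f (headExt l (l A) D) C) + T =
        0 := by
      rw [hT, ← usum_add]
      have : usum e w (fun A R => D (headExt f (l A) R)) = 0 := by
        have := usum_map (e := e) D.toAddMonoidHom w fun A R => headExt f (l A) R
        simp only [LinearMap.toAddMonoidHom_coe] at this
        rw [← this, congrFun hF w, hDD]
      rw [← this]
      refine usum_congr fun A R _ => ?_
      rw [← usum_headExt_cons f (l A) (hlmem A) R, hF, hFD]
    -- Exchanging the two brackets is odd, because each of them lowers the degree by one.
    have e3 : T = - T := by
      conv_lhs => rw [hT, usum_assoc w fun A D C =>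
        ((wdeg e A - 1) * wdeg e D).negOnePow • headExt₂ f (l D) (l A) C]
      rw [hT, usum_assoc w fun A D C =>
        ((wdeg e A - 1) * wdeg e D).negOnePow • headExt₂ f (l D) (l A) C, ← usum_neg]
      refine usum_congr fun I C _ => ?_
      conv_lhs => rw [usum_comm]
      rw [← usum_neg]
      refine usum_congr fun A E _ => ?_
      rw [headExt₂_comm hfs (hlmem A) (hlmem E), smul_smul, smul_smul, ← Int.negOnePow_add,
        ← Int.negOnePow_add, ← Units.neg_smul, ← Int.negOnePow_succ]
      congr 1
      refine negOnePow_congr ⟨wdeg e A * wdeg e E - wdeg e A, ?_⟩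
      ring
    have e4 : T = 0 := by
      have : (2 : k) • T = 0 := by
        rw [two_smul]
        nth_rw 1 [e3]
        exact neg_add_cancel T
      exact (smul_eq_zero.1 this).resolve_left two_ne_zero
    rw [e1]
    simpa [e4] using e2
  -- By induction on the length, all summands with nonempty `C` vanish; the one with `C = []` is the
  -- Jacobi sum itself, since `f [b] = b`.
  have main : ∀ (n : ℕ) (w : List B), w.length = n →
      usum e w (fun I K => headExt l (l I) K) = 0 := by
    intro n
    induction n using Nat.strong_induction_on with
    | _ n ih =>
      intro w hw
      rw [eq_comm, ← step w, usum_congr (w := w) (Φ := fun I C =>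
        headExt f (usum e I fun I K => headExt l (l I) K) C)
        (Φ' := fun I C => if C = [] then
          headExt f (usum e I fun I K => headExt l (l I) K) C else 0), usum_right_nil,
        if_pos rfl, headExt_nil hf1]
      · exact fun A C hC => if_neg hC
      · intro A C hp
        split_ifs with hC
        · rfl
        · have h1 := hp.length_eq
          have h2 := List.length_pos_iff.2 hC
          rw [List.length_append] at h1
          rw [ih A.length (by omega) A rfl, headExt_zero]
  exact main _ w rfl

end Perturbation

/-! ### Unshuffles as permutations and as decompositions of words -/

section Bridge

/-- The permutation with `q ↦ 0` that agrees with `τ` on the remaining positions. -/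
def insertPerm {n : ℕ} (q : Fin (n + 1)) (τ : Equiv.Perm (Fin n)) : Equiv.Perm (Fin (n + 1)) :=
  (finSuccEquiv' q).trans ((Equiv.optionCongr τ).trans (finSuccEquiv' 0).symm)

@[simp] theorem insertPerm_self {n : ℕ} (q : Fin (n + 1)) (τ : Equiv.Perm (Fin n)) :
    insertPerm q τ q = 0 := by
  simp [insertPerm]

@[simp] theorem insertPerm_succAbove {n : ℕ} (q : Fin (n + 1)) (τ : Equiv.Perm (Fin n))
    (a : Fin n) : insertPerm q τ (q.succAbove a) = (τ a).succ := by
  simp [insertPerm]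

theorem insertPerm_lt {n : ℕ} (q : Fin (n + 1)) (τ : Equiv.Perm (Fin n)) (a : ℕ) (h : a < q) :
    insertPerm q τ ⟨a, h.trans q.2⟩ = (τ ⟨a, by omega⟩).succ := by
  rw [← insertPerm_succAbove q τ, Fin.succAbove_of_castSucc_lt _ _ (by simpa [Fin.lt_def])]
  rfl

theorem insertPerm_gt {n : ℕ} (q : Fin (n + 1)) (τ : Equiv.Perm (Fin n)) (a : ℕ) (h : (q : ℕ) ≤ a)
    (ha : a < n) : insertPerm q τ ⟨a + 1, by omega⟩ = (τ ⟨a, ha⟩).succ := by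
  rw [← insertPerm_succAbove q τ, Fin.succAbove_of_le_castSucc _ _ (by simpa [Fin.le_def])]
  rfl

theorem insertPerm_bijective (n : ℕ) : Function.Bijective
    fun z : Fin (n + 1) × Equiv.Perm (Fin n) => insertPerm z.1 z.2 := by
  rw [Fintype.bijective_iff_injective_and_card]
  constructor
  · rintro ⟨q, τ⟩ ⟨q', τ'⟩ h
    simp only at h
    have hq : q = q' := by
      apply (insertPerm q τ).injective
      rw [insertPerm_self, h, insertPerm_self]
    subst hq
    refine Prod.ext rfl (Equiv.ext fun a => ?_)
    have := congrArg (fun σ => σ (q.succAbove a)) h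
    simpa using this
  · simp [Fintype.card_perm, Nat.factorial_succ]

theorem sum_perm_succ {M : Type*} [AddCommMonoid M] {n : ℕ} (F : Equiv.Perm (Fin (n + 1)) → M) :
    ∑ σ, F σ = ∑ q, ∑ τ, F (insertPerm q τ) := by
  rw [← Fintype.sum_prod_type']
  exact ((insertPerm_bijective n).sum_comp F).symm

/-- The letter `0` is the smallest, so an unshuffle must place it first in one of the two blocks, at
position `0` or `i`. Removing it leaves an unshuffle, whose first block is one shorter in the former
case if `0 < i`. -/
theorem isUnshuffle_insertPerm {n : ℕ} (i : ℕ) (q : Fin (n + 1)) (τ : Equiv.Perm (Fin n)) :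
    IsUnshuffle i (insertPerm q τ) ↔
      ((q : ℕ) = 0 ∨ (q : ℕ) = i) ∧ IsUnshuffle (if (q : ℕ) < i then i - 1 else i) τ := by
  constructor
  · intro h
    refine ⟨?_, fun a b hab hc => ?_⟩
    · by_contra! hq
      have := h ⟨q - 1, by omega⟩ q (by show (q : ℕ) - 1 < q; omega)
        (by show (q : ℕ) < i ∨ i ≤ (q : ℕ) - 1; omega)
      rw [insertPerm_self] at this
      exact absurd this (Fin.not_lt_zero _)
    · have := h (q.succAbove a) (q.succAbove b) (Fin.succAbove_lt_succAbove_iff.2 hab) ?_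
      · simpa using this
      · simp only [Fin.succAbove, Fin.lt_def, Fin.val_castSucc] at hab ⊢
        split_ifs at hc ⊢ <;> simp at * <;> omega
  · rintro ⟨hq, h⟩ a b hab hc
    rcases eq_or_ne b q with rfl | hb
    · exfalso
      rw [Fin.lt_def] at hab
      omega
    · obtain ⟨b, rfl⟩ := Fin.exists_succAbove_eq hb
      rcases eq_or_ne a q with rfl | ha
      · simp
      · obtain ⟨a, rfl⟩ := Fin.exists_succAbove_eq ha
        rw [insertPerm_succAbove, insertPerm_succAbove, Fin.succ_lt_succ_iff]
        rw [Fin.succAbove_lt_succAbove_iff] at hab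
        refine h a b hab ?_
        simp only [Fin.succAbove, Fin.lt_def, Fin.val_castSucc] at hab hc
        split_ifs at hc ⊢ <;> simp at * <;> omega

/-- The inversions that involve the letter `0` come from the letters placed before position `q`. -/
theorem koszulSign_insertPerm {n : ℕ} (q : Fin (n + 1)) (τ : Equiv.Perm (Fin n))
    (d : Fin (n + 1) → ℤ) :
    koszulSign (insertPerm q τ) d = koszulSign τ (fun a => d a.succ) *
      ∏ a : Fin n, if (a : ℕ) < q then (d 0 * d (τ a).succ).negOnePow else 1 := by
  rw [koszulSign, Fin.prod_univ_succAbove _ q]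
  rw [Finset.prod_eq_one (fun b _ => by rw [if_neg]; simp), one_mul, koszulSign,
    ← Finset.prod_mul_distrib]
  refine Finset.prod_congr rfl fun a _ => ?_
  rw [Fin.prod_univ_succAbove _ q, mul_comm]
  congr 1
  · refine Finset.prod_congr rfl fun b _ => ?_
    simp only [insertPerm_succAbove, Fin.succAbove_lt_succAbove_iff, Fin.succ_lt_succ_iff]
  · simp only [insertPerm_succAbove, insertPerm_self, Fin.succ_pos, and_true,
      Fin.succAbove_lt_iff_castSucc_lt, mul_comm]
    simp only [Fin.lt_def, Fin.val_castSucc]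

variable {B : Type*} {e : B → ℤ} {M : Type*} [AddCommGroup M]

theorem ofFn_insertPerm {n : ℕ} (q : Fin (n + 1)) (τ : Equiv.Perm (Fin n)) (x : Fin (n + 1) → B) :
    List.ofFn (fun a => x (insertPerm q τ a)) =
      (List.ofFn fun a => x (τ a).succ).take q ++ x 0 ::
        (List.ofFn fun a => x (τ a).succ).drop q := by
  have hq := q.2
  refine List.ext_getElem (by simp; omega) fun a h1 h2 => ?_
  simp only [List.length_ofFn] at h1
  rw [List.getElem_ofFn, List.getElem_append]
  simp only [List.length_take, List.length_ofFn]
  split_ifs with h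
  · rw [List.getElem_take, List.getElem_ofFn, insertPerm_lt q τ a (by omega)]
  · rw [List.getElem_cons]
    split_ifs with h'
    · have : (⟨a, h1⟩ : Fin (n + 1)) = q := Fin.ext (by simp; omega)
      rw [this, insertPerm_self]
    · obtain ⟨a, rfl⟩ : ∃ a', a = a' + 1 := ⟨a - 1, by omega⟩
      rw [List.getElem_drop, List.getElem_ofFn, insertPerm_gt q τ a (by omega) (by omega)]
      congr 4
      omega

theorem wdeg_take_ofFn {n : ℕ} (x : Fin n → B) (i : ℕ) (hi : i ≤ n) :
    wdeg e ((List.ofFn x).take i) = ∑ a : Fin n, if (a : ℕ) < i then e (x a) else 0 := by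
  induction n generalizing i with
  | zero => simp
  | succ n ih =>
    rw [List.ofFn_succ, Fin.sum_univ_succ]
    cases i with
    | zero => simp
    | succ i => simp [ih (fun a => x a.succ) i (by omega)]

theorem prod_negOnePow {ι : Type*} (s : Finset ι) (f : ι → ℤ) :
    ∏ a ∈ s, (f a).negOnePow = (∑ a ∈ s, f a).negOnePow := by
  classical
  induction s using Finset.induction_on with
  | empty => simp
  | insert a s ha ih => rw [Finset.prod_insert ha, Finset.sum_insert ha, ih, Int.negOnePow_add]

/-- Links the sums over unshuffle permutations with the recursive sums over splittings of a word. By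
induction: the first letter heads the first block (`q = 0 < i`) or the second (`q = i`), as in the
recursion for `usum`. -/
theorem sum_unshuffles_eq_usum {n : ℕ} (x : Fin n → B) (Φ : List B → List B → M) :
    ∑ i ∈ Finset.range (n + 1), ∑ σ : Equiv.Perm (Fin n) with IsUnshuffle i σ,
      koszulSign σ (fun a => e (x a)) • Φ ((List.ofFn fun a => x (σ a)).take i)
        ((List.ofFn fun a => x (σ a)).drop i) = usum e (List.ofFn x) Φ := by
  induction n generalizing Φ with
  | zero =>
    have : ∀ σ : Equiv.Perm (Fin 0), IsUnshuffle 0 σ := fun σ a => a.elim0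
    simp [usum, this, koszulSign]
  | succ n ih =>
    rw [List.ofFn_succ, usum, ← ih, ← ih]
    set G : ℕ → Equiv.Perm (Fin (n + 1)) → M := fun i σ =>
      koszulSign σ (fun a => e (x a)) • Φ ((List.ofFn fun a => x (σ a)).take i)
        ((List.ofFn fun a => x (σ a)).drop i) with hG
    have h1 : ∀ i, ∑ σ : Equiv.Perm (Fin (n + 1)) with IsUnshuffle i σ, G i σ =
        ∑ q : Fin (n + 1), if (q : ℕ) = 0 ∨ (q : ℕ) = i then
          ∑ τ : Equiv.Perm (Fin n) with IsUnshuffle (if (q : ℕ) < i then i - 1 else i) τ,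
            G i (insertPerm q τ) else 0 := by
      intro i
      rw [Finset.sum_filter, sum_perm_succ]
      refine Finset.sum_congr rfl fun q _ => ?_
      simp only [isUnshuffle_insertPerm]
      by_cases hq : (q : ℕ) = 0 ∨ (q : ℕ) = i
      · simp only [hq, true_and, if_true, Finset.sum_filter]
      · simp only [hq, false_and, if_false, Finset.sum_const_zero]
    have h2 : ∀ i ∈ Finset.range (n + 1),
        ∑ τ : Equiv.Perm (Fin n) with IsUnshuffle i τ, G (i + 1) (insertPerm 0 τ) =
        ∑ τ : Equiv.Perm (Fin n) with IsUnshuffle i τ, koszulSign τ (fun a => e (x a.succ)) •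
          Φ (x 0 :: (List.ofFn fun a => x (τ a).succ).take i)
            ((List.ofFn fun a => x (τ a).succ).drop i) := by
      intro i _
      refine Finset.sum_congr rfl fun τ _ => ?_
      simp only [hG, ofFn_insertPerm, koszulSign_insertPerm]
      simp
    have h3 : ∀ i (hi : i ∈ Finset.range (n + 1)),
        ∑ τ : Equiv.Perm (Fin n) with IsUnshuffle i τ,
          G i (insertPerm ⟨i, Finset.mem_range.1 hi⟩ τ) =
        ∑ τ : Equiv.Perm (Fin n) with IsUnshuffle i τ, koszulSign τ (fun a => e (x a.succ)) •
          (e (x 0) * wdeg e ((List.ofFn fun a => x (τ a).succ).take i)).negOnePow •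
          Φ ((List.ofFn fun a => x (τ a).succ).take i)
            (x 0 :: (List.ofFn fun a => x (τ a).succ).drop i) := by
      intro i hi
      have hi' := Finset.mem_range.1 hi
      refine Finset.sum_congr rfl fun τ _ => ?_
      have hlen : ((List.ofFn fun a => x (τ a).succ).take i).length = i := by simp; omega
      simp only [hG, ofFn_insertPerm, koszulSign_insertPerm]
      rw [List.take_left' hlen, List.drop_left' hlen, mul_smul]
      congr 2
      rw [wdeg_take_ofFn _ _ (by omega), Finset.mul_sum, ← prod_negOnePow]
      refine Finset.prod_congr rfl fun a _ => ?_
      split_ifs <;> simp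
    rw [← Finset.sum_congr rfl h2]
    rw [Finset.sum_congr rfl fun i _ => h1 i]
    -- For `i = 0` the two positions coincide and belong to the second block; the condition `0 < i`
    -- prevents counting this case twice.
    have h4 : ∀ i (q : Fin (n + 1)) (P : M), (if (q : ℕ) = 0 ∨ (q : ℕ) = i then P else 0) =
        (if q = 0 then (if 0 < i then P else 0) else 0) + if (q : ℕ) = i then P else 0 := by
      intro i q P
      have : q = 0 ↔ (q : ℕ) = 0 := by rw [Fin.ext_iff]; rfl
      simp only [this]
      split_ifs <;> first | (simp; done) | (exfalso; omega)
    simp only [h4, Finset.sum_add_distrib]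
    congr 1
    · rw [Finset.sum_range_succ']
      simp
    · rw [Finset.sum_range_succ, Finset.sum_eq_zero (s := Finset.univ) fun (q : Fin (n + 1)) _ => by
        rw [if_neg (by omega)], add_zero]
      refine Finset.sum_congr rfl fun i hi => ?_
      rw [Finset.sum_eq_single ⟨i, Finset.mem_range.1 hi⟩]
      · rw [if_pos rfl, ← h3 i hi]
        simp
      · intro q _ hq
        rw [if_neg]
        exact fun h => hq (Fin.ext h)
      · simp

end Bridge

/-! ### Pair products of nested operations -/

section PairNest

theorem prod_fin_ite_lt (n b : ℕ) (hb : b ≤ n) (g : ℕ → ℤˣ) :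
    ∏ a : Fin n, (if (a : ℕ) < b then g a else 1) = ∏ a ∈ Finset.range b, g a := by
  rw [← Finset.prod_range fun a => if a < b then g a else 1, ← Finset.prod_filter]
  refine Finset.prod_congr ?_ fun _ _ => rfl
  ext a
  simp only [Finset.mem_filter, Finset.mem_range]
  omega

theorem pairProd_eq_prod_range {n : ℕ} {s : Fin n → Fin n → ℤˣ} {s' : ℕ → ℕ → ℤˣ}
    (h : ∀ a b : Fin n, a < b → s a b = s' a b) :
    pairProd s = ∏ b ∈ Finset.range n, ∏ a ∈ Finset.range b, s' a b := by
  rw [pairProd, Finset.prod_comm, Finset.prod_range]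
  refine Finset.prod_congr rfl fun b _ => ?_
  rw [← prod_fin_ite_lt n b b.2.le]
  refine Finset.prod_congr rfl fun a _ => ?_
  by_cases hab : a < b
  · rw [if_pos hab, if_pos (Fin.lt_def.1 hab), h a b hab]
  · rw [if_neg hab, if_neg (fun h => hab (Fin.lt_def.2 h))]

variable {m : ℕ∞}

/-- The arguments of the inner operation among all arguments. -/
def innerEmb (n : Arity m) (p : Fin n.1) (a : Fin (innerArity n p).1) : Fin n.1 :=
  ⟨a, lt_of_lt_of_le a.2 (Nat.succ_le_of_lt p.2)⟩

/-- The arguments of the outer operation (apart from the first one) among all arguments. -/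
def outerEmb (n : Arity m) (p : Fin n.1) (b : Fin (outerArity n p).1) : Fin n.1 :=
  ⟨p + b, by have h := b.2; simp only [outerArity] at h; omega⟩

/-- Pairs of inner arguments are seen by the inner operation and pairs of outer ones by the outer
operation. A mixed pair is seen through the first outer slot, which must carry the product over all
inner arguments. -/
theorem pairProd_nest (n : Arity m) (p : Fin n.1) {s : Fin n.1 → Fin n.1 → ℤˣ}
    {s₁ : Fin (innerArity n p).1 → Fin (innerArity n p).1 → ℤˣ}
    {s₂ : Fin (outerArity n p).1 → Fin (outerArity n p).1 → ℤˣ}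
    (h₁ : ∀ a b, s₁ a b = s (innerEmb n p a) (innerEmb n p b))
    (h₂ : ∀ a b : Fin (outerArity n p).1, (a : ℕ) = 0 → (b : ℕ) ≠ 0 →
      s₂ a b = ∏ c, s (innerEmb n p c) (outerEmb n p b))
    (h₃ : ∀ a b : Fin (outerArity n p).1, (a : ℕ) ≠ 0 → (b : ℕ) ≠ 0 → s₂ a b = s (outerEmb n p a) (outerEmb n p b)) :
    pairProd s = pairProd s₁ * pairProd s₂ := by
  obtain ⟨q, hq⟩ : ∃ q, n.1 = p + 1 + q := ⟨n.1 - (p + 1), by have := p.2; omega⟩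
  have hi : (innerArity n p).1 = p + 1 := rfl
  have ho : (outerArity n p).1 = q + 1 := by simp only [outerArity]; omega
  let s' : ℕ → ℕ → ℤˣ := fun a b => if h : a < n.1 ∧ b < n.1 then s ⟨a, h.1⟩ ⟨b, h.2⟩ else 1
  have hs : ∀ a b : Fin n.1, s a b = s' a b := fun a b => by simp [s']
  let t : ℕ → ℕ → ℤˣ := fun a b =>
    if a = 0 then ∏ c ∈ Finset.range (p + 1), s' c (p + b) else s' (p + a) (p + b)
  rw [pairProd_eq_prod_range (s' := s') fun a b _ => hs a b,
    pairProd_eq_prod_range (s := s₁) (s' := s') fun a b _ => by rw [h₁, hs]; rfl,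
    pairProd_eq_prod_range (s := s₂) (s' := t) fun a b hab => ?_]
  · have h1 : ∏ b ∈ Finset.range n.1, ∏ a ∈ Finset.range b, s' a b =
        ∏ b ∈ Finset.range (p + 1 + q), ∏ a ∈ Finset.range b, s' a b := by rw [← hq]
    have h2 : ∏ b ∈ Finset.range (outerArity n p).1, ∏ a ∈ Finset.range b, t a b =
        ∏ b ∈ Finset.range (q + 1), ∏ a ∈ Finset.range b, t a b := by rw [← ho]
    rw [h1, h2, hi, Finset.prod_range_add, Finset.prod_range_succ' _ q]
    simp only [Finset.range_zero, Finset.prod_empty, mul_one]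
    congr 1
    refine Finset.prod_congr rfl fun b _ => ?_
    rw [Finset.prod_range_add, Finset.prod_range_succ' (fun a => t a (b + 1)), mul_comm]
    congr 1
    · refine Finset.prod_congr rfl fun a _ => ?_
      simp only [t]
      rw [if_neg (by omega)]
      congr 1 <;> ring
    · simp only [t, if_pos]
      refine Finset.prod_congr rfl fun a _ => ?_
      congr 1
      ring
  · have hb : (b : ℕ) ≠ 0 := by rw [Fin.lt_def] at hab; omega
    by_cases ha : (a : ℕ) = 0
    · rw [h₂ a b ha hb]
      simp only [t, if_pos ha]
      rw [Finset.prod_range]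
      exact Finset.prod_congr rfl fun c _ => hs _ _
    · rw [h₃ a b ha hb, hs]
      simp only [t, if_neg ha]
      rfl

end PairNest

/-! ### Décalage -/

section Decalage

variable {k : Type*} [Field k] {B : Type*} {e : B → ℤ}

theorem wordSymm_move {M : Type*} [AddCommGroup M] {g : List B → M} (hg : WordSymm e g) (A C : List B)
    (x : B) : g (A ++ x :: C) = (e x * wdeg e A).negOnePow • g (x :: (A ++ C)) := by
  induction A generalizing g with
  | nil => simp
  | cons y A ih =>
    have h1 := ih (g := fun w => g (y :: w)) fun u x' y' v => hg (y :: u) x' y' v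
    have h2 := hg [] y x (A ++ C)
    simp only [List.nil_append] at h2
    rw [List.cons_append, h1, h2, smul_smul, ← Int.negOnePow_add, wdeg_cons, List.cons_append]
    congr 2
    ring

/-- Symmetry under adjacent exchanges implies symmetry under all permutations: move the letter `0`
to the front and apply induction to the rest. -/
theorem wordSymm_perm {M : Type*} [AddCommGroup M] {n : ℕ} {g : List B → M} (hg : WordSymm e g)
    (x : Fin n → B) (σ : Equiv.Perm (Fin n)) :
    g (List.ofFn fun a => x (σ a)) = koszulSign σ (fun a => e (x a)) • g (List.ofFn x) := by
  induction n generalizing g with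
  | zero => simp [koszulSign]
  | succ n ih =>
    obtain ⟨⟨q, τ⟩, rfl⟩ := (insertPerm_bijective n).surjective σ
    simp only
    have h1 := ih (g := fun w => g (x 0 :: w)) (fun u x' y' v => hg (x 0 :: u) x' y' v)
      (fun a => x a.succ) τ
    have hq := q.2
    rw [ofFn_insertPerm, wordSymm_move hg, List.take_append_drop, h1, koszulSign_insertPerm,
      wdeg_take_ofFn _ _ (by omega), List.ofFn_succ, smul_smul, mul_comm, Finset.mul_sum,
      ← prod_negOnePow]
    congr 2
    refine Finset.prod_congr rfl fun a _ => ?_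
    split_ifs <;> simp

variable (e) in
/-- The sign of the décalage isomorphism. -/
def decSign {n : ℕ} (t : Fin n → B) : ℤˣ := pairProd fun a _ => (e (t a) - 1).negOnePow

variable (k e) in
/-- The operations on a space with a given basis obtained by décalage. -/
def decOp (l : List B → B →₀ k) (n : ℕ) : MultilinearMap k (fun _ : Fin n => B →₀ k) (B →₀ k) :=
  basisMultilinear Finsupp.basisSingleOne fun t => decSign e t • l (List.ofFn t)

theorem decOp_single (l : List B → B →₀ k) {n : ℕ} (t : Fin n → B) :
    decOp k e l n (fun a => Finsupp.single (t a) 1) = decSign e t • l (List.ofFn t) := by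
  have := basisMultilinear_apply (Finsupp.basisSingleOne (R := k))
    (fun t => decSign e t • l (List.ofFn t)) t
  simpa [decOp] using this

variable {m : ℕ∞}

theorem take_ofFn_eq (n : Arity m) (p : Fin n.1) (t : Fin n.1 → B) :
    (List.ofFn t).take (p + 1) = List.ofFn (innerArgs n p t) := by
  have := p.2
  have hl : (List.ofFn (innerArgs n p t)).length = p + 1 := List.length_ofFn
  refine List.ext_getElem (by rw [hl, List.length_take, List.length_ofFn]; omega) fun a h1 h2 => ?_
  rw [List.getElem_take, List.getElem_ofFn, List.getElem_ofFn]
  rfl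

theorem ofFn_outerArgs (n : Arity m) (p : Fin n.1) (b : B) (t : Fin n.1 → B) :
    List.ofFn (outerArgs n p b t) = b :: (List.ofFn t).drop (p + 1) := by
  have := p.2
  have hl : (List.ofFn (outerArgs n p b t)).length = n.1 - p := List.length_ofFn
  refine List.ext_getElem
    (by rw [hl, List.length_cons, List.length_drop, List.length_ofFn]; omega) fun a h1 h2 => ?_
  rw [List.getElem_ofFn, List.getElem_cons]
  simp only [outerArgs]
  split_ifs
  · rfl
  · rw [List.getElem_drop, List.getElem_ofFn]
    congr 2
    omega

theorem outerArgs_map {X Z : Type*} (f : X → Z) (n : Arity m) (p : Fin n.1) (v : X)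
    (x : Fin n.1 → X) (b) :
    f (outerArgs n p v x b) = outerArgs n p (f v) (fun a => f (x a)) b := by
  simp only [outerArgs]
  split_ifs <;> rfl

/-- The first outer slot should carry `(-1)` to the sum of `e - 1` over the `p + 1` inner letters,
but `e b - 1` is the sum of the `e` minus `2`. The parity of the difference is `p + 1`, once for
each of the `n - p - 1` remaining outer arguments, which gives `(-1)^{i(j-1)}`. -/
theorem decSign_nest (n : Arity m) (p : Fin n.1) (t : Fin n.1 → B) (b : B)
    (hb : e b = wdeg e ((List.ofFn t).take (p + 1)) - 1) :
    decSign e (innerArgs n p t) * decSign e (outerArgs n p b t) =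
      jacobiSign n.1 p * decSign e t := by
  have key := pairProd_nest n p (s := fun a _ => (e (t a) - 1).negOnePow)
    (s₁ := fun a _ => (e (innerArgs n p t a) - 1).negOnePow)
    (s₂ := fun a b' => (if (a : ℕ) = 0 then ((p : ℤ) + 1).negOnePow else 1) *
      (e (outerArgs n p b t a) - 1).negOnePow) (fun _ _ => rfl) ?_ ?_
  · rw [decSign, decSign, decSign, key, pairProd_mul, ← mul_assoc,
      mul_comm (jacobiSign n.1 p), mul_assoc (pairProd _)]
    congr 1
    rw [← mul_assoc]
    have : jacobiSign n.1 p = pairProd fun a _ : Fin (outerArity n p).1 =>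
        if (a : ℕ) = 0 then ((p : ℤ) + 1).negOnePow else 1 := by
      rw [pairProd_eq_prod_range (s' := fun a _ => if a = 0 then ((p : ℤ) + 1).negOnePow else 1)
        fun _ _ _ => rfl]
      have ho : (outerArity n p).1 = n.1 - p - 1 + 1 := by
        have := p.2; simp only [outerArity]; omega
      rw [ho, Finset.prod_range_succ', Finset.prod_congr rfl fun b _ => by
        rw [Finset.prod_range_succ', Finset.prod_eq_one fun a _ => by rw [if_neg (by omega)],
          one_mul, if_pos rfl], Finset.prod_const]
      simp only [Finset.range_zero, Finset.prod_empty, mul_one, Finset.card_range, jacobiSign,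
        pow_mul]
      congr 1
    rw [this, Int.units_mul_self, one_mul]
  · intro a b' ha _
    rw [if_pos ha]
    have h1 : outerArgs n p b t a = b := by simp [outerArgs, ha]
    rw [h1, hb, prod_negOnePow, ← Int.negOnePow_add, take_ofFn_eq]
    refine negOnePow_congr ⟨p, ?_⟩
    have h2 : wdeg e (List.ofFn (innerArgs n p t)) = ∑ a, e (innerArgs n p t a) := by
      rw [wdeg, List.map_ofFn, List.sum_ofFn]; rfl
    rw [h2, Finset.sum_sub_distrib]
    have h3 : ((innerArity n p).1 : ℤ) = p + 1 := by simp [innerArity]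
    simp only [Finset.sum_const, Finset.card_univ, Fintype.card_fin, nsmul_eq_mul, mul_one, h3]
    simp only [innerEmb, innerArgs]
    ring
  · intro a b' ha _
    rw [if_neg ha, one_mul]
    simp only [outerArgs, if_neg ha]
    rfl

variable {l : List B → B →₀ k}

theorem nest_decOp (hl : ∀ w, l w ∈ homog k e (wdeg e w - 1)) (n : Arity m) (p : Fin n.1)
    (t : Fin n.1 → B) :
    nest (fun j : Arity m => fun y => decOp k e l j.1 y) n p (fun a => Finsupp.single (t a) 1) =
      (jacobiSign n.1 p * decSign e t) •
        headExt l (l ((List.ofFn t).take (p + 1))) ((List.ofFn t).drop (p + 1)) := by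
  -- The inner value is a combination of basis elements, all of the same degree, so the sign
  -- computed for one basis element applies to the whole combination.
  have h1 : ∀ v ∈ homog k e (wdeg e ((List.ofFn t).take (p + 1)) - 1),
      decSign e (innerArgs n p t) • decOp k e l (outerArity n p).1
        (outerArgs n p v fun a => Finsupp.single (t a) 1) =
      (jacobiSign n.1 p * decSign e t) • headExt l v ((List.ofFn t).drop (p + 1)) := by
    intro v hv
    induction hv using homog_induction with
    | hs b hb =>
      have : outerArgs n p (Finsupp.single b (1 : k)) (fun a => Finsupp.single (t a) 1) =
          fun a => Finsupp.single (outerArgs n p b t a) 1 :=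
        funext fun a => (outerArgs_map (fun c => Finsupp.single c (1 : k)) n p b t a).symm
      rw [this, decOp_single, smul_smul, decSign_nest n p t b hb, ofFn_outerArgs, headExt_single]
    | h0 =>
      rw [headExt_zero, outerArgs_eq_update n p _ 0, MultilinearMap.map_update_zero, smul_zero,
        smul_zero]
    | ha u v _ _ hu hv =>
      rw [headExt_add, smul_add, ← hu, ← hv, outerArgs_eq_update n p _ 0,
        outerArgs_eq_update n p _ 0 u, outerArgs_eq_update n p _ 0 v,
        MultilinearMap.map_update_add, smul_add]
    | hc c v _ hv =>
      have hs : headExt l (c • v) ((List.ofFn t).drop (p + 1)) =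
          c • headExt l v ((List.ofFn t).drop (p + 1)) := map_smul _ _ _
      rw [hs, unit_smul_comm, ← hv, outerArgs_eq_update n p _ 0, outerArgs_eq_update n p _ 0 v,
        MultilinearMap.map_update_smul, unit_smul_comm]
  rw [nest_eq, ← h1 _ (hl _)]
  have h2 : decOp k e l (innerArity n p).1 (innerArgs n p fun a => Finsupp.single (t a) 1) =
      decSign e (innerArgs n p t) • l ((List.ofFn t).take (p + 1)) := by
    rw [take_ofFn_eq]
    exact decOp_single l (innerArgs n p t)
  rw [h2, outerArgs_eq_update n p _ 0, multilinear_unit_smul, ← outerArgs_eq_update]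

theorem homog_eq_span (n : ℤ) : homog k e n =
    Submodule.span k ((fun b => Finsupp.single b (1 : k)) '' {b | e b = n}) :=
  Finsupp.supported_eq_span_single k _

/-- Décalage turns symmetric operations of degree `-1` into an `L(m)`-algebra. -/
theorem lAxioms_decOp (hl : ∀ w, l w ∈ homog k e (wdeg e w - 1)) (hs : WordSymm e l)
    (hnil : l [] = 0) (hjac : ∀ w, usum e w (fun I K => headExt l (l I) K) = 0) :
    LAxioms m (fun d => homog k e (d + 1)) (fun j => decOp k e l j.1) := by
  have choice : ∀ {n : ℕ} {x : Fin n → B →₀ k} {d : Fin n → ℤ},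
      (∀ a, x a ∈ (fun b => Finsupp.single b (1 : k)) '' {b | e b = d a + 1}) →
      ∃ t : Fin n → B, (x = fun a => Finsupp.single (t a) 1) ∧ d = fun a => e (t a) - 1 := by
    intro n x d hx
    choose t ht ht' using hx
    exact ⟨t, funext fun a => (ht' a).symm, funext fun a => by rw [show e (t a) = _ from ht a]; ring⟩
  have hhom : (fun d => homog k e (d + 1)) = fun d => Submodule.span k
      ((fun b => Finsupp.single b (1 : k)) '' {b | e b = d + 1}) :=
    funext fun d => homog_eq_span _
  rw [hhom]
  refine LAxioms.of_span ?_ ?_ ?_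
  · intro j x d hx
    obtain ⟨t, rfl, rfl⟩ := choice hx
    rw [decOp_single, ← homog_eq_span]
    refine unit_smul_mem _ _ ?_
    convert hl _ using 2
    rw [wdeg, List.map_ofFn, List.sum_ofFn]
    simp only [Function.comp_apply, Finset.sum_sub_distrib, Finset.sum_const, Finset.card_univ,
      Fintype.card_fin, nsmul_eq_mul, mul_one]
    ring
  · intro j x d hx σ
    obtain ⟨t, rfl, rfl⟩ := choice hx
    rw [decOp_single l fun a => t (σ a), decOp_single, wordSymm_perm hs, smul_smul, smul_smul]
    congr 1
    rw [chi_eq_invProd, koszulSign_eq_invProd, mul_comm, decSign, decSign]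
    refine invProd_mul_pairProd_comp σ (s := fun a _ => (e (t a) - 1).negOnePow) fun x y _ => ?_
    -- Modulo two, `1 + (a - 1)(b - 1) + ab` equals `(a - 1) + (b - 1)`: décalage turns the
    -- antisymmetric commutation rule into the symmetric one.
    rw [← Int.negOnePow_add, ← Int.negOnePow_add]
    refine negOnePow_congr ⟨e (t x) + e (t y) - e (t x) * e (t y) - 2, ?_⟩
    ring
  · intro n x d hx
    obtain ⟨t, rfl, rfl⟩ := choice hx
    have := sum_unshuffles_eq_usum (e := e) t fun I K => headExt l (l I) K
    -- Splittings with empty first block do not contribute since `l [] = 0`; the others are indexed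
    -- by `p`, the size of the first block minus one.
    rw [hjac, Finset.sum_range_succ', Finset.sum_eq_zero (s := Finset.univ.filter _)
      (fun σ _ => by simp [hnil, headExt_zero]), add_zero, Finset.sum_range] at this
    rw [← smul_zero (decSign e t), ← this, Finset.smul_sum]
    refine Finset.sum_congr rfl fun p _ => ?_
    rw [Finset.smul_sum]
    refine Finset.sum_congr rfl fun σ _ => ?_
    rw [nest_decOp hl n p fun a => t (σ a), smul_smul, smul_smul]
    congr 1
    have h1 : chi σ (fun a => e (t a) - 1) * decSign e (fun a => t (σ a)) =
        koszulSign σ (fun a => e (t a)) * decSign e t := by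
      rw [chi_eq_invProd, koszulSign_eq_invProd, decSign, decSign]
      refine invProd_mul_pairProd_comp σ (s := fun a _ => (e (t a) - 1).negOnePow) fun x y _ => ?_
      rw [← Int.negOnePow_add, ← Int.negOnePow_add]
      refine negOnePow_congr ⟨e (t x) + e (t y) - e (t x) * e (t y) - 2, ?_⟩
      ring
    have h2 : jacobiSign n.1 p * jacobiSign n.1 p = 1 := Int.units_mul_self _
    rw [mul_comm (decSign e t), ← h1, ← mul_assoc, mul_assoc (chi _ _), h2, mul_one]

end Decalage

/-! ### The operad as a quotient of all trees -/

section Spanning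

variable {k : Type*} [Field k] {m : ℕ∞}

theorem InContext.gRel_antisymm {α : Type} {r : Tr m α →₀ k} (h : InContext k (IsAntisymm k) r) :
    GRel k Tr.node Tr.deg r := by
  induction h with
  | base r h =>
    cases h with
    | mk j T σ => exact .anti j T σ
  | graft j T i r _ ih => exact .graft j T i r ih

theorem InContext.gRel_jacobi {α : Type} {r : Tr m α →₀ k} (h : InContext k (IsJacobi k) r) :
    GRel k Tr.node Tr.deg r := by
  induction h with
  | base r h =>
    cases h with
    | mk n T => exact .jac n T
  | graft j T i r _ ih => exact .graft j T i r ih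

theorem GRel.inContext {α : Type} {r : Tr m α →₀ k} (h : GRel k Tr.node Tr.deg r) :
    InContext k (IsAntisymm k) r ∨ InContext k (IsJacobi k) r := by
  induction h with
  | anti j T σ => exact .inl (.base _ (.mk j T σ))
  | jac n T => exact .inr (.base _ (.mk n T))
  | graft j T i r _ ih => exact ih.imp (.graft j T i r) (.graft j T i r)

theorem LOperad.mk_eq_zero {n : ℕ} {r : LTree m n →₀ k}
    (h : GRel k Tr.node Tr.deg (Finsupp.mapDomain Subtype.val r)) :
    LOperad.mk k m n (FreeOperad.mk k m n r) = 0 := by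
  rcases h.inContext with h | h
  · have : FreeOperad.mk k m n r = 0 :=
      (Submodule.Quotient.mk_eq_zero _).2 (Submodule.subset_span h)
    rw [this, map_zero]
  · exact (Submodule.Quotient.mk_eq_zero _).2
      (Submodule.mem_map_of_mem (Submodule.subset_span h))

/-- A linear map on combinations of `n`-trees that kills the relations descends to the operad. -/
def LOperad.lift {A : Type*} [AddCommGroup A] [Module k A] {n : ℕ}
    (F : (LTree m n →₀ k) →ₗ[k] A)
    (h : ∀ r, GRel k Tr.node Tr.deg (Finsupp.mapDomain Subtype.val r) → F r = 0) :
    LOperad k m n →ₗ[k] A :=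
  (jacobiIdeal k m n).liftQ
    ((relSpan k m n (IsAntisymm k)).liftQ F
      (Submodule.span_le.2 fun r hr => h r (InContext.gRel_antisymm hr)))
    (by
      rw [jacobiIdeal, Submodule.map_le_iff_le_comap]
      exact Submodule.span_le.2 fun r hr => h r (InContext.gRel_jacobi hr))

theorem LOperad.lift_treeClass {A : Type*} [AddCommGroup A] [Module k A] {n : ℕ}
    (F : (LTree m n →₀ k) →ₗ[k] A)
    (h : ∀ r, GRel k Tr.node Tr.deg (Finsupp.mapDomain Subtype.val r) → F r = 0) (T : LTree m n) :
    LOperad.lift F h (treeClass k T) = F (Finsupp.single T 1) := rfl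

theorem treeClass_linearCombination {n : ℕ} (r : LTree m n →₀ k) :
    Finsupp.linearCombination k (treeClass k) r = LOperad.mk k m n (FreeOperad.mk k m n r) := by
  have : Finsupp.linearCombination k (treeClass k) =
      (LOperad.mk k m n).comp (FreeOperad.mk k m n) := by
    ext T
    simp [treeClass]
  rw [this]
  rfl

theorem span_range_treeClass (n : ℕ) :
    Submodule.span k (Set.range (treeClass k : LTree m n → LOperad k m n)) = ⊤ := by
  rw [← Finsupp.range_linearCombination, eq_top_iff]
  rintro x -
  obtain ⟨y, rfl⟩ := Submodule.mkQ_surjective (jacobiIdeal k m n) x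
  obtain ⟨r, rfl⟩ := Submodule.mkQ_surjective (relSpan k m n (IsAntisymm k)) y
  exact ⟨r, treeClass_linearCombination r⟩

theorem Tr.Admissible.node {α : Type} {j : Arity m} {c : Fin j.1 → Tr m α}
    (h : j.1 = 1 → ∀ i, (c i).IsLeaf) (hc : ∀ i, (c i).Admissible) : (Tr.node j c).Admissible := by
  rw [Tr.Admissible]
  exact ⟨h, hc⟩

theorem Tr.Admissible.leaf {α : Type} (a : α) : (Tr.leaf a : Tr m α).Admissible := by
  rw [Tr.Admissible]
  trivial

open Classical in
variable (k) in
/-- The class in the operad of a tree, or zero if the tree is not an `n`-tree. -/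
def operadClass {n : ℕ} (T : Tr m (Fin n)) : LOperad k m n :=
  if h : ∀ a, T.occ a = 1 then treeClass k ⟨T, h⟩ else 0

theorem Tr.occ_node {α : Type} [DecidableEq α] (j : Arity m) (T : Fin j.1 → Tr m α) :
    (fun a => (Tr.node j T).occ a) = (0 : α → ℕ) + ∑ i, fun a => (T i).occ a := by
  funext a
  simp [Tr.occ]

/-- The number of occurrences of each label is the same for all trees in a relation. Hence either
all of them are `n`-trees, and the relation is one of the operad, or none is, and every term is sent
to zero. -/
theorem linearCombination_operadClass {n : ℕ} {r : Tr m (Fin n) →₀ k}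
    (hr : GRel k Tr.node Tr.deg r) : Finsupp.linearCombination k (operadClass k) r = 0 := by
  classical
  obtain ⟨g, hg⟩ := GRel.exists_level (M := Fin n → ℕ) (ν := fun T a => T.occ a) (c := fun _ => 0)
    Tr.occ_node (fun _ _ _ => rfl) hr
  rw [Finsupp.mem_supported] at hg
  by_cases h : g = fun _ => 1
  · subst h
    have hr' := Finsupp.mapDomain_comapDomain (M := k)
      (Subtype.val : LTree m n → Tr m (Fin n)) Subtype.val_injective r
      (fun T hT => ⟨⟨T, congrFun (hg hT)⟩, rfl⟩)
    rw [← hr'] at hr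
    rw [← hr', Finsupp.linearCombination_mapDomain, ← LOperad.mk_eq_zero hr,
      ← treeClass_linearCombination]
    congr 2
    funext T
    exact dif_pos T.2
  · rw [Finsupp.linearCombination_apply]
    refine Finset.sum_eq_zero fun T hT => ?_
    dsimp only
    rw [operadClass, dif_neg, smul_zero]
    intro hT'
    exact h ((show (fun a => T.occ a) = g from hg hT).symm.trans (funext hT'))

/-- The quotient of all trees by all relations. -/
abbrev TreeAlg (k : Type*) [Field k] (m : ℕ∞) (α : Type) : Type _ :=
  GenAlg k (Tr.node : (j : Arity m) → (Fin j.1 → Tr m α) → Tr m α) Tr.deg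

/-- The projection onto the operad. -/
def TreeAlg.toOperad (k : Type*) [Field k] (m : ℕ∞) (n : ℕ) :
    TreeAlg k m (Fin n) →ₗ[k] LOperad k m n :=
  (relations k Tr.node Tr.deg).liftQ (Finsupp.linearCombination k (operadClass k))
    (Submodule.span_le.2 fun _ hr => linearCombination_operadClass hr)

theorem TreeAlg.toOperad_of {n : ℕ} (T : Tr m (Fin n)) :
    TreeAlg.toOperad k m n (GenAlg.of k Tr.node Tr.deg T) = operadClass k T := by
  change Finsupp.linearCombination k (operadClass k) (Finsupp.single T 1) = _
  simp

theorem TreeAlg.lAxioms (k : Type*) [Field k] (m : ℕ∞) (α : Type) :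
    LAxioms m (GenAlg.grading k (Tr.node : (j : Arity m) → (Fin j.1 → Tr m α) → Tr m α) Tr.deg)
      (GenAlg.op k Tr.node Tr.deg) :=
  GenAlg.lAxioms fun _ _ => by rw [Tr.deg]

theorem isUnshuffle_self {n : ℕ} {i : ℕ} (hi : n ≤ i) {σ : Equiv.Perm (Fin n)} :
    IsUnshuffle i σ ↔ σ = 1 := by
  constructor
  · intro h
    rw [← Equiv.Perm.monotone_iff]
    exact StrictMono.monotone fun a b hab => h a b hab (.inl (b.2.trans_le hi))
  · rintro rfl a b hab _
    exact hab

theorem op_congr {X : Type*} (op : (j : Arity m) → (Fin j.1 → X) → X) {j j' : Arity m}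
    (h : j.1 = j'.1) {y : Fin j.1 → X} {y' : Fin j'.1 → X} (hy : ∀ a, y a = y' (a.cast h)) :
    op j y = op j' y' := by
  obtain rfl : j = j' := Subtype.ext h
  exact congrArg (op j) (funext hy)

/-- The admissible trees span. -/
theorem of_mem_span_admissible {α : Type} (T : Tr m α) :
    (GenAlg.of k Tr.node Tr.deg T : TreeAlg k m α) ∈
      Submodule.span k (GenAlg.of k Tr.node Tr.deg '' {T : Tr m α | T.Admissible}) := by
  set P := Submodule.span k
    ((GenAlg.of k Tr.node Tr.deg : Tr m α → TreeAlg k m α) '' {T : Tr m α | T.Admissible}) with hP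
  -- A root with at least two inputs never violates admissibility.
  have big : ∀ (j : Arity m), 2 ≤ j.1 → ∀ x : Fin j.1 → TreeAlg k m α, (∀ a, x a ∈ P) →
      GenAlg.op k Tr.node Tr.deg j x ∈ P := by
    intro j hj x hx
    refine multilinear_mem_of_span _ (fun _ => GenAlg.of k Tr.node Tr.deg '' {T | T.Admissible})
      P (fun x hx => ?_) x hx
    choose T hT hT' using hx
    rw [← funext hT', GenAlg.op_of]
    exact Submodule.subset_span ⟨_, Tr.Admissible.node (fun h => by omega) hT, rfl⟩
  have one : ∀ T : Tr m α, T.Admissible → ∀ (j : Arity m), j.1 = 1 → ∀ x : Fin j.1 → TreeAlg k m α,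
      (∀ a, x a = GenAlg.of k Tr.node Tr.deg T) → GenAlg.op k Tr.node Tr.deg j x ∈ P := by
    intro T
    induction T with
    | leaf a =>
      intro _ j hj x hx
      rw [funext hx, GenAlg.op_of]
      exact Submodule.subset_span ⟨Tr.node j fun _ => Tr.leaf a,
        Tr.Admissible.node (fun _ _ => trivial) fun _ => .leaf a, rfl⟩
    | node n c ih =>
      intro hadm j hj x hx
      have hc : ∀ a, (c a).Admissible := hadm.2
      have hcP : ∀ a, (GenAlg.of k Tr.node Tr.deg (c a) : TreeAlg k m α) ∈ P :=
        fun a => Submodule.subset_span ⟨_, hc a, rfl⟩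
      -- The index `p = n - 1`, that is `i = n` and `j = 1`: the unary vertex with the `n`-corolla
      -- as its input. The identity is solved for this term.
      let last : Fin n.1 := ⟨n.1 - 1, Nat.sub_lt n.2.1 one_pos⟩
      have hlast : (last : ℕ) + 1 = n.1 := Nat.sub_add_cancel n.2.1
      have jac := (TreeAlg.lAxioms k m α).jacobi n (fun a => GenAlg.of k Tr.node Tr.deg (c a))
        (fun a => (c a).deg) fun a => GenAlg.of_mem_grading _
      rw [← Finset.add_sum_erase _ _ (Finset.mem_univ last)] at jac
      have hsum : ∑ p ∈ Finset.univ.erase last,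
          ∑ σ : Equiv.Perm (Fin n.1) with IsUnshuffle (p + 1) σ,
          (chi σ (fun a => (c a).deg) * jacobiSign n.1 p) •
            nest (fun j y => GenAlg.op k Tr.node Tr.deg j y) n p
              (fun a => GenAlg.of k Tr.node Tr.deg (c (σ a))) ∈ P := by
        refine Submodule.sum_mem _ fun p hp => Submodule.sum_mem _ fun σ _ =>
          unit_smul_mem _ _ ?_
        have hp' : (p : ℕ) + 1 < n.1 := by
          have h1 := p.2
          have h2 : (p : ℕ) ≠ n.1 - 1 := fun h => (Finset.mem_erase.1 hp).1 (Fin.ext h)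
          omega
        rw [nest_eq]
        refine big _ (by simp only [outerArity]; omega) _ fun b => ?_
        rw [outerArgs]
        split_ifs with hb
        -- For `p = 0` the inner operation is a unary vertex over one of the trees `c a`, to which
        -- the induction hypothesis applies; otherwise it has at least two inputs.
        · by_cases hp0 : (p : ℕ) = 0
          · refine ih (σ ⟨0, n.2.1⟩) (hc _) _ (by simp [innerArity, hp0]) _ fun a => ?_
            have ha : (a : ℕ) = 0 := by have := a.2; simp only [innerArity] at this; omega
            simp only [innerArgs]
            congr 4
          · exact big _ (by simp only [innerArity]; omega) _ fun a => hcP _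
        · exact hcP _
      have hl := (Submodule.add_mem_iff_left P hsum).1 (jac ▸ P.zero_mem)
      have hfil : (Finset.univ.filter fun σ : Equiv.Perm (Fin n.1) =>
          IsUnshuffle ((last : ℕ) + 1) σ) = {1} := by
        ext σ
        simp [isUnshuffle_self hlast.ge]
      rw [hfil, Finset.sum_singleton] at hl
      have hl' := unit_smul_mem P (chi 1 (fun a => (c a).deg) * jacobiSign n.1 last) hl
      rw [unit_smul_smul_self] at hl'
      convert hl' using 1
      rw [nest_eq]
      refine op_congr (fun j y => GenAlg.op k Tr.node Tr.deg j y)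
        (by simp only [outerArity]; omega) fun a => ?_
      have ha : (a : ℕ) = 0 := by have := a.2; omega
      rw [hx, outerArgs, if_pos (by simpa using ha), ← GenAlg.op_of]
      exact op_congr (fun j y => GenAlg.op k Tr.node Tr.deg j y) hlast.symm fun a => rfl
  induction T with
  | leaf a => exact Submodule.subset_span ⟨_, Tr.Admissible.leaf (m := m) a, rfl⟩
  | node j c ih =>
    rw [← GenAlg.op_of]
    by_cases hj : j.1 = 1
    · refine multilinear_mem_of_span _
        (fun _ => GenAlg.of k Tr.node Tr.deg '' {T | T.Admissible}) P (fun x hx => ?_) _ ih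
      obtain ⟨T, hT, hT'⟩ := hx ⟨0, j.2.1⟩
      refine one T hT j hj x fun a => ?_
      rw [hT']
      congr 1
      exact Fin.ext (by have := a.2; simp only; omega)
    · exact big j (by have := j.2.1; omega) _ ih

/-- The signs of the subtrees come out by multilinearity, and permuting the inputs of the root costs
`χ`. -/
theorem Tr.Same.of_eq {α : Type} {T T' : Tr m α} (h : Tr.Same T T') :
    ∃ u : ℤˣ, (GenAlg.of k Tr.node Tr.deg T' : TreeAlg k m α) = u • GenAlg.of k Tr.node Tr.deg T := by
  induction h with
  | leaf a => exact ⟨1, (one_smul _ _).symm⟩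
  | node j σ c c' _ ih =>
    choose u hu using ih
    have h1 := (TreeAlg.lAxioms k m α).antisymm j (fun a => GenAlg.of k Tr.node Tr.deg (c a))
        (fun a => (c a).deg) (fun a => GenAlg.of_mem_grading _) σ
    refine ⟨(∏ a, u a) * chi σ fun a => (c a).deg, ?_⟩
    rw [← GenAlg.op_of, funext hu, mul_smul, ← GenAlg.op_of, ← h1,
      unit_smul_eq_intCast_smul (k := k)]
    simp_rw [unit_smul_eq_intCast_smul (k := k)]
    rw [MultilinearMap.map_smul_univ]
    congr 1
    rw [Units.coe_prod, Int.cast_prod]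

theorem span_admissible_eq_top (s : (n : ℕ) → AdmTree m n → {T : LTree m n // T.1.Admissible})
    (hs : ∀ (n : ℕ) (τ : AdmTree m n), (Quotient.mk (admSetoid m n) (s n τ) : AdmTree m n) = τ)
    (n : ℕ) :
    Submodule.span k (Set.range fun τ : AdmTree m n => treeClass k (s n τ).1) = ⊤ := by
  rw [eq_top_iff, ← span_range_treeClass, Submodule.span_le]
  rintro _ ⟨T, rfl⟩
  have h1 : treeClass k T = TreeAlg.toOperad k m n (GenAlg.of k Tr.node Tr.deg T.1) := by
    rw [TreeAlg.toOperad_of, operadClass, dif_pos T.2]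
  rw [SetLike.mem_coe, h1]
  have h2 := Submodule.mem_map_of_mem (f := TreeAlg.toOperad k m n) (of_mem_span_admissible T.1)
  rw [Submodule.map_span] at h2
  refine Submodule.span_le.2 ?_ h2
  rintro _ ⟨_, ⟨S, hS, rfl⟩, rfl⟩
  rw [SetLike.mem_coe, TreeAlg.toOperad_of]
  by_cases hS' : ∀ a, S.occ a = 1
  · let S' : {T : LTree m n // T.1.Admissible} := ⟨⟨S, hS'⟩, hS⟩
    have hsame : Tr.Same (s n (Quotient.mk _ S')).1.1 S := Quotient.exact (hs n (Quotient.mk _ S'))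
    obtain ⟨u, hu⟩ := hsame.of_eq (k := k)
    rw [← TreeAlg.toOperad_of, hu, map_unit_smul, TreeAlg.toOperad_of, operadClass,
      dif_pos (s n (Quotient.mk _ S')).1.2]
    exact unit_smul_mem _ _ (Submodule.subset_span ⟨_, rfl⟩)
  · rw [operadClass, dif_neg hS']
    exact Submodule.zero_mem _

end Spanning

/-! ### Decorated trees -/

section Independence

/-- Trees whose leaves and vertices carry a mark. -/
inductive DTree (α : Type) : Type where
  | leaf (a : α) (e : Bool) : DTree α
  | node (j : ℕ) (c : Fin j → DTree α) (e : Bool) : DTree α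

namespace DTree

variable {α : Type}

/-- An arbitrary linear order on decorated trees. -/
instance : LinearOrder (DTree α) := IsWellOrder.linearOrder WellOrderingRel

/-- The degree of a decorated tree, shifted by one. -/
def sdeg : DTree α → ℤ
  | leaf _ e => if e then 0 else 1
  | node _ c e => ∑ i, sdeg (c i) - if e then 1 else 0

/-- The vertex with a given family of inputs, in an arbitrary order. -/
def mkNode (s : Multiset (DTree α)) (e : Bool) : DTree α :=
  node s.toList.length s.toList.get e

theorem sdeg_mkNode (w : List (DTree α)) (e : Bool) :
    sdeg (mkNode (w : Multiset (DTree α)) e) = wdeg sdeg w - if e then 1 else 0 := by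
  have h := Multiset.coe_toList (w : Multiset (DTree α))
  rw [mkNode, sdeg, ← wdeg_perm sdeg (Multiset.coe_eq_coe.1 h), wdeg]
  congr 1
  rw [← List.sum_ofFn]
  congr 1
  refine List.ext_getElem (by simp) fun a h1 h2 => by simp

theorem mkNode_injective {s s' : Multiset (DTree α)} {e e' : Bool} (h : mkNode s e = mkNode s' e') :
    s = s' := by
  rw [mkNode, mkNode, node.injEq] at h
  rw [← Multiset.coe_toList s, ← Multiset.coe_toList s']
  congr 1
  refine List.ext_get h.1 fun a h1 h2 => ?_
  have key : ∀ {n n' : ℕ} (hn : n = n') {f : Fin n → DTree α} {f' : Fin n' → DTree α}, HEq f f' →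
      ∀ (h1 : a < n) (h2 : a < n'), f ⟨a, h1⟩ = f' ⟨a, h2⟩ := by
    rintro n _ rfl f _ h
    cases h
    exact fun _ _ => rfl
  exact key h.1 h.2.1 h1 h2

/-- All vertices are marked. -/
def Good : DTree α → Prop
  | leaf _ _ => True
  | node _ c e => e = true ∧ ∀ i, Good (c i)

theorem good_mkNode {s : Multiset (DTree α)} {e : Bool} :
    (mkNode s e).Good ↔ e = true ∧ ∀ b ∈ s, b.Good := by
  rw [mkNode, Good]
  refine and_congr_right fun _ => ?_
  constructor
  · intro h b hb
    rw [← Multiset.mem_toList, List.mem_iff_get] at hb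
    obtain ⟨i, rfl⟩ := hb
    exact h i
  · exact fun h i => h _ (Multiset.mem_toList.1 (List.get_mem _ _))

/-- Marking the root. -/
def mark : DTree α → DTree α
  | leaf a _ => leaf a true
  | node j c _ => node j c true

/-- The root is marked. -/
def marked : DTree α → Bool
  | leaf _ e => e
  | node _ _ e => e

theorem sdeg_mark {b : DTree α} (h : b.marked = false) : b.mark.sdeg = b.sdeg - 1 := by
  cases b <;> simp_all [marked, mark, sdeg]

theorem marked_mark (b : DTree α) : b.mark.marked = true := by cases b <;> rfl

/-- The Koszul sign of sorting a word. -/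
def wsign : List (DTree α) → ℤˣ
  | [] => 1
  | x :: w => (w.map fun y => if y < x then (sdeg x * sdeg y).negOnePow else 1).prod * wsign w

theorem wsign_swap (u : List (DTree α)) {x y : DTree α} (hxy : x ≠ y) (v : List (DTree α)) :
    wsign (u ++ x :: y :: v) = (sdeg x * sdeg y).negOnePow * wsign (u ++ y :: x :: v) := by
  induction u with
  | nil =>
    simp only [List.nil_append, wsign, List.map_cons, List.prod_cons]
    rcases lt_or_gt_of_ne hxy with h | h
    · rw [if_neg h.not_gt, if_pos h, mul_comm (sdeg y)]
      simp only [← mul_assoc, Int.units_mul_self, one_mul]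
      rw [mul_comm (List.prod _)]
    · rw [if_pos h, if_neg h.not_gt]
      simp only [one_mul, mul_assoc]
      rw [mul_left_comm (List.prod _) (List.prod _)]
  | cons z u ih =>
    simp only [List.cons_append, wsign, ih]
    rw [mul_left_comm]
    congr 2
    exact List.Perm.prod_eq ((List.Perm.append_left u (List.Perm.swap y x v)).map _)

variable (k : Type*) [Field k]

open Classical in
/-- The unmarked vertices as symmetric operations. -/
def symNode : List (DTree α) → DTree α →₀ k
  | [] => 0
  | [b] => Finsupp.single b 1
  -- A repeated letter of odd degree forces the value zero by symmetry. Dropping all repetitions is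
  -- harmless, as the inputs of a vertex of a tree with distinct labels are distinct.
  | b :: b' :: w => if (b :: b' :: w).Nodup then
      wsign (b :: b' :: w) • Finsupp.single (mkNode ↑(b :: b' :: w) false) 1 else 0

open Classical in
theorem symNode_of_two_le {w : List (DTree α)} (h : 2 ≤ w.length) :
    symNode k w = if w.Nodup then wsign w • Finsupp.single (mkNode ↑w false) 1 else 0 := by
  rcases w with _ | ⟨b, _ | ⟨b', w⟩⟩
  · simp at h
  · simp at h
  · rfl

theorem symNode_mem (w : List (DTree α)) : symNode k w ∈ homog k sdeg (wdeg sdeg w) := by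
  classical
  rcases w with _ | ⟨b, _ | ⟨b', w⟩⟩
  · exact Submodule.zero_mem _
  · exact Finsupp.single_mem_supported k 1 (by simp)
  · rw [symNode]
    split_ifs
    · refine unit_smul_mem _ _ (Finsupp.single_mem_supported k 1 ?_)
      rw [Set.mem_ofPred_eq, sdeg_mkNode]
      simp
    · exact Submodule.zero_mem _

theorem symNode_wordSymm : WordSymm sdeg (symNode k : List (DTree α) → _) := by
  classical
  intro u x y v
  rw [symNode_of_two_le k (by simp; omega), symNode_of_two_le k (by simp; omega)]
  have hp : (u ++ x :: y :: v).Perm (u ++ y :: x :: v) :=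
    List.Perm.append_left u (List.Perm.swap y x v)
  rw [Multiset.coe_eq_coe.2 hp]
  simp only [hp.nodup_iff]
  split_ifs with hn
  · have hxy : x ≠ y := by
      rintro rfl
      have := (List.nodup_append.1 hn).2.1
      simp at this
    rw [wsign_swap u hxy, mul_smul]
  · rw [smul_zero]

/-- The differential marks the root. -/
def markRoot : (DTree α →₀ k) →ₗ[k] (DTree α →₀ k) :=
  Finsupp.linearCombination k fun b => if b.marked then 0 else Finsupp.single b.mark 1

theorem markRoot_single (b : DTree α) :
    markRoot k (Finsupp.single b 1) = if b.marked then 0 else Finsupp.single b.mark 1 := by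
  simp [markRoot]

theorem markRoot_mem (n : ℤ) (v : DTree α →₀ k) (hv : v ∈ homog k sdeg n) :
    markRoot k v ∈ homog k sdeg (n - 1) := by
  induction hv using homog_induction with
  | hs b hb =>
    rw [markRoot_single]
    split_ifs with h
    · exact Submodule.zero_mem _
    · refine Finsupp.single_mem_supported k 1 ?_
      rw [Set.mem_ofPred_eq, sdeg_mark (by simpa using h), hb]
  | h0 => rw [map_zero]; exact Submodule.zero_mem _
  | ha u v _ _ hu hv => rw [map_add]; exact Submodule.add_mem _ hu hv
  | hc c v _ hv => rw [map_smul]; exact Submodule.smul_mem _ _ hv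

theorem markRoot_markRoot (v : DTree α →₀ k) : markRoot k (markRoot k v) = 0 := by
  induction v using Finsupp.induction_linear with
  | zero => simp
  | add u v hu hv => rw [map_add, map_add, hu, hv, add_zero]
  | single b c =>
    rw [markRoot, Finsupp.linearCombination_single, map_smul]
    split_ifs
    · simp
    · rw [Finsupp.linearCombination_single, marked_mark]
      simp

/-- The symmetric operations of degree `-1` on decorated trees. -/
def sop (w : List (DTree α)) : DTree α →₀ k := perturb sdeg (symNode k) (markRoot k) w

variable {k}

/-- The symmetric operations exist in all arities; keeping only those of arity at most `m` is
legitimate because the `n`-th Jacobi identity involves arities at most `n`. -/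
theorem lAxioms (m : ℕ∞) [CharZero k] :
    LAxioms m (fun d => homog k (sdeg (α := α)) (d + 1)) fun j => decOp k sdeg (sop k) j.1 :=
  lAxioms_decOp (perturb_mem (symNode_mem k) (markRoot_mem k))
    (perturb_wordSymm (symNode_wordSymm k)) (perturb_nil rfl)
    (usum_perturb_perturb (fun _ => rfl) (symNode_mem k) (symNode_wordSymm k) (markRoot_mem k)
      (markRoot_markRoot k))

variable (k α) in
/-- The combinations of trees with an unmarked vertex. -/
def bad : Submodule k (DTree α →₀ k) := Finsupp.supported k k {b | ¬ b.Good}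

theorem symNode_mem_bad {w : List (DTree α)} (h : 2 ≤ w.length) : symNode k w ∈ bad α k := by
  classical
  rw [symNode_of_two_le k h]
  split_ifs
  · exact unit_smul_mem _ _ (Finsupp.single_mem_supported k 1 (by simp [good_mkNode]))
  · exact Submodule.zero_mem _

/-- Each correction term in the recursion is a value of `symNode` with at least two inputs, hence
has an unmarked root. -/
theorem sop_sub_mem_bad (w : List (DTree α)) :
    sop k w - markRoot k (symNode k w) ∈ bad α k := by
  rw [sop, perturb_eq, sub_sub_cancel_left]
  refine Submodule.neg_mem _ (usum_mem _ fun I K hp => ?_)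
  rcases K with _ | ⟨b', K⟩
  · rw [← hp.length_eq, List.append_nil, perturbAux_eq_zero _ _ le_rfl, headExt_zero]
    exact Submodule.zero_mem _
  · rw [headExt, Finsupp.linearCombination_apply]
    exact Submodule.sum_mem _ fun b _ => Submodule.smul_mem _ _ (symNode_mem_bad (by simp))

theorem sop_singleton (b : DTree α) : sop k [b] = markRoot k (Finsupp.single b 1) := by
  rw [sop, perturb_eq]
  simp [usum, perturbAux, headExt_zero, symNode]

open Classical in
theorem markRoot_symNode {w : List (DTree α)} (h : 2 ≤ w.length) : markRoot k (symNode k w) =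
    if w.Nodup then wsign w • Finsupp.single (mkNode ↑w true) 1 else 0 := by
  rw [symNode_of_two_le k h]
  split_ifs
  · rw [map_unit_smul, markRoot_single]
    rfl
  · rw [map_zero]

/-- A new root does not repair an unmarked vertex below it. For `j = 1` this fails: the operation
marks the existing root, which may be the only unmarked vertex. -/
theorem decOp_mem_bad {j : ℕ} (hj : 2 ≤ j) (x : Fin j → DTree α →₀ k) (i : Fin j)
    (hx : x i ∈ bad α k) : decOp k sdeg (sop k) j x ∈ bad α k := by
  classical
  refine multilinear_mem_of_span _ (fun a => (fun b => Finsupp.single b (1 : k)) ''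
    if a = i then {b | ¬ b.Good} else Set.univ) _ (fun y hy => ?_) x fun a => ?_
  · choose t ht hty using hy
    rw [← funext hty, decOp_single]
    refine unit_smul_mem _ _ ?_
    rw [← sub_add_cancel (sop k _) (markRoot k (symNode k (List.ofFn t)))]
    refine Submodule.add_mem _ (sop_sub_mem_bad _) ?_
    rw [markRoot_symNode (by simpa)]
    split_ifs
    · refine unit_smul_mem _ _ (Finsupp.single_mem_supported k 1 ?_)
      rw [Set.mem_ofPred_eq, good_mkNode]
      intro h
      have h1 := ht i
      rw [if_pos rfl] at h1
      exact h1 (h.2 _ (Multiset.mem_coe.2 (List.mem_ofFn.2 ⟨i, rfl⟩)))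
    · exact Submodule.zero_mem _
  · rw [← Finsupp.supported_eq_span_single]
    split_ifs with h
    · rw [h]; exact hx
    · simp [Finsupp.supported_univ]

end DTree

/-! ### Leading terms of admissible trees -/

variable {m : ℕ∞} {α : Type}

/-- The decorated tree that corresponds to an admissible tree: the vertices are marked, and the
unary vertices become marks of leaves. -/
def Tr.decorate : Tr m α → DTree α
  | leaf a => .leaf a false
  | node j c => if j.1 = 1 then (decorate (c ⟨0, j.2.1⟩)).mark
      else DTree.mkNode ↑(List.ofFn fun i => decorate (c i)) true

theorem exists_perm_of_ofFn_perm {X : Type*} [LinearOrder X] {n : ℕ} {f g : Fin n → X}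
    (h : (List.ofFn f).Perm (List.ofFn g)) : ∃ σ : Equiv.Perm (Fin n), ∀ i, f (σ i) = g i := by
  have h1 : f ∘ Tuple.sort f = g ∘ Tuple.sort g := by
    refine List.ofFn_injective (List.Perm.eq_of_pairwise' (r := (· ≤ ·)) ?_ ?_
      ((((Tuple.sort f).ofFn_comp_perm f).trans h).trans
        ((Tuple.sort g).ofFn_comp_perm g).symm))
    · exact (Tuple.monotone_sort f).sortedLE_ofFn.pairwise
    · exact (Tuple.monotone_sort g).sortedLE_ofFn.pairwise
  refine ⟨(Tuple.sort g).symm.trans (Tuple.sort f), fun i => ?_⟩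
  have := congrFun h1 ((Tuple.sort g).symm i)
  simpa using this

theorem Tr.isLeaf_iff {T : Tr m α} : T.IsLeaf ↔ ∃ a, T = leaf a := by
  cases T <;> simp [IsLeaf]

theorem Tr.Admissible.decorate_good {T : Tr m α} (hT : T.Admissible) : T.decorate.Good := by
  induction T with
  | leaf a => trivial
  | node j c ih =>
    rw [Tr.decorate]
    split_ifs with hj
    · obtain ⟨a, ha⟩ := Tr.isLeaf_iff.1 (hT.1 hj ⟨0, j.2.1⟩)
      rw [ha]
      trivial
    · rw [DTree.good_mkNode]
      refine ⟨rfl, fun b hb => ?_⟩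
      rw [Multiset.mem_coe, List.mem_ofFn] at hb
      obtain ⟨i, rfl⟩ := hb
      exact ih i (hT.2 i)

/-- An unmarked leaf comes from a bare leaf, a marked leaf from a leaf below a unary vertex, and a
vertex from a vertex of arity at least two, whose inputs are known up to order. Admissibility
excludes all other unary vertices. -/
theorem Tr.same_of_decorate_eq {T : Tr m α} (hT : T.Admissible) :
    ∀ {T' : Tr m α}, T'.Admissible → T.decorate = T'.decorate → Tr.Same T T' := by
  induction T with
  | leaf a =>
    intro T' hT' h
    cases T' with
    | leaf a' =>
      rw [decorate, decorate, DTree.leaf.injEq] at h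
      rw [h.1]
      exact .leaf a'
    | node j' c' =>
      have := congrArg DTree.marked h
      rw [decorate, decorate] at this
      split_ifs at this
      · rw [DTree.marked_mark] at this
        cases this
      · cases this
  | node j c ih =>
    intro T' hT' h
    cases T' with
    | leaf a' =>
      have := congrArg DTree.marked h
      rw [decorate, decorate] at this
      split_ifs at this
      · rw [DTree.marked_mark] at this
        cases this
      · cases this
    | node j' c' =>
      rw [decorate, decorate] at h
      split_ifs at h with hj hj' hj'
      · obtain ⟨a, ha⟩ := Tr.isLeaf_iff.1 (hT.1 hj ⟨0, j.2.1⟩)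
        obtain ⟨a', ha'⟩ := Tr.isLeaf_iff.1 (hT'.1 hj' ⟨0, j'.2.1⟩)
        obtain rfl : j = j' := Subtype.ext (hj.trans hj'.symm)
        rw [ha, ha', decorate, decorate, DTree.mark, DTree.mark, DTree.leaf.injEq] at h
        refine .node j 1 c c' fun i => ?_
        obtain rfl : i = ⟨0, j.2.1⟩ := Fin.ext (by have := i.2; simp only; omega)
        rw [Equiv.Perm.one_apply, ha, ha', h.1]
        exact .leaf a'
      · obtain ⟨a, ha⟩ := Tr.isLeaf_iff.1 (hT.1 hj ⟨0, j.2.1⟩)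
        rw [ha] at h
        cases h
      · obtain ⟨a, ha⟩ := Tr.isLeaf_iff.1 (hT'.1 hj' ⟨0, j'.2.1⟩)
        rw [ha] at h
        cases h
      · have hp := Multiset.coe_eq_coe.1 (DTree.mkNode_injective h)
        have hl := hp.length_eq
        rw [List.length_ofFn, List.length_ofFn] at hl
        obtain rfl : j = j' := Subtype.ext hl
        obtain ⟨σ, hσ⟩ := exists_perm_of_ofFn_perm hp
        exact .node j σ c c' fun i => ih (σ i) (hT.2 _) (hT'.2 i) (hσ i)

theorem Tr.Same.occ_eq [DecidableEq α] {T T' : Tr m α} (h : Tr.Same T T') (a : α) :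
    T.occ a = T'.occ a := by
  induction h with
  | leaf b => rfl
  | node j σ c c' _ ih =>
    rw [Tr.occ, Tr.occ, ← Equiv.sum_comp σ]
    exact Finset.sum_congr rfl fun i _ => ih i

theorem Tr.exists_occ_pos [DecidableEq α] (T : Tr m α) : ∃ a, 0 < T.occ a := by
  induction T with
  | leaf a => exact ⟨a, by simp [Tr.occ]⟩
  | node j c ih =>
    obtain ⟨a, ha⟩ := ih ⟨0, j.2.1⟩
    exact ⟨a, ha.trans_le (by
      rw [Tr.occ]
      exact Finset.single_le_sum (f := fun i => (c i).occ a) (fun _ _ => Nat.zero_le _)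
        (Finset.mem_univ _))⟩

variable {k : Type*} [Field k]

variable (k) in
/-- Evaluation of trees in the algebra of decorated trees. -/
def Tr.decEval : Tr m α → DTree α →₀ k
  | leaf a => Finsupp.single (.leaf a false) 1
  | node j c => decOp k DTree.sdeg (DTree.sop k) j.1 fun i => decEval (c i)

theorem Tr.decEval_mem [CharZero k] (T : Tr m α) :
    T.decEval k ∈ homog k DTree.sdeg (T.deg + 1) := by
  induction T with
  | leaf a => exact Finsupp.single_mem_supported k 1 rfl
  | node j c ih =>
    rw [Tr.decEval, Tr.deg]
    exact (DTree.lAxioms m).degree j _ _ ih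

/-- The leading term. Below a vertex with at least two inputs the subtrees may be replaced by their
leading terms, as bad arguments give bad values; the operation on these is the marked vertex modulo
bad trees. A unary vertex of an admissible tree just marks a leaf. -/
theorem Tr.decEval_sub_mem [DecidableEq α] {T : Tr m α} (hT : T.Admissible) (hocc : ∀ a, T.occ a ≤ 1) :
    ∃ u : ℤˣ, T.decEval k - u • Finsupp.single T.decorate 1 ∈ DTree.bad α k := by
  induction T with
  | leaf a => exact ⟨1, by rw [one_smul, Tr.decEval, Tr.decorate, sub_self]; exact Submodule.zero_mem _⟩
  | node j c ih =>
    rw [Tr.decEval, Tr.decorate]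
    split_ifs with hj
    · obtain ⟨j, hj1, hj2⟩ := j
      subst hj
      obtain ⟨a, ha⟩ := Tr.isLeaf_iff.1 (hT.1 rfl ⟨0, hj1⟩)
      refine ⟨decSign DTree.sdeg (fun _ : Fin 1 => DTree.leaf a false), ?_⟩
      have hc : (fun i => (c i).decEval k) = fun _ : Fin 1 => Finsupp.single (DTree.leaf a false) 1 := by
        funext i
        rw [Subsingleton.elim i ⟨0, hj1⟩, ha, Tr.decEval]
      rw [hc, ha, decOp_single]
      have : List.ofFn (fun _ : Fin 1 => DTree.leaf a false) = [DTree.leaf a false] := by simp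
      rw [this, DTree.sop_singleton, DTree.markRoot_single, Tr.decorate]
      simp only [DTree.marked, Bool.false_eq_true, if_false, sub_self]
      exact Submodule.zero_mem _
    · have hj2 : 2 ≤ j.1 := by have := j.2.1; omega
      have hocc' : ∀ i a, (c i).occ a ≤ 1 := fun i a => (hocc a).trans' (by
        rw [Tr.occ]
        exact Finset.single_le_sum (f := fun i => (c i).occ a) (fun _ _ => Nat.zero_le _)
          (Finset.mem_univ _))
      choose u hu using fun i => ih i (hT.2 i) (hocc' i)
      have h1 := multilinear_sub_mem (decOp k DTree.sdeg (DTree.sop k) j.1) (DTree.bad α k)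
        (DTree.bad α k) (fun x i hx => DTree.decOp_mem_bad hj2 x i hx) _ _ hu
      -- Two inputs with equal decoration would be the same tree and share a label, contrary to
      -- `hocc`; so the symmetric node does not vanish.
      have hnd : (List.ofFn fun i => (c i).decorate).Nodup := by
        rw [List.nodup_ofFn]
        intro i i' hii
        by_contra hne
        have hs := Tr.same_of_decorate_eq (hT.2 i) (hT.2 i') hii
        obtain ⟨a, ha⟩ := (c i).exists_occ_pos
        have h2 := hocc a
        rw [Tr.occ] at h2
        have h3 := Finset.add_le_sum (f := fun i => (c i).occ a) (fun _ _ => Nat.zero_le _)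
          (Finset.mem_univ i) (Finset.mem_univ i') hne
        have h4 := hs.occ_eq a
        omega
      have h5 := DTree.sop_sub_mem_bad (k := k) (List.ofFn fun i => (c i).decorate)
      rw [DTree.markRoot_symNode (by simpa), if_pos hnd] at h5
      refine ⟨(∏ i, u i) * decSign DTree.sdeg (fun i => (c i).decorate) *
        DTree.wsign (List.ofFn fun i => (c i).decorate), ?_⟩
      have h6 : decOp k DTree.sdeg (DTree.sop k) j.1
          (fun i => u i • Finsupp.single (c i).decorate 1) =
          ((∏ i, u i) * decSign DTree.sdeg (fun i => (c i).decorate)) •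
            DTree.sop k (List.ofFn fun i => (c i).decorate) := by
        simp_rw [unit_smul_eq_intCast_smul (k := k) (u _)]
        rw [MultilinearMap.map_smul_univ, decOp_single, mul_smul,
          unit_smul_eq_intCast_smul (k := k) (∏ i, u i)]
        congr 1
        rw [Units.coe_prod, Int.cast_prod]
      rw [h6] at h1
      have h7 := unit_smul_mem _ ((∏ i, u i) * decSign DTree.sdeg fun i => (c i).decorate) h5
      rw [smul_sub, ← mul_smul] at h7
      rw [← sub_add_sub_cancel]
      exact Submodule.add_mem _ h1 h7

/-- The evaluation in decorated trees respects the relations, hence descends to the operad. The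
coefficient of the decoration of `τ₀`, which no bad tree affects, is plus or minus the coefficient
of `τ₀`. -/
theorem linearIndependent_admissible [CharZero k]
    (s : (n : ℕ) → AdmTree m n → {T : LTree m n // T.1.Admissible})
    (hs : ∀ (n : ℕ) (τ : AdmTree m n), (Quotient.mk (admSetoid m n) (s n τ) : AdmTree m n) = τ)
    (n : ℕ) : LinearIndependent k (fun τ : AdmTree m n => treeClass k (s n τ).1) := by
  classical
  let F : (LTree m n →₀ k) →ₗ[k] (DTree (Fin n) →₀ k) :=
    Finsupp.linearCombination k fun T => T.1.decEval k
  have hF : ∀ r, GRel k Tr.node Tr.deg (Finsupp.mapDomain Subtype.val r) → F r = 0 := by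
    intro r hr
    have := GRel.linearCombination_eq_zero (DTree.lAxioms m) (f := Tr.decEval k)
      (fun j T => by rw [Tr.decEval]) Tr.decEval_mem hr
    rwa [Finsupp.linearCombination_mapDomain] at this
  have hsign : ∀ τ : AdmTree m n, ∃ u : ℤˣ, (s n τ).1.1.decEval k -
      u • Finsupp.single (s n τ).1.1.decorate 1 ∈ DTree.bad (Fin n) k :=
    fun τ => Tr.decEval_sub_mem (s n τ).2 fun a => ((s n τ).1.2 a).le
  choose u hu using hsign
  have hinj : ∀ τ τ', (s n τ).1.1.decorate = (s n τ').1.1.decorate → τ = τ' := by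
    intro τ τ' h
    rw [← hs n τ, ← hs n τ']
    exact Quotient.sound (Tr.same_of_decorate_eq (s n τ).2 (s n τ').2 h)
  have hbad : ∀ v ∈ DTree.bad (Fin n) k, ∀ τ, v (s n τ).1.1.decorate = 0 := by
    intro v hv τ
    by_contra h
    exact (Finsupp.mem_supported k v).1 hv (Finsupp.mem_support_iff.2 h) (s n τ).2.decorate_good
  rw [linearIndependent_iff]
  intro c hc
  ext τ₀
  have h1 := congrArg (LOperad.lift F hF) hc
  rw [Finsupp.apply_linearCombination, map_zero] at h1
  have h2 : (LOperad.lift F hF ∘ fun τ : AdmTree m n => treeClass k (s n τ).1) =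
      fun τ => (s n τ).1.1.decEval k := by
    funext τ
    rw [Function.comp_apply, LOperad.lift_treeClass]
    simp [F]
  rw [h2, Finsupp.linearCombination_apply] at h1
  have h3 := DFunLike.congr_fun h1 (s n τ₀).1.1.decorate
  rw [Finsupp.sum, Finsupp.finsetSum_apply, Finset.sum_eq_single τ₀] at h3
  · have h4 := hbad _ (hu τ₀) τ₀
    rw [Finsupp.sub_apply, sub_eq_zero] at h4
    rw [Finsupp.smul_apply, h4] at h3
    rcases Int.units_eq_one_or (u τ₀) with h | h <;> simpa [h, Units.smul_def] using h3
  · intro τ _ hne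
    have h4 := hbad _ (hu τ) τ₀
    rw [Finsupp.sub_apply, sub_eq_zero] at h4
    rw [Finsupp.smul_apply, h4]
    have h5 : (Finsupp.single (s n τ).1.1.decorate (1 : k)) (s n τ₀).1.1.decorate = 0 :=
      Finsupp.single_eq_of_ne fun h => hne (hinj _ _ h.symm)
    rcases Int.units_eq_one_or (u τ) with h | h <;> simp [h, h5, Units.smul_def]
  · intro h
    rw [Finsupp.notMem_support_iff.1 h, zero_smul, Finsupp.zero_apply]

end Independence

/-! ### Trees with coloured leaves -/

/-- Planar trees with leaves coloured by `ι`. -/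
inductive PTree (m : ℕ∞) (ι : Type*) where
  | leaf (i : ι) : PTree m ι
  | node (j : Arity m) (c : Fin j.1 → PTree m ι) : PTree m ι

section Signs

variable {m : ℕ∞} {ι : Type*} {n n' : ℕ}

/-- The degree of a tree whose leaves coloured by `i` have degree `δ i`. -/
def PTree.deg (δ : ι → ℤ) : PTree m ι → ℤ
  | leaf i => δ i
  | node j c => (j.1 : ℤ) - 2 + ∑ i, deg δ (c i)

theorem prod_outerArgs_mul {M : Type*} [CommMonoid M] (j : Arity m) (p : Fin j.1) (u v : M)
    (g : Fin j.1 → M) : ∏ b, outerArgs j p (u * v) g b = u * ∏ b, outerArgs j p v g b := by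
  rw [← Finset.mul_prod_erase _ _ (Finset.mem_univ (outerZero j p)),
    ← Finset.mul_prod_erase _ _ (Finset.mem_univ (outerZero j p)), ← mul_assoc]
  congr 1
  refine Finset.prod_congr rfl fun b hb => ?_
  have : (b : ℕ) ≠ 0 := fun h0 => (Finset.mem_erase.1 hb).1 (Fin.ext h0)
  simp [outerArgs, this]

theorem prod_outerArgs_prod_innerArgs {M : Type*} [CommMonoid M] (j : Arity m) (p : Fin j.1)
    (g : Fin j.1 → M) : ∏ b, outerArgs j p (∏ a, innerArgs j p g a) g b = ∏ a, g a :=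
  sum_outerArgs_sum_innerArgs (M := Additive M) j p g

namespace Tr

/-- The colouring of the leaves of a labelled tree. -/
def fill {α : Type} (w : α → ι) : Tr m α → PTree m ι
  | leaf a => .leaf (w a)
  | node j c => .node j fun i => fill w (c i)

/-- The total degree of the leaves. -/
def labelDeg (d : Fin n → ℤ) (T : Tr m (Fin n)) : ℤ := ∑ x, (T.occ x : ℤ) * d x

/-- The exponent of the Koszul sign of sorting the leaves of two consecutive trees. -/
def crossing (d : Fin n → ℤ) (A B : Tr m (Fin n)) : ℤ :=
  ∑ x, ∑ y, if y < x then (A.occ x : ℤ) * B.occ y * (d x * d y) else 0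

/-- The Koszul sign of moving the leaves of `A` past the tree `B`, and of sorting all leaves. -/
def swapSign (d : Fin n → ℤ) (A B : Tr m (Fin n)) : ℤˣ :=
  (crossing d A B + labelDeg d A * B.deg).negOnePow

/-- The Koszul sign of moving the leaves, the degrees of which are given by `d`, to the right of
all vertices and of sorting them. -/
def sgn (d : Fin n → ℤ) : Tr m (Fin n) → ℤˣ
  | leaf _ => 1
  | node _ c => (∏ i, sgn d (c i)) * pairProd fun a b => swapSign d (c a) (c b)

theorem labelDeg_node (d : Fin n → ℤ) (j : Arity m) (c : Fin j.1 → Tr m (Fin n)) :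
    labelDeg d (node j c) = ∑ i, labelDeg d (c i) := by
  simp only [labelDeg, occ]
  rw [Finset.sum_comm (f := fun i x => (((c i).occ x : ℕ) : ℤ) * d x)]
  refine Finset.sum_congr rfl fun x _ => ?_
  push_cast
  rw [Finset.sum_mul]

theorem crossing_node (d : Fin n → ℤ) (j : Arity m) (c : Fin j.1 → Tr m (Fin n))
    (B : Tr m (Fin n)) : crossing d (node j c) B = ∑ i, crossing d (c i) B := by
  simp only [crossing, occ]
  symm
  rw [Finset.sum_comm]
  refine Finset.sum_congr rfl fun x _ => ?_
  rw [Finset.sum_comm]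
  refine Finset.sum_congr rfl fun y _ => ?_
  split_ifs
  · push_cast
    rw [Finset.sum_mul, Finset.sum_mul]
  · exact Finset.sum_const_zero

theorem swapSign_node (d : Fin n → ℤ) (j : Arity m) (c : Fin j.1 → Tr m (Fin n))
    (B : Tr m (Fin n)) : swapSign d (node j c) B = ∏ i, swapSign d (c i) B := by
  simp only [swapSign]
  rw [prod_negOnePow, crossing_node, labelDeg_node, Finset.sum_add_distrib, Finset.sum_mul]

theorem swapSign_congr (d : Fin n → ℤ) {A A' B B' : Tr m (Fin n)} (hA : ∀ x, A.occ x = A'.occ x)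
    (hB : ∀ x, B.occ x = B'.occ x) (hB' : B.deg = B'.deg) : swapSign d A B = swapSign d A' B' := by
  simp only [swapSign, crossing, labelDeg, hA, hB, hB']

theorem deg_fill (δ : ι → ℤ) (w : Fin n → ι) (T : Tr m (Fin n)) :
    (T.fill w).deg δ = T.deg + labelDeg (fun a => δ (w a)) T := by
  induction T with
  | leaf a => simp [fill, PTree.deg, deg, labelDeg, occ]
  | node j c ih =>
    rw [fill, PTree.deg, deg, labelDeg_node, add_assoc, ← Finset.sum_add_distrib]
    exact congrArg _ (Finset.sum_congr rfl fun i _ => ih i)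

theorem occ_le_of_node {α : Type} [DecidableEq α] {j : Arity m} {c : Fin j.1 → Tr m α} {g : α → ℕ}
    (h : ∀ a, (node j c).occ a ≤ g a) (i : Fin j.1) (a : α) : (c i).occ a ≤ g a :=
  (h a).trans' (by
    rw [occ]
    exact Finset.single_le_sum (f := fun i => (c i).occ a) (fun _ _ => Nat.zero_le _)
      (Finset.mem_univ _))

theorem occ_mul_occ {α : Type} [DecidableEq α] {j : Arity m} {c : Fin j.1 → Tr m α}
    (h : ∀ a, (node j c).occ a ≤ 1) {i i' : Fin j.1} (hi : i ≠ i') (a : α) :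
    (c i).occ a * (c i').occ a = 0 := by
  have h2 := h a
  rw [occ] at h2
  have h3 := Finset.add_le_sum (f := fun i => (c i).occ a) (fun _ _ => Nat.zero_le _)
    (Finset.mem_univ i) (Finset.mem_univ i') hi
  rw [Nat.mul_eq_zero]
  omega

/-- For trees without common labels, each pair of a leaf of `A` and a leaf of `B` is out of order in
exactly one of the two arrangements. -/
theorem crossing_add_crossing (d : Fin n → ℤ) {A B : Tr m (Fin n)}
    (h : ∀ x, A.occ x * B.occ x = 0) :
    crossing d A B + crossing d B A = labelDeg d A * labelDeg d B := by
  rw [crossing, crossing, Finset.sum_comm (f := fun x y => if y < x then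
    (B.occ x : ℤ) * A.occ y * (d x * d y) else 0), labelDeg, labelDeg, Finset.sum_mul_sum,
    ← Finset.sum_add_distrib]
  refine Finset.sum_congr rfl fun x _ => ?_
  rw [← Finset.sum_add_distrib]
  refine Finset.sum_congr rfl fun y _ => ?_
  rcases lt_trichotomy x y with hxy | rfl | hxy
  · rw [if_neg hxy.not_gt, if_pos hxy]
    ring
  · have : (A.occ x : ℤ) * B.occ x = 0 := by exact_mod_cast h x
    rw [if_neg (lt_irrefl _), if_neg (lt_irrefl _)]
    linear_combination (-d x * d x) * this
  · rw [if_pos hxy, if_neg hxy.not_gt]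
    ring

/-- Compares two commutation rules: the degree of a coloured tree includes its leaves, that of a
labelled tree only its vertices. `swapSign` accounts for the difference. -/
theorem swapSign_mul_swapSign (d : Fin n → ℤ) {A B : Tr m (Fin n)}
    (h : ∀ x, A.occ x * B.occ x = 0) : swapSign d A B * swapSign d B A =
      (1 + (A.deg + labelDeg d A) * (B.deg + labelDeg d B)).negOnePow *
        (1 + A.deg * B.deg).negOnePow := by
  rw [swapSign, swapSign, ← Int.negOnePow_add, ← Int.negOnePow_add]
  have := crossing_add_crossing d h
  refine negOnePow_congr ⟨- 1 - A.deg * B.deg, ?_⟩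
  linear_combination this

theorem chi_mul_sgn (d : Fin n → ℤ) {j : Arity m} {c : Fin j.1 → Tr m (Fin n)}
    (h : ∀ a, (node j c).occ a ≤ 1) (σ : Equiv.Perm (Fin j.1)) :
    chi σ (fun a => (c a).deg + labelDeg d (c a)) * sgn d (node j fun a => c (σ a)) =
      chi σ (fun a => (c a).deg) * sgn d (node j c) := by
  rw [sgn, sgn, Equiv.prod_comp σ fun a => sgn d (c a), mul_left_comm, mul_left_comm (chi σ _)]
  congr 1
  rw [chi_eq_invProd, chi_eq_invProd]
  exact invProd_mul_pairProd_comp σ (s := fun a b => swapSign d (c a) (c b)) fun x y hxy =>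
    swapSign_mul_swapSign d (occ_mul_occ h hxy)

theorem chi_mul_sgn' (d : Fin n → ℤ) {j : Arity m} {c : Fin j.1 → Tr m (Fin n)}
    (h : ∀ a, (node j c).occ a ≤ 1) (σ : Equiv.Perm (Fin j.1)) :
    chi σ (fun a => (c a).deg) * sgn d (node j fun a => c (σ a)) =
      chi σ (fun a => (c a).deg + labelDeg d (c a)) * sgn d (node j c) := by
  have h1 := chi_mul_sgn d h σ
  generalize sgn d (node j fun a => c (σ a)) = s at *
  generalize sgn d (node j c) = t at *
  generalize chi σ (fun a => (c a).deg + labelDeg d (c a)) = u at *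
  generalize chi σ (fun a => (c a).deg) = v at *
  rw [← one_mul (v * s), ← Int.units_mul_self u, ← mul_one (u * t), ← Int.units_mul_self v]
  calc u * u * (v * s) = (u * s) * (u * v) := by ac_rfl
    _ = _ := by rw [h1]; ac_rfl

/-- The inner vertex precedes all leaves, so no leaf has to pass it, and the planar order of the
leaves is that of the corolla. Hence all terms of a Jacobi relation with a fixed `σ` have the same
sign. -/
theorem sgn_nest (d : Fin n → ℤ) (j : Arity m) (p : Fin j.1) (c : Fin j.1 → Tr m (Fin n)) :
    sgn d (nest node j p c) = sgn d (node j c) := by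
  rw [nest_eq, sgn, sgn]
  have h0 : ∀ b : Fin (outerArity j p).1, (b : ℕ) = 0 →
      outerArgs j p (node (innerArity j p) (innerArgs j p c)) c b =
        node (innerArity j p) (innerArgs j p c) := fun b hb => by rw [outerArgs, if_pos hb]
  have h1 : ∀ b : Fin (outerArity j p).1, (b : ℕ) ≠ 0 →
      outerArgs j p (node (innerArity j p) (innerArgs j p c)) c b = c (outerEmb j p b) :=
    fun b hb => by rw [outerArgs, if_neg hb]; rfl
  rw [pairProd_nest j p (s := fun a b => swapSign d (c a) (c b))
    (s₁ := fun a b => swapSign d (innerArgs j p c a) (innerArgs j p c b))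
    (s₂ := fun a b => swapSign d (outerArgs j p (node (innerArity j p) (innerArgs j p c)) c a)
      (outerArgs j p (node (innerArity j p) (innerArgs j p c)) c b)) (fun _ _ => rfl)
      (fun a b ha hb => by rw [h0 a ha, h1 b hb, swapSign_node]; rfl)
      (fun a b ha hb => by rw [h1 a ha, h1 b hb]), ← mul_assoc]
  congr 1
  rw [mul_comm, ← prod_outerArgs_prod_innerArgs j p, ← prod_outerArgs_mul]
  refine Finset.prod_congr rfl fun b _ => ?_
  rw [outerArgs_map (sgn d), sgn, mul_comm]
  rfl

/-- The sign of a grafting depends on the grafted tree only through its own sign, its degree and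
its leaves. -/
theorem sgn_update (d : Fin n → ℤ) (j : Arity m) (c : Fin j.1 → Tr m (Fin n)) (i : Fin j.1)
    {V V' : Tr m (Fin n)} (h : ∀ x, V.occ x = V'.occ x) (h' : V.deg = V'.deg) :
    sgn d (node j (Function.update c i V)) =
      sgn d (node j (Function.update c i V')) * sgn d V' * sgn d V := by
  rw [sgn, sgn, ← Finset.mul_prod_erase _ _ (Finset.mem_univ i),
    ← Finset.mul_prod_erase _ _ (Finset.mem_univ i), Function.update_self, Function.update_self]
  have h1 : ∏ a ∈ Finset.univ.erase i, sgn d (Function.update c i V a) =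
      ∏ a ∈ Finset.univ.erase i, sgn d (Function.update c i V' a) :=
    Finset.prod_congr rfl fun a ha => by
      rw [Function.update_of_ne (Finset.ne_of_mem_erase ha),
        Function.update_of_ne (Finset.ne_of_mem_erase ha)]
  have h2 : ∀ a x, (Function.update c i V a).occ x = (Function.update c i V' a).occ x := by
    intro a x
    rcases eq_or_ne a i with rfl | ha
    · rw [Function.update_self, Function.update_self, h]
    · rw [Function.update_of_ne ha, Function.update_of_ne ha]
  have h3 : ∀ a, (Function.update c i V a).deg = (Function.update c i V' a).deg := by
    intro a
    rcases eq_or_ne a i with rfl | ha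
    · rw [Function.update_self, Function.update_self, h']
    · rw [Function.update_of_ne ha, Function.update_of_ne ha]
  rw [h1, pairProd_congr fun a b _ => swapSign_congr d (h2 a) (h2 b) (h3 b)]
  generalize (∏ a ∈ Finset.univ.erase i, sgn d (Function.update c i V' a)) = P
  generalize pairProd (fun a b => swapSign d (Function.update c i V' a)
    (Function.update c i V' b)) = Q
  calc sgn d V * P * Q = (sgn d V' * sgn d V') * (sgn d V * P * Q) := by
        rw [Int.units_mul_self, one_mul]
    _ = _ := by ac_rfl

/-! ### The behaviour of the relations under colouring -/

variable {k : Type*} [Field k] (δ : ι → ℤ) (w : Fin n → ι)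

variable (k) in
/-- The colouring of combinations of trees, with the Koszul signs. -/
def fillMap : (Tr m (Fin n) →₀ k) →ₗ[k] (PTree m ι →₀ k) :=
  Finsupp.linearCombination k fun T =>
    sgn (fun a => δ (w a)) T • Finsupp.single (T.fill w) 1

theorem fillMap_single (T : Tr m (Fin n)) : fillMap k δ w (Finsupp.single T 1) =
    sgn (fun a => δ (w a)) T • Finsupp.single (T.fill w) 1 := by
  simp [fillMap]

theorem fill_nest (j : Arity m) (p : Fin j.1) (c : Fin j.1 → Tr m (Fin n)) :
    (nest node j p c).fill w = nest PTree.node j p fun a => (c a).fill w :=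
  nest_map (fill w) node PTree.node j p c fun _ _ => by rw [fill]

theorem fillMap_antisymmRel {j : Arity m} {c : Fin j.1 → Tr m (Fin n)}
    (h : ∀ a, (node j c).occ a ≤ 1) (σ : Equiv.Perm (Fin j.1)) :
    fillMap k δ w (antisymmRel k node deg j c σ) =
      sgn (fun a => δ (w a)) (node j fun a => c (σ a)) •
        antisymmRel k PTree.node (PTree.deg δ) j (fun a => (c a).fill w) σ := by
  have h1 := chi_mul_sgn (fun a => δ (w a)) h σ
  rw [antisymmRel, antisymmRel, map_sub, map_unit_smul, fillMap_single, fillMap_single, smul_sub,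
    smul_smul, smul_smul, ← h1, fill, fill]
  simp only [deg_fill δ w]
  rw [mul_comm]

theorem fillMap_jacobiRel {j : Arity m} {c : Fin j.1 → Tr m (Fin n)}
    (h : ∀ a, (node j c).occ a ≤ 1) :
    fillMap k δ w (jacobiRel k node deg j c) = sgn (fun a => δ (w a)) (node j c) •
        jacobiRel k PTree.node (PTree.deg δ) j (fun a => (c a).fill w) := by
  rw [jacobiRel, jacobiRel, map_sum, Finset.smul_sum]
  refine Finset.sum_congr rfl fun p _ => ?_
  rw [map_sum, Finset.smul_sum]
  refine Finset.sum_congr rfl fun σ _ => ?_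
  rw [map_unit_smul, fillMap_single, fill_nest, sgn_nest, smul_smul, smul_smul]
  congr 1
  have h1 := chi_mul_sgn' (fun a => δ (w a)) h σ
  simp only [deg_fill δ w]
  rw [mul_right_comm, h1]
  ac_rfl

/-- All trees in `r` have the same labels and the same degree, so by `sgn_update` grafting changes
their signs by one common factor, which is read off from any tree `V'` of the support. -/
theorem fillMap_mapDomain (j : Arity m) (c : Fin j.1 → Tr m (Fin n)) (i : Fin j.1)
    {g : Fin n → ℕ} {e : ℤ} {r : Tr m (Fin n) →₀ k}
    (h : r ∈ Finsupp.supported k k {V | (fun a => V.occ a) = g})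
    (h' : r ∈ Finsupp.supported k k {V | V.deg = e}) :
    ∃ u : ℤˣ, fillMap k δ w (Finsupp.mapDomain (fun V => node j (Function.update c i V)) r) =
      u • Finsupp.mapDomain (fun S => PTree.node j (Function.update (fun a => (c a).fill w) i S))
        (fillMap k δ w r) := by
  rcases eq_or_ne r 0 with rfl | hr
  · exact ⟨1, by simp⟩
  · obtain ⟨V', hV'⟩ := Finsupp.support_nonempty_iff.2 hr
    rw [Finsupp.mem_supported] at h h'
    refine ⟨sgn (fun a => δ (w a)) (node j (Function.update c i V')) *
      sgn (fun a => δ (w a)) V', ?_⟩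
    have h1 : r ∈ Submodule.span k ((fun V => Finsupp.single V (1 : k)) '' r.support) := by
      rw [← Finsupp.supported_eq_span_single]
      exact Finsupp.mem_supported_support k r
    rw [← Finsupp.lmapDomain_apply k k, ← Finsupp.lmapDomain_apply k k]
    generalize r.support = s at h h' hV' h1
    clear hr
    induction h1 using Submodule.span_induction with
    | mem r hr =>
      obtain ⟨V, hV, rfl⟩ := hr
      rw [Finsupp.lmapDomain_apply, Finsupp.mapDomain_single, fillMap_single, fillMap_single,
        map_unit_smul, Finsupp.lmapDomain_apply, Finsupp.mapDomain_single, smul_smul]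
      congr 1
      · exact sgn_update _ j c i (fun x => congrFun ((h hV).trans (h hV').symm) x)
          ((h' hV).trans (h' hV').symm)
      · rw [fill]
        congr 2
        funext a
        rcases eq_or_ne a i with rfl | ha
        · rw [Function.update_self, Function.update_self]
        · rw [Function.update_of_ne ha, Function.update_of_ne ha]
    | zero => simp
    | add r s _ _ hr hs => rw [map_add, map_add, map_add, map_add, hr, hs, smul_add]
    | smul a r _ hr => rw [map_smul, map_smul, map_smul, map_smul, hr, unit_smul_comm]

theorem exists_occ_level {α : Type} [DecidableEq α] {r : Tr m α →₀ k}
    (hr : GRel k node deg r) : ∃ g, r ∈ Finsupp.supported k k {V | (fun a => V.occ a) = g} :=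
  GRel.exists_level (M := α → ℕ) (c := fun _ => 0) (ν := fun V a => V.occ a) occ_node (fun _ _ _ => rfl) hr

theorem exists_deg_level {α : Type} {r : Tr m α →₀ k} (hr : GRel k node deg r) :
    ∃ e, r ∈ Finsupp.supported k k {V | V.deg = e} :=
  GRel.exists_level (M := ℤ) (c := fun n => (n : ℤ) - 2) (fun j T => by rw [deg])
    (fun n p hp => by push_cast [Nat.cast_sub hp.le]; ring) hr

/-- Relations between trees with distinct labels become relations between coloured trees. -/
theorem fillMap_mem_relations {r : Tr m (Fin n) →₀ k} (hr : GRel k node deg r)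
    (h : ∀ V ∈ r.support, ∀ a, V.occ a ≤ 1) :
    fillMap k δ w r ∈ relations k PTree.node (PTree.deg δ) := by
  classical
  induction hr with
  -- If the relation is not zero, some tree occurs in it; as labels are constant along the relation,
  -- distinctness of labels passes from that tree to `node j c`.
  | anti j c σ =>
    rcases eq_or_ne (antisymmRel k node deg j c σ) 0 with h0 | h0
    · rw [h0, map_zero]; exact Submodule.zero_mem _
    · obtain ⟨V, hV⟩ := Finsupp.support_nonempty_iff.2 h0
      have h1 := (Finsupp.mem_supported _ _).1 (antisymmRel_mem_supported (M := Fin n → ℕ)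
        (c := fun _ => 0) (ν := fun V a => V.occ a) occ_node j c σ) hV
      have h2 : ∀ a, (node j c).occ a ≤ 1 := fun a => by
        rw [congrFun (occ_node j c) a, ← congrFun h1 a]
        exact h V hV a
      rw [fillMap_antisymmRel δ w h2]
      exact unit_smul_mem _ _ (Submodule.subset_span (.anti j _ σ))
  | jac j c =>
    rcases eq_or_ne (jacobiRel k node deg j c) 0 with h0 | h0
    · rw [h0, map_zero]; exact Submodule.zero_mem _
    · obtain ⟨V, hV⟩ := Finsupp.support_nonempty_iff.2 h0
      have h1 := (Finsupp.mem_supported _ _).1 (jacobiRel_mem_supported (M := Fin n → ℕ)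
        (c := fun _ => 0) (ν := fun V a => V.occ a) occ_node (fun _ _ _ => rfl) j c) hV
      have h2 : ∀ a, (node j c).occ a ≤ 1 := fun a => by
        have h3 := h V hV a
        rw [show V.occ a = _ from congrFun h1 a] at h3
        rw [congrFun (occ_node j c) a]
        simpa using h3
      rw [fillMap_jacobiRel δ w h2]
      exact unit_smul_mem _ _ (Submodule.subset_span (.jac j _))
  | graft j c i r hr ih =>
    obtain ⟨g, hg⟩ := exists_occ_level hr
    obtain ⟨e, he⟩ := exists_deg_level hr
    obtain ⟨u, hu⟩ := fillMap_mapDomain δ w j c i hg he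
    rw [hu]
    refine unit_smul_mem _ _ (graft_mem_relations j _ i (ih fun V hV a => ?_))
    have hinj : Function.Injective fun V => node j (Function.update c i V) := by
      intro V V' hVV
      simp only [node.injEq, heq_eq_eq, true_and] at hVV
      simpa using congrFun hVV i
    have h1 : node j (Function.update c i V) ∈ (Finsupp.mapDomain (fun V =>
        node j (Function.update c i V)) r).support := by
      rw [Finsupp.mapDomain_support_of_injective hinj]
      exact Finset.mem_image_of_mem (fun V => node j (Function.update c i V)) hV
    have h2 := occ_le_of_node (g := fun _ => 1) (h _ h1) i a
    simpa using h2

/-- Relations between coloured trees are obtained from relations between labelled trees. -/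
theorem exists_fillMap_eq {r : PTree m ι →₀ k} (hr : GRel k PTree.node (PTree.deg δ) r) :
    ∃ S : PTree m ι, ∀ (n : ℕ) (w : Fin n → ι) (U : Tr m (Fin n)), U.fill w = S →
      (∀ a, U.occ a ≤ 1) → ∃ (r' : Tr m (Fin n) →₀ k) (u : ℤˣ), GRel k node deg r' ∧
        r' ∈ Finsupp.supported k k {V | (fun a => V.occ a) = fun a => U.occ a} ∧
        fillMap k δ w r' = u • r := by
  have hnode : ∀ {n : ℕ} {w : Fin n → ι} {U : Tr m (Fin n)} {j : Arity m} {c : Fin j.1 → PTree m ι},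
      U.fill w = PTree.node j c → ∃ c', U = node j c' ∧ ∀ i, (c' i).fill w = c i := by
    intro n w U j c h
    cases U with
    | leaf a => rw [fill] at h; cases h
    | node j' c' =>
      rw [fill, PTree.node.injEq] at h
      obtain ⟨rfl, h⟩ := h
      exact ⟨c', rfl, congrFun (eq_of_heq h)⟩
  -- The witness `S` is a coloured tree with the leaves of the relation, so a labelled tree `U` over
  -- `S` supplies labels for the whole relation. Controlling the labels of `r'` is what lets the
  -- induction continue through graftings.
  induction hr with
  | anti j T σ =>
    refine ⟨PTree.node j T, fun n w U hU hocc => ?_⟩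
    obtain ⟨c, rfl, hc⟩ := hnode hU
    refine ⟨antisymmRel k node deg j c σ, _, .anti j c σ, ?_,
      (fillMap_antisymmRel δ w hocc σ).trans (by rw [funext hc])⟩
    rw [occ_node]
    exact antisymmRel_mem_supported (k := k) (dg := deg) (M := Fin n → ℕ) (c := fun _ => 0) (ν := fun V a => V.occ a) occ_node j c σ
  | jac j T =>
    refine ⟨PTree.node j T, fun n w U hU hocc => ?_⟩
    obtain ⟨c, rfl, hc⟩ := hnode hU
    refine ⟨jacobiRel k node deg j c, _, .jac j c, ?_,
      (fillMap_jacobiRel δ w hocc).trans (by rw [funext hc])⟩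
    rw [occ_node]
    have := jacobiRel_mem_supported (k := k) (dg := deg) (M := Fin n → ℕ) (c := fun _ => 0) (ν := fun V a => V.occ a) occ_node
      (fun _ _ _ => rfl) j c
    simpa only [add_zero] using this
  | graft j T i r _ ih =>
    obtain ⟨S, hS⟩ := ih
    refine ⟨PTree.node j (Function.update T i S), fun n w U hU hocc => ?_⟩
    obtain ⟨c, rfl, hc⟩ := hnode hU
    obtain ⟨r', u, hr', hsupp, hu⟩ := hS n w (c i) (by rw [hc, Function.update_self])
      (occ_le_of_node hocc i)
    obtain ⟨e, he⟩ := exists_deg_level hr'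
    obtain ⟨u', hu'⟩ := fillMap_mapDomain δ w j c i hsupp he
    refine ⟨_, u' * u, .graft j c i r' hr', ?_, ?_⟩
    · refine mapDomain_mem_supported_level (fun V hV => ?_) hsupp
      rw [additive_nd_update (nd := node) (c := fun _ => 0) (ν := fun V a => V.occ a) occ_node j c i V, hV, occ_node,
        ← Finset.add_sum_erase _ _ (Finset.mem_univ i)]
    · rw [hu', hu, ← Finsupp.lmapDomain_apply k k, map_unit_smul, mul_smul]
      congr 3
      rw [Finsupp.lmapDomain_apply]
      congr 1
      funext S'
      congr 1
      funext a
      rcases eq_or_ne a i with rfl | ha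
      · rw [Function.update_self, Function.update_self]
      · rw [Function.update_of_ne ha, Function.update_of_ne ha, hc, Function.update_of_ne ha]

end Tr

end Signs

/-! ### Signs of relabelled trees -/

theorem prod_diag_mul_pairProd {n : ℕ} (h : Fin n → Fin n → ℤˣ) :
    (∏ a, h a a) * pairProd (fun a b => h a b * h b a) = ∏ a, ∏ b, h a b := by
  have h1 : ∀ a b, h a b = (if a < b then h a b else 1) * (if a = b then h a b else 1) *
      (if b < a then h a b else 1) := by
    intro a b
    rcases lt_trichotomy a b with hab | rfl | hab
    · simp [hab, hab.ne, hab.not_gt]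
    · simp
    · simp [hab, hab.ne', hab.not_gt]
  have h2 : ∏ a, ∏ b, h a b = ∏ a, ∏ b, (if a < b then h a b else 1) *
      (if a = b then h a b else 1) * (if b < a then h a b else 1) :=
    Finset.prod_congr rfl fun a _ => Finset.prod_congr rfl fun b _ => h1 a b
  rw [h2, pairProd_mul]
  simp only [Finset.prod_mul_distrib, Finset.prod_ite_eq, Finset.mem_univ, if_true]
  rw [Finset.prod_comm (f := fun a b => if b < a then h a b else 1)]
  simp only [pairProd]
  ac_rfl

namespace Tr

variable {m : ℕ∞} {n n' n'' : ℕ}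

theorem deg_map {α β : Type} (f : α → β) (T : Tr m α) : (T.map f).deg = T.deg := by
  induction T with
  | leaf a => rfl
  | node j c ih => rw [map, deg, deg, Finset.sum_congr rfl fun i _ => ih i]

theorem fill_map {α β : Type} {ι : Type*} (f : α → β) (w : β → ι) (T : Tr m α) :
    (T.map f).fill w = T.fill fun a => w (f a) := by
  induction T with
  | leaf a => rfl
  | node j c ih => rw [map, fill, fill, funext ih]

theorem sum_occ_map (f : Fin n → Fin n') (T : Tr m (Fin n)) (g : Fin n' → ℤ) :
    ∑ x, ((T.map f).occ x : ℤ) * g x = ∑ x, (T.occ x : ℤ) * g (f x) := by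
  induction T with
  | leaf a => simp [map, occ]
  | node j c ih =>
    simp only [map, occ, Nat.cast_sum, Finset.sum_mul]
    rw [Finset.sum_comm, Finset.sum_congr rfl fun i _ => ih i, Finset.sum_comm]

theorem labelDeg_map (d : Fin n' → ℤ) (f : Fin n → Fin n') (T : Tr m (Fin n)) :
    labelDeg d (T.map f) = labelDeg (fun a => d (f a)) T := sum_occ_map f T d

/-- A bilinear form on combinations of labels. -/
def pairing (h : Fin n → Fin n' → ℤ) (A : Tr m (Fin n)) (B : Tr m (Fin n')) : ℤ :=
  ∑ x, (A.occ x : ℤ) * ∑ y, (B.occ y : ℤ) * h x y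

theorem crossing_eq_pairing (d : Fin n → ℤ) (A B : Tr m (Fin n)) :
    crossing d A B = pairing (fun x y => if y < x then d x * d y else 0) A B := by
  rw [crossing, pairing]
  refine Finset.sum_congr rfl fun x _ => ?_
  rw [Finset.mul_sum]
  refine Finset.sum_congr rfl fun y _ => ?_
  split_ifs <;> ring

theorem pairing_map (h : Fin n'' → Fin n'' → ℤ) (f : Fin n → Fin n'') (f' : Fin n' → Fin n'')
    (A : Tr m (Fin n)) (B : Tr m (Fin n')) :
    pairing h (A.map f) (B.map f') = pairing (fun x y => h (f x) (f' y)) A B := by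
  rw [pairing, sum_occ_map f A fun x => ∑ y, ((B.map f').occ y : ℤ) * h x y]
  exact Finset.sum_congr rfl fun x _ => by rw [sum_occ_map]

theorem pairing_swap (h : Fin n → Fin n → ℤ) (A B : Tr m (Fin n)) :
    pairing h A B = pairing (fun x y => h y x) B A := by
  simp only [pairing, Finset.mul_sum]
  rw [Finset.sum_comm]
  refine Finset.sum_congr rfl fun x _ => Finset.sum_congr rfl fun y _ => by ring

theorem pairing_add (h h' : Fin n → Fin n → ℤ) (A B : Tr m (Fin n)) :
    pairing (fun x y => h x y + h' x y) A B = pairing h A B + pairing h' A B := by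
  simp only [pairing, Finset.mul_sum, mul_add, Finset.sum_add_distrib]

theorem pairing_node (h : Fin n → Fin n → ℤ) (j : Arity m) (c : Fin j.1 → Tr m (Fin n))
    (B : Tr m (Fin n)) : pairing h (node j c) B = ∑ i, pairing h (c i) B := by
  simp only [pairing, occ, Nat.cast_sum, Finset.sum_mul]
  rw [Finset.sum_comm]

/-- The exponent of the Koszul sign of the relabelling `f`. -/
def invForm (f : Fin n → Fin n') (d : Fin n' → ℤ) (A B : Tr m (Fin n)) : ℤ :=
  pairing (fun x y => if x < y ∧ f y < f x then d (f x) * d (f y) else 0) A B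

theorem invForm_node (f : Fin n → Fin n') (d : Fin n' → ℤ) (j : Arity m)
    (c : Fin j.1 → Tr m (Fin n)) :
    invForm f d (node j c) (node j c) = ∑ i, ∑ i', invForm f d (c i) (c i') := by
  rw [invForm, pairing_node]
  refine Finset.sum_congr rfl fun i _ => ?_
  rw [pairing_swap, pairing_node]
  exact Finset.sum_congr rfl fun i' _ => pairing_swap _ _ _

/-- Relabelling changes the number of crossings exactly at the pairs of labels that `f` inverts. -/
theorem swapSign_map {f : Fin n → Fin n'} (hf : Function.Injective f) (d : Fin n' → ℤ)
    (A B : Tr m (Fin n)) : swapSign d (A.map f) (B.map f) =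
      swapSign (fun a => d (f a)) A B * ((invForm f d A B).negOnePow *
        (invForm f d B A).negOnePow) := by
  rw [swapSign, swapSign, ← Int.negOnePow_add, ← Int.negOnePow_add, labelDeg_map, deg_map,
    crossing_eq_pairing, crossing_eq_pairing, pairing_map]
  have h1 : pairing (fun x y => if f y < f x then d (f x) * d (f y) else 0) A B +
      invForm f d B A = pairing (fun x y => if y < x then d (f x) * d (f y) else 0) A B +
      invForm f d A B := by
    rw [invForm, invForm, pairing_swap _ B A, ← pairing_add, ← pairing_add]
    congr 1
    funext x y
    rcases lt_trichotomy x y with h | rfl | h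
    · rcases lt_or_gt_of_ne (hf.ne h.ne) with h' | h' <;> simp [h, h', h.not_gt, h'.not_gt]
    · simp
    · rcases lt_or_gt_of_ne (hf.ne h.ne') with h' | h' <;>
        simp [h, h', h.not_gt, h'.not_gt, mul_comm]
  refine negOnePow_congr ⟨- invForm f d B A, ?_⟩
  linear_combination h1

/-- The quadratic form `invForm f d T T` splits over the pairs of inputs of the root: diagonal terms
come from the subtrees, off-diagonal ones from their exchange signs. -/
theorem sgn_map {f : Fin n → Fin n'} (hf : Function.Injective f) (d : Fin n' → ℤ)
    (T : Tr m (Fin n)) :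
    sgn d (T.map f) = sgn (fun a => d (f a)) T * (invForm f d T T).negOnePow := by
  induction T with
  | leaf a =>
    have : invForm f d (leaf a : Tr m (Fin n)) (leaf a) = 0 := by
      simp only [invForm, pairing, occ]
      refine Finset.sum_eq_zero fun x _ => ?_
      rw [Finset.mul_sum]
      refine Finset.sum_eq_zero fun y _ => ?_
      by_cases hx : a = x
      · by_cases hy : a = y
        · simp [← hx, ← hy]
        · simp [hy]
      · simp [hx]
    rw [this, map, sgn, sgn, Int.negOnePow_zero, mul_one]
  | node j c ih =>
    rw [map, sgn, sgn, Finset.prod_congr rfl fun i _ => ih i, invForm_node,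
      pairProd_congr fun a b _ => swapSign_map hf d (c a) (c b), pairProd_mul,
      Finset.prod_mul_distrib, mul_mul_mul_comm,
      prod_diag_mul_pairProd fun a b => (invForm f d (c a) (c b)).negOnePow, ← prod_negOnePow]
    simp only [← prod_negOnePow]

theorem sgn_map_of_strictMono {f : Fin n → Fin n'} (hf : StrictMono f) (d : Fin n' → ℤ)
    (T : Tr m (Fin n)) : sgn d (T.map f) = sgn (fun a => d (f a)) T := by
  rw [sgn_map hf.injective]
  have : invForm f d T T = 0 := by
    rw [invForm, pairing]
    refine Finset.sum_eq_zero fun x _ => ?_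
    rw [Finset.sum_eq_zero, mul_zero]
    intro y _
    rw [if_neg, mul_zero]
    exact fun h => (h.2.trans (hf h.1)).false
  rw [this, Int.negOnePow_zero, mul_one]

theorem sgn_map_perm (σ : Equiv.Perm (Fin n)) (d : Fin n → ℤ) {T : Tr m (Fin n)}
    (hT : ∀ a, T.occ a = 1) :
    sgn d (T.map σ) = sgn (fun a => d (σ a)) T * koszulSign σ d := by
  rw [sgn_map σ.injective, invForm, pairing, koszulSign]
  congr 1
  simp only [hT, Nat.cast_one, one_mul]
  rw [← prod_negOnePow]
  refine Finset.prod_congr rfl fun a _ => ?_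
  rw [← prod_negOnePow]
  refine Finset.prod_congr rfl fun b _ => ?_
  split_ifs <;> simp

end Tr

variable {m : ℕ∞}

theorem finSigmaFinEquiv_strictMono {j : ℕ} (n : Fin j → ℕ) (i : Fin j) :
    StrictMono fun a : Fin (n i) => finSigmaFinEquiv (⟨i, a⟩ : Σ i, Fin (n i)) := by
  intro a b hab
  rw [Fin.lt_def, finSigmaFinEquiv_apply, finSigmaFinEquiv_apply]
  exact Nat.add_lt_add_left hab _

theorem finSigmaFinEquiv_lt {j : ℕ} (n : Fin j → ℕ) {i i' : Fin j} (h : i < i') (a : Fin (n i))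
    (b : Fin (n i')) :
    finSigmaFinEquiv (⟨i, a⟩ : Σ i, Fin (n i)) < finSigmaFinEquiv (⟨i', b⟩ : Σ i, Fin (n i)) := by
  rw [Fin.lt_def, finSigmaFinEquiv_apply, finSigmaFinEquiv_apply]
  have key : ∀ i : Fin j, ∑ l : Fin (i : ℕ), n (Fin.castLE i.2.le l) =
      ∑ l ∈ Finset.range i, if h : l < j then n ⟨l, h⟩ else 0 := by
    intro i
    rw [Finset.sum_range]
    refine Finset.sum_congr rfl fun l _ => ?_
    rw [dif_pos (l.2.trans i.2)]
    rfl
  rw [key, key]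
  have h1 := Finset.sum_le_sum_of_subset (f := fun l => if h : l < j then n ⟨l, h⟩ else 0)
    (Finset.range_mono (Nat.succ_le_of_lt (Fin.lt_def.1 h)))
  rw [Finset.sum_range_succ, dif_pos i.2] at h1
  have h2 : (a : ℕ) < n ⟨i, i.2⟩ := a.2
  exact (Nat.add_lt_add_left h2 _).trans_le (h1.trans (Nat.le_add_right _ _))

/-- The sign of a grafted tree. -/
theorem LTree.sgn_graft (j : Arity m) (n : Fin j.1 → ℕ) (T : (i : Fin j.1) → LTree m (n i))
    (d : Fin (∑ i, n i) → ℤ) :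
    Tr.sgn d (LTree.graft j n T).1 =
      shuffleSign (fun i => (T i).1.deg) (fun i => ∑ a, d (finSigmaFinEquiv ⟨i, a⟩)) *
        ∏ i, Tr.sgn (fun a => d (finSigmaFinEquiv ⟨i, a⟩)) (T i).1 := by
  rw [LTree.graft, Tr.sgn, mul_comm, Finset.prod_congr rfl fun i _ =>
    Tr.sgn_map_of_strictMono (finSigmaFinEquiv_strictMono n i) d (T i).1]
  congr 1
  refine pairProd_congr fun a b hab => ?_
  -- The blocks of labels are in increasing order, so different subtrees have no crossings; only the
  -- leaves of `T a` passing the vertices of `T b` contribute.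
  rw [Tr.swapSign, Tr.crossing_eq_pairing, Tr.pairing_map, Tr.deg_map, Tr.labelDeg_map,
    Tr.pairing]
  simp only [(finSigmaFinEquiv_lt n hab _ _).not_gt, if_false, mul_zero, Finset.sum_const_zero,
    zero_add, Tr.labelDeg, (T a).2, Nat.cast_one, one_mul]

/-! ### The free algebra in terms of coloured trees -/

section ColouredTrees

variable (k : Type*) [Field k] (m : ℕ∞) {ι : Type*} (δ : ι → ℤ)

/-- The combinations of coloured trees modulo all relations. -/
abbrev ColAlg : Type _ :=
  GenAlg k (PTree.node : (j : Arity m) → (Fin j.1 → PTree m ι) → PTree m ι) (PTree.deg δ)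

/-- The operations on coloured trees. -/
abbrev ColAlg.op (j : Arity m) :
    MultilinearMap k (fun _ : Fin j.1 => ColAlg k m δ) (ColAlg k m δ) :=
  GenAlg.op k PTree.node (PTree.deg δ) j

/-- The grading by the degree of coloured trees. -/
abbrev ColAlg.grading : ℤ → Submodule k (ColAlg k m δ) :=
  GenAlg.grading k PTree.node (PTree.deg δ)

/-- The class of a coloured tree. -/
abbrev ColAlg.of (S : PTree m ι) : ColAlg k m δ := GenAlg.of k PTree.node (PTree.deg δ) S

theorem ColAlg.isLAlgebra [CharZero k] :
    IsLAlgebra m (ColAlg.grading k m δ) (ColAlg.op k m δ) :=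
  GenAlg.isLAlgebra fun _ _ => by rw [PTree.deg]

variable {k m δ} {A : Type*} [AddCommGroup A] [Module k A] {𝒜 : ℤ → Submodule k A}
  {lA : (j : Arity m) → MultilinearMap k (fun _ : Fin j.1 => A) A}

/-- The value of a coloured tree in an algebra. -/
def PTree.eval (lA : (j : Arity m) → MultilinearMap k (fun _ : Fin j.1 => A) A) (φ : ι → A) :
    PTree m ι → A
  | leaf i => φ i
  | node j c => lA j fun a => eval lA φ (c a)

theorem PTree.eval_mem (hA : LAxioms m 𝒜 lA) {φ : ι → A} (hφ : ∀ i, φ i ∈ 𝒜 (δ i))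
    (S : PTree m ι) : S.eval lA φ ∈ 𝒜 (S.deg δ) := by
  induction S with
  | leaf i => exact hφ i
  | node j c ih =>
    rw [PTree.eval, PTree.deg]
    exact hA.degree j _ _ ih

/-- The algebra of coloured trees has the universal property of a free algebra. -/
theorem ColAlg.existsUnique_hom (hA : LAxioms m 𝒜 lA) {φ : ι → A} (hφ : ∀ i, φ i ∈ 𝒜 (δ i)) :
    ∃! Φ : ColAlg k m δ →ₗ[k] A,
      IsStrictHom (ColAlg.grading k m δ) (ColAlg.op k m δ) 𝒜 lA Φ ∧
        ∀ i, Φ (ColAlg.of k m δ (.leaf i)) = φ i := by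
  let Φ : ColAlg k m δ →ₗ[k] A := (relations k PTree.node (PTree.deg δ)).liftQ
    (Finsupp.linearCombination k (PTree.eval lA φ)) (Submodule.span_le.2 fun r hr =>
      GRel.linearCombination_eq_zero hA (fun j T => by rw [PTree.eval])
        (PTree.eval_mem hA hφ) hr)
  have hΦ : ∀ S, Φ (ColAlg.of k m δ S) = S.eval lA φ := by
    intro S
    change Finsupp.linearCombination k (PTree.eval lA φ) (Finsupp.single S 1) = _
    rw [Finsupp.linearCombination_single, one_smul]
  refine ⟨Φ, ⟨⟨?_, ?_⟩, fun i => (hΦ _).trans (by rw [PTree.eval])⟩, ?_⟩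
  · intro d x hx
    have : ColAlg.grading k m δ d ≤ (𝒜 d).comap Φ := by
      rw [ColAlg.grading, GenAlg.grading, Submodule.span_le]
      rintro _ ⟨S, hS, rfl⟩
      rw [SetLike.mem_coe, Submodule.mem_comap, hΦ, ← hS]
      exact PTree.eval_mem hA hφ S
    exact this hx
  · intro j x
    refine multilinear_eq_of_span (F := Φ.compMultilinearMap (ColAlg.op k m δ j))
      (G := (lA j).compLinearMap fun _ => Φ) (fun _ => Set.range (ColAlg.of k m δ))
      (fun x hx => ?_) x fun i => by rw [GenAlg.span_range_of]; trivial
    choose S hS using hx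
    rw [← funext hS]
    simp only [LinearMap.compMultilinearMap_apply, MultilinearMap.compLinearMap_apply, hΦ]
    rw [GenAlg.op_of, hΦ, PTree.eval]
  · rintro Ψ ⟨hΨ, hΨ'⟩
    have key : ∀ S, Ψ (ColAlg.of k m δ S) = S.eval lA φ := by
      intro S
      induction S with
      | leaf i => rw [hΨ', PTree.eval]
      | node j c ih =>
        rw [PTree.eval, ← funext ih, ← hΨ.map_op, GenAlg.op_of]
    refine LinearMap.ext_on_range GenAlg.span_range_of fun S => ?_
    exact (key S).trans (hΦ S).symm

end ColouredTrees

/-! ### Transport of structure along a linear isomorphism -/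

section Transport

variable {k : Type*} [Field k] {m : ℕ∞} {V W : Type*} [AddCommGroup V] [Module k V]
  [AddCommGroup W] [Module k W] {𝒱 : ℤ → Submodule k V} {𝒲 : ℤ → Submodule k W}
  {l : (j : Arity m) → MultilinearMap k (fun _ : Fin j.1 => V) V}
  {l' : (j : Arity m) → MultilinearMap k (fun _ : Fin j.1 => W) W}

theorem isInternal_comap (E : V ≃ₗ[k] W) (h𝒱 : ∀ d x, x ∈ 𝒱 d ↔ E x ∈ 𝒲 d)
    (h : DirectSum.IsInternal 𝒲) : DirectSum.IsInternal 𝒱 := by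
  rw [DirectSum.isInternal_submodule_iff_iSupIndep_and_iSup_eq_top] at h ⊢
  have h1 : 𝒱 = (Submodule.orderIsoMapComap E).symm ∘ 𝒲 := by
    funext d
    ext x
    exact h𝒱 d x
  rw [h1]
  refine ⟨h.1.map_orderIso _, ?_⟩
  have := (Submodule.orderIsoMapComap E).symm.map_iSup 𝒲
  rw [h.2, OrderIso.map_top] at this
  exact this.symm

theorem IsLAlgebra.of_equiv (E : V ≃ₗ[k] W) (h𝒱 : ∀ d x, x ∈ 𝒱 d ↔ E x ∈ 𝒲 d)
    (hl : ∀ j x, E (l j x) = l' j fun a => E (x a)) (h : IsLAlgebra m 𝒲 l') :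
    IsLAlgebra m 𝒱 l where
  isInternal := isInternal_comap E h𝒱 h.isInternal
  degree j x d hx := by
    rw [h𝒱, hl]
    exact h.degree j _ d fun a => (h𝒱 _ _).1 (hx a)
  antisymm j x d hx σ := by
    apply E.injective
    rw [hl, h.antisymm j (fun a => E (x a)) d (fun a => (h𝒱 _ _).1 (hx a)) σ, ← hl]
    exact (map_unit_smul E.toLinearMap _ _).symm
  jacobi n x d hx := by
    apply E.injective
    rw [map_zero, ← h.jacobi n (fun a => E (x a)) d fun a => (h𝒱 _ _).1 (hx a), map_sum]
    refine Finset.sum_congr rfl fun p _ => ?_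
    rw [map_sum]
    refine Finset.sum_congr rfl fun σ _ => ?_
    rw [← nest_map E (fun j y => l j y) (fun j y => l' j y) n p (fun a => x (σ a)) hl]
    exact map_unit_smul E.toLinearMap _ _

end Transport

/-! ### Elements of the free algebra -/

section Elements

variable {k : Type*} [Field k] {m : ℕ∞} {Y : Type*} [AddCommGroup Y] [Module k Y]
  {𝒴 : ℤ → Submodule k Y}

variable (𝒴) in
/-- The element `elt m 𝒴 n f y` as a linear function of `f`. -/
def eltLinear (n : ℕ+) (y : Fin n → Y) : LOperad k m n →ₗ[k] FreeL m 𝒴 :=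
  (DirectSum.lof k ℕ+ (fun n : ℕ+ => FreePart m 𝒴 n) n) ∘ₗ FreePart.mk m 𝒴 n ∘ₗ
    (TensorProduct.mk k (LOperad k m n) (⨂[k] _ : Fin n, Y)).flip (PiTensorProduct.tprod k y)

theorem eltLinear_apply (n : ℕ+) (y : Fin n → Y) (f : LOperad k m n) :
    eltLinear 𝒴 n y f = elt m 𝒴 n f y := rfl

variable (𝒴) in
/-- The element `elt m 𝒴 n f y` as a multilinear function of `y`. -/
def eltMultilinear (n : ℕ+) (f : LOperad k m n) :
    MultilinearMap k (fun _ : Fin n => Y) (FreeL m 𝒴) :=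
  ((DirectSum.lof k ℕ+ (fun n : ℕ+ => FreePart m 𝒴 n) n) ∘ₗ FreePart.mk m 𝒴 n ∘ₗ
    TensorProduct.mk k (LOperad k m n) (⨂[k] _ : Fin n, Y) f).compMultilinearMap
      (PiTensorProduct.tprod k)

theorem eltMultilinear_apply (n : ℕ+) (f : LOperad k m n) (y : Fin n → Y) :
    eltMultilinear 𝒴 n f y = elt m 𝒴 n f y := rfl

theorem elt_relabel (n : ℕ+) (T : LTree m n) (σ : Equiv.Perm (Fin n)) {y : Fin n → Y}
    {d : Fin n → ℤ} (hy : ∀ a, y a ∈ 𝒴 (d a)) : elt m 𝒴 n (treeClass k (T.relabel σ)) y =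
      koszulSign σ d • elt m 𝒴 n (treeClass k T) fun a => y (σ a) := by
  rw [elt, elt, ← map_unit_smul, ← map_unit_smul]
  congr 1
  rw [← sub_eq_zero, ← map_sub]
  exact (Submodule.Quotient.mk_eq_zero _).2 (Submodule.subset_span ⟨T, y, d, σ, hy, rfl⟩)

variable {ι : Type*} (b : Module.Basis ι k Y)

/-- The projection modulo the span is zero, since a linear map on the free algebra is determined by
its values on generators of the operad tensored with words in the basis. -/
theorem span_elt {S : (n : ℕ+) → Set (LOperad k m n)} (hS : ∀ n, Submodule.span k (S n) = ⊤) :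
    Submodule.span k {z : FreeL m 𝒴 | ∃ (n : ℕ+) (f : LOperad k m n) (w : Fin n → ι),
      f ∈ S n ∧ z = elt m 𝒴 n f fun a => b (w a)} = ⊤ := by
  set N := Submodule.span k {z : FreeL m 𝒴 | ∃ (n : ℕ+) (f : LOperad k m n) (w : Fin n → ι),
      f ∈ S n ∧ z = elt m 𝒴 n f fun a => b (w a)} with hN
  have h0 : N.mkQ = 0 := by
    refine DirectSum.linearMap_ext k fun n => ?_
    refine Submodule.linearMap_qext (coinvRel m 𝒴 n) (TensorProduct.ext ?_)
    refine LinearMap.ext_on (hS n) fun f hf => ?_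
    refine (Basis.piTensorProduct fun _ : Fin n => b).ext fun w => ?_
    rw [Basis.piTensorProduct_apply]
    change N.mkQ (elt m 𝒴 n f fun a => b (w a)) = 0
    rw [Submodule.mkQ_apply, Submodule.Quotient.mk_eq_zero]
    exact Submodule.subset_span ⟨n, f, w, hf, rfl⟩
  rw [← N.ker_mkQ, h0, LinearMap.ker_zero]

variable (δ : ι → ℤ)

variable (k m) in
/-- Colouring of labelled trees as a bilinear map. -/
def fillTensor (n : ℕ) :
    (LTree m n →₀ k) →ₗ[k] (⨂[k] _ : Fin n, Y) →ₗ[k] ColAlg k m δ :=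
  Finsupp.linearCombination k fun T => (Basis.piTensorProduct fun _ : Fin n => b).constr k
    fun w => T.1.sgn (fun a => δ (w a)) • ColAlg.of k m δ (T.1.fill w)

theorem fillTensor_basis (n : ℕ) (r : LTree m n →₀ k) (w : Fin n → ι) :
    fillTensor k m b δ n r (PiTensorProduct.tprod k fun a => b (w a)) =
      (relations k PTree.node (PTree.deg δ)).mkQ
        (Tr.fillMap k δ w (Finsupp.mapDomain Subtype.val r)) := by
  induction r using Finsupp.induction_linear with
  | zero => simp
  | add r s hr hs =>
    rw [map_add, LinearMap.add_apply, hr, hs, Finsupp.mapDomain_add, map_add, map_add]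
  | single T c =>
    rw [Finsupp.mapDomain_single, fillTensor, Tr.fillMap, Finsupp.linearCombination_single,
      Finsupp.linearCombination_single, map_smul, map_unit_smul, LinearMap.smul_apply]
    congr 1
    rw [← Basis.piTensorProduct_apply, Module.Basis.constr_basis]
    rfl

theorem fillTensor_single (n : ℕ) (T : LTree m n) (w : Fin n → ι) :
    fillTensor k m b δ n (Finsupp.single T 1) (PiTensorProduct.tprod k fun a => b (w a)) =
      T.1.sgn (fun a => δ (w a)) • ColAlg.of k m δ (T.1.fill w) := by
  rw [fillTensor_basis, Finsupp.mapDomain_single, Tr.fillMap_single, map_unit_smul]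
  rfl

theorem fillTensor_eq_zero (n : ℕ) {r : LTree m n →₀ k}
    (hr : GRel k Tr.node Tr.deg (Finsupp.mapDomain Subtype.val r)) :
    fillTensor k m b δ n r = 0 := by
  classical
  refine (Basis.piTensorProduct fun _ : Fin n => b).ext fun w => ?_
  rw [Basis.piTensorProduct_apply, fillTensor_basis, LinearMap.zero_apply, Submodule.mkQ_apply,
    Submodule.Quotient.mk_eq_zero]
  refine Tr.fillMap_mem_relations δ w hr fun V hV a => ?_
  obtain ⟨T, _, rfl⟩ := Finset.mem_image.1 (Finsupp.mapDomain_support hV)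
  exact (T.2 a).le

/-- Colouring of elements of the operad. -/
def fillOperad (n : ℕ) : LOperad k m n →ₗ[k] (⨂[k] _ : Fin n, Y) →ₗ[k] ColAlg k m δ :=
  LOperad.lift (fillTensor k m b δ n) fun _ hr => fillTensor_eq_zero b δ n hr

theorem fillOperad_treeClass (n : ℕ) (T : LTree m n) (w : Fin n → ι) :
    fillOperad b δ n (treeClass k T) (PiTensorProduct.tprod k fun a => b (w a)) =
      T.1.sgn (fun a => δ (w a)) • ColAlg.of k m δ (T.1.fill w) := by
  rw [fillOperad, LOperad.lift_treeClass, fillTensor_single]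

theorem basis_mem (hb : ∀ d, 𝒴 d = Submodule.span k (b '' {i | δ i = d})) (i : ι) :
    b i ∈ 𝒴 (δ i) := by
  rw [hb]
  exact Submodule.subset_span ⟨i, rfl, rfl⟩

/-- Compatibility with the symmetric groups. Both sides are multilinear in `y`, and on basis vectors
the claim is `Tr.sgn_map_perm`. -/
theorem fillOperad_relabel (hb : ∀ d, 𝒴 d = Submodule.span k (b '' {i | δ i = d})) (n : ℕ)
    (T : LTree m n) (σ : Equiv.Perm (Fin n)) {y : Fin n → Y} {d : Fin n → ℤ}
    (hy : ∀ a, y a ∈ 𝒴 (d a)) :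
    fillOperad b δ n (treeClass k (T.relabel σ)) (PiTensorProduct.tprod k y) =
      koszulSign σ d • fillOperad b δ n (treeClass k T)
        (PiTensorProduct.tprod k fun a => y (σ a)) := by
  have h1 := multilinear_eq_of_span
    (F := (fillOperad b δ n (treeClass k (T.relabel σ))).compMultilinearMap
      (PiTensorProduct.tprod k))
    (G := (((koszulSign σ d : ℤˣ) : ℤ) : k) • ((fillOperad b δ n
      (treeClass k T)).compMultilinearMap (PiTensorProduct.tprod k)).domDomCongr σ)
    (fun a => b '' {i | δ i = d a}) (fun y hy => ?_) y fun a => by rw [← hb]; exact hy a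
  · rw [smul_apply, ← unit_smul_eq_intCast_smul] at h1
    exact h1
  · choose w hw hw' using hy
    obtain rfl : d = fun a => δ (w a) := funext fun a => (hw a).symm
    rw [← funext hw', smul_apply, ← unit_smul_eq_intCast_smul]
    change fillOperad b δ n (treeClass k (T.relabel σ)) (PiTensorProduct.tprod k fun a => b (w a)) =
      koszulSign σ (fun a => δ (w a)) • fillOperad b δ n (treeClass k T)
        (PiTensorProduct.tprod k fun a => b (w (σ a)))
    rw [fillOperad_treeClass, fillOperad_treeClass b δ n T fun a => w (σ a), LTree.relabel,
      Tr.sgn_map_perm σ _ T.2, Tr.fill_map, smul_smul, mul_comm]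

/-- A linear map that is compatible with relabelling descends to coinvariants. -/
def FreePart.lift {A : Type*} [AddCommGroup A] [Module k A] {n : ℕ}
    (F : LOperad k m n ⊗[k] (⨂[k] _ : Fin n, Y) →ₗ[k] A) (h : coinvRel m 𝒴 n ≤ LinearMap.ker F) :
    FreePart m 𝒴 n →ₗ[k] A :=
  (coinvRel m 𝒴 n).liftQ F h

variable (m) in
/-- Colouring of the elements of the free algebra. -/
def toColAlg (hb : ∀ d, 𝒴 d = Submodule.span k (b '' {i | δ i = d})) :
    FreeL m 𝒴 →ₗ[k] ColAlg k m δ :=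
  DirectSum.toModule k ℕ+ _ fun n => FreePart.lift
    (TensorProduct.lift (fillOperad b δ n)) (by
      rw [coinvRel, Submodule.span_le]
      rintro _ ⟨T, y, d, σ, hy, rfl⟩
      rw [SetLike.mem_coe, LinearMap.mem_ker, map_sub, map_unit_smul, TensorProduct.lift.tmul,
        TensorProduct.lift.tmul, fillOperad_relabel b δ hb n T σ hy, sub_self])

theorem toColAlg_elt (hb : ∀ d, 𝒴 d = Submodule.span k (b '' {i | δ i = d})) (n : ℕ+)
    (f : LOperad k m n) (y : Fin n → Y) :
    toColAlg m b δ hb (elt m 𝒴 n f y) = fillOperad b δ n f (PiTensorProduct.tprod k y) := by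
  rw [toColAlg, elt, DirectSum.toModule_lof]
  exact TensorProduct.lift.tmul _ _

theorem toColAlg_elt_basis (hb : ∀ d, 𝒴 d = Submodule.span k (b '' {i | δ i = d})) (n : ℕ+)
    (T : LTree m n) (w : Fin n → ι) :
    toColAlg m b δ hb (elt m 𝒴 n (treeClass k T) fun a => b (w a)) =
      T.1.sgn (fun a => δ (w a)) • ColAlg.of k m δ (T.1.fill w) := by
  rw [toColAlg_elt, fillOperad_treeClass]

end Elements

/-! ### Planar labellings of coloured trees -/

section Labelling

variable {m : ℕ∞} {ι : Type*}

/-- The labelled tree obtained by labelling the leaves of a coloured tree from left to right, and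
the word of colours. -/
def PTree.labelling : PTree m ι → Σ n : ℕ+, LTree m n × (Fin n → ι)
  | leaf i => ⟨1, LTree.unit m, fun _ => i⟩
  | node j c => ⟨sumPos j fun i => (labelling (c i)).1,
      LTree.graft j (fun i => ((labelling (c i)).1 : ℕ)) fun i => (labelling (c i)).2.1,
      concat j (fun i => (labelling (c i)).1) fun i => (labelling (c i)).2.2⟩

theorem concat_apply {X : Type*} (j : Arity m) (n : Fin j.1 → ℕ+)
    (x : (i : Fin j.1) → Fin (n i) → X) (i : Fin j.1) (a : Fin (n i)) :
    concat j n x (finSigmaFinEquiv (n := fun i => (n i : ℕ)) ⟨i, a⟩) = x i a := by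
  have : ∀ p q : Σ i, Fin (n i : ℕ), p = q → x p.1 p.2 = x q.1 q.2 := by
    rintro p _ rfl; rfl
  exact this _ _ (finSigmaFinEquiv.symm_apply_apply _)

theorem LTree.fill_graft (j : Arity m) (n : Fin j.1 → ℕ+) (T : (i : Fin j.1) → LTree m (n i))
    (w : (i : Fin j.1) → Fin (n i) → ι) :
    (LTree.graft j (fun i => (n i : ℕ)) T).1.fill (concat j n w) =
      PTree.node j fun i => (T i).1.fill (w i) := by
  change PTree.node j (fun i => Tr.fill _ (Tr.map _ (T i).1)) = _
  congr 1
  funext i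
  refine (Tr.fill_map (β := Fin (sumPos j n)) _ _ _).trans ?_
  congr 1
  funext a
  exact concat_apply j n w i a

theorem PTree.fill_labelling (S : PTree m ι) : S.labelling.2.1.1.fill S.labelling.2.2 = S := by
  induction S with
  | leaf i => rfl
  | node j c ih =>
    rw [PTree.labelling]
    exact (LTree.fill_graft j _ _ _).trans (by rw [funext ih])

theorem Tr.map_map {α β γ : Type} (f : α → β) (g : β → γ) (T : Tr m α) :
    (T.map f).map g = T.map fun a => g (f a) := by
  induction T with
  | leaf a => rfl
  | node j c ih => rw [map, map, map, funext ih]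

/-- Every labelling is a relabelling of the planar one. -/
theorem Tr.exists_map_labelling {α : Type} (T : Tr m α) (w : α → ι) :
    ∃ g : Fin (T.fill w).labelling.1 → α, (T.fill w).labelling.2.1.1.map g = T ∧
      ∀ a, w (g a) = (T.fill w).labelling.2.2 a := by
  induction T with
  | leaf a => exact ⟨fun _ => a, rfl, fun _ => rfl⟩
  | node j c ih =>
    choose g hg hg' using ih
    rw [fill, PTree.labelling]
    refine ⟨concat j _ g, ?_, fun a => hg' _ _⟩
    change Tr.node j (fun i => Tr.map _ (Tr.map _ _)) = Tr.node j c
    congr 1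
    funext i
    refine (Tr.map_map (β := Fin (sumPos j fun i => ((c i).fill w).labelling.1)) _ _ _).trans
      (Eq.trans ?_ (hg i))
    congr 1
    funext a
    exact concat_apply j _ g i a

/-- Every label occurs once in either tree, so counting leaves shows that each fibre of `g` has one
element. -/
theorem Tr.bijective_of_map {n n' : ℕ} {C : LTree m n} {T : LTree m n'} {g : Fin n → Fin n'}
    (h : C.1.map g = T.1) : Function.Bijective g := by
  rw [Function.bijective_iff_existsUnique]
  intro y
  have h1 := Tr.sum_occ_map g C.1 fun x => if x = y then 1 else 0
  simp only [h, C.2, T.2, Nat.cast_one, one_mul, Finset.sum_ite_eq', Finset.mem_univ, if_true] at h1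
  rw [Finset.sum_boole] at h1
  have h2 : (Finset.univ.filter fun x => g x = y).card = 1 := by exact_mod_cast h1.symm
  obtain ⟨x, hx⟩ := Finset.card_eq_one.1 h2
  refine ⟨x, by simpa using (Finset.ext_iff.1 hx x), fun x' hx' => ?_⟩
  simpa [hx'] using (Finset.ext_iff.1 hx x')

end Labelling

/-! ### The isomorphism -/

section Isomorphism

variable {k : Type*} [Field k] {m : ℕ∞} {Y : Type*} [AddCommGroup Y] [Module k Y]
  {𝒴 : ℤ → Submodule k Y} {ι : Type*} (b : Module.Basis ι k Y) (δ : ι → ℤ)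

/-- Relabelling changes `Tr.sgn` and the element of the coinvariants by the same Koszul sign. Hence
the signed element depends only on the coloured tree. -/
theorem sgn_smul_elt_congr (hb : ∀ d, 𝒴 d = Submodule.span k (b '' {i | δ i = d})) {n n' : ℕ+}
    {C : LTree m n} {T : LTree m n'} {g : Fin n → Fin n'} (h : C.1.map g = T.1) {v : Fin n → ι}
    {w : Fin n' → ι} (hw : ∀ a, w (g a) = v a) :
    C.1.sgn (fun a => δ (v a)) • elt m 𝒴 n (treeClass k C) (fun a => b (v a)) =
      T.1.sgn (fun a => δ (w a)) • elt m 𝒴 n' (treeClass k T) fun a => b (w a) := by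
  have hg := Tr.bijective_of_map h
  obtain rfl : n = n' := PNat.eq (by simpa using Fintype.card_of_bijective hg)
  let σ := Equiv.ofBijective g hg
  obtain rfl : T = C.relabel σ := Subtype.ext h.symm
  obtain rfl : (fun a => w (σ a)) = v := funext hw
  rw [elt_relabel n C σ (d := fun a => δ (w a)) fun a => basis_mem b δ hb _, smul_smul,
    LTree.relabel, Tr.sgn_map_perm σ _ C.2, mul_assoc, Int.units_mul_self, mul_one]

variable (k 𝒴) in
/-- The element of the free algebra represented by a coloured tree. -/
def ofPTree (S : PTree m ι) : FreeL m 𝒴 :=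
  S.labelling.2.1.1.sgn (fun a => δ (S.labelling.2.2 a)) •
    elt m 𝒴 S.labelling.1 (treeClass k S.labelling.2.1) fun a => b (S.labelling.2.2 a)

theorem ofPTree_fill (hb : ∀ d, 𝒴 d = Submodule.span k (b '' {i | δ i = d})) {n : ℕ+}
    (T : LTree m n) (w : Fin n → ι) : ofPTree k 𝒴 b δ (T.1.fill w) =
      T.1.sgn (fun a => δ (w a)) • elt m 𝒴 n (treeClass k T) fun a => b (w a) := by
  obtain ⟨g, hg, hw⟩ := T.1.exists_map_labelling w
  exact sgn_smul_elt_congr b δ hb hg hw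

theorem linearCombination_ofPTree_fillMap
    (hb : ∀ d, 𝒴 d = Submodule.span k (b '' {i | δ i = d})) {n : ℕ+} (w : Fin n → ι)
    {r : Tr m (Fin n) →₀ k} (hr : r ∈ Finsupp.supported k k {V | ∀ a, V.occ a = 1}) :
    Finsupp.linearCombination k (ofPTree k 𝒴 b δ) (Tr.fillMap k δ w r) =
      eltLinear 𝒴 n (fun a => b (w a)) (Finsupp.linearCombination k (operadClass k) r) := by
  rw [Finsupp.supported_eq_span_single] at hr
  induction hr using Submodule.span_induction with
  | mem r hr =>
    obtain ⟨V, hV, rfl⟩ := hr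
    replace hV : ∀ a, V.occ a = 1 := hV
    rw [Tr.fillMap_single, map_unit_smul, Finsupp.linearCombination_single,
      Finsupp.linearCombination_single, one_smul, one_smul, operadClass, dif_pos hV,
      ofPTree_fill b δ hb (⟨V, hV⟩ : LTree m n) w, unit_smul_smul_self, eltLinear_apply]
  | zero => simp only [map_zero]
  | add r s _ _ hr hs => simp only [map_add, hr, hs]
  | smul c r _ hr => simp only [map_smul, hr]

/-- A coloured relation is lifted to a relation between trees with the labels of a planar labelling;
that relation vanishes in the operad. -/
theorem linearCombination_ofPTree (hb : ∀ d, 𝒴 d = Submodule.span k (b '' {i | δ i = d}))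
    {r : PTree m ι →₀ k} (hr : GRel k PTree.node (PTree.deg δ) r) :
    Finsupp.linearCombination k (ofPTree k 𝒴 b δ) r = 0 := by
  obtain ⟨S, hS⟩ := Tr.exists_fillMap_eq δ hr
  obtain ⟨r', u, hr', hsupp, hu⟩ := hS S.labelling.1 S.labelling.2.2 S.labelling.2.1.1
    S.fill_labelling fun a => (S.labelling.2.1.2 a).le
  have h1 := linearCombination_ofPTree_fillMap (𝒴 := 𝒴) b δ hb S.labelling.2.2 (r := r')
    (Finsupp.supported_mono (fun V hV a => (congrFun hV a).trans (S.labelling.2.1.2 a)) hsupp)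
  rw [linearCombination_operadClass hr', map_zero, hu, map_unit_smul] at h1
  rw [← unit_smul_smul_self u (Finsupp.linearCombination k (ofPTree k 𝒴 b δ) r), h1, smul_zero]

variable (m) in
/-- The element of the free algebra represented by a combination of coloured trees. -/
def ofColAlg (hb : ∀ d, 𝒴 d = Submodule.span k (b '' {i | δ i = d})) :
    ColAlg k m δ →ₗ[k] FreeL m 𝒴 :=
  (relations k PTree.node (PTree.deg δ)).liftQ (Finsupp.linearCombination k (ofPTree k 𝒴 b δ))
    (Submodule.span_le.2 fun _ hr => linearCombination_ofPTree b δ hb hr)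

theorem ofColAlg_of (hb : ∀ d, 𝒴 d = Submodule.span k (b '' {i | δ i = d})) (S : PTree m ι) :
    ofColAlg m b δ hb (ColAlg.of k m δ S) = ofPTree k 𝒴 b δ S := by
  change Finsupp.linearCombination k (ofPTree k 𝒴 b δ) (Finsupp.single S 1) = _
  rw [Finsupp.linearCombination_single, one_smul]

theorem toColAlg_ofPTree (hb : ∀ d, 𝒴 d = Submodule.span k (b '' {i | δ i = d}))
    (S : PTree m ι) : toColAlg m b δ hb (ofPTree k 𝒴 b δ S) = ColAlg.of k m δ S := by
  rw [ofPTree, map_unit_smul, toColAlg_elt_basis, unit_smul_smul_self, S.fill_labelling]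

variable (m) in
/-- The free algebra is the algebra of coloured trees. -/
def freeEquiv (hb : ∀ d, 𝒴 d = Submodule.span k (b '' {i | δ i = d})) :
    FreeL m 𝒴 ≃ₗ[k] ColAlg k m δ :=
  LinearEquiv.ofLinearMap (toColAlg m b δ hb) (ofColAlg m b δ hb)
    (by
      refine LinearMap.ext_on_range GenAlg.span_range_of fun S => ?_
      rw [LinearMap.comp_apply]
      exact (congrArg _ (ofColAlg_of b δ hb S)).trans (toColAlg_ofPTree b δ hb S))
    (by
      refine LinearMap.ext_on (span_elt b fun n => span_range_treeClass n) ?_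
      rintro _ ⟨n, _, w, ⟨T, rfl⟩, rfl⟩
      rw [LinearMap.comp_apply, toColAlg_elt_basis, map_unit_smul, ofColAlg_of,
        ofPTree_fill b δ hb, unit_smul_smul_self, LinearMap.id_apply])

theorem freeEquiv_elt_basis (hb : ∀ d, 𝒴 d = Submodule.span k (b '' {i | δ i = d})) (n : ℕ+)
    (T : LTree m n) (w : Fin n → ι) :
    freeEquiv m b δ hb (elt m 𝒴 n (treeClass k T) fun a => b (w a)) =
      T.1.sgn (fun a => δ (w a)) • ColAlg.of k m δ (T.1.fill w) :=
  toColAlg_elt_basis b δ hb n T w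

theorem freeEquiv_ofPTree (hb : ∀ d, 𝒴 d = Submodule.span k (b '' {i | δ i = d}))
    (S : PTree m ι) : freeEquiv m b δ hb (ofPTree k 𝒴 b δ S) = ColAlg.of k m δ S :=
  toColAlg_ofPTree b δ hb S

theorem LTree.sum_eq_labelDeg {n : ℕ} (T : LTree m n) (d : Fin n → ℤ) :
    Tr.labelDeg d T.1 = ∑ a, d a := by
  simp [Tr.labelDeg, T.2]

/-- Both gradings are spanned by trees with homogeneous leaves, and the degree of a coloured tree is
the degree of its vertices plus that of its leaves. -/
theorem mem_freeGrading_iff (hb : ∀ d, 𝒴 d = Submodule.span k (b '' {i | δ i = d})) (e : ℤ)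
    (x : FreeL m 𝒴) : x ∈ freeGrading m 𝒴 e ↔ freeEquiv m b δ hb x ∈ ColAlg.grading k m δ e := by
  constructor
  · intro hx
    have : freeGrading m 𝒴 e ≤
        (ColAlg.grading k m δ e).comap (freeEquiv m b δ hb).toLinearMap := by
      rw [freeGrading, Submodule.span_le]
      rintro _ ⟨n, T, y, d, hy, rfl, rfl⟩
      refine multilinear_mem_of_span (eltMultilinear 𝒴 n (treeClass k T))
        (fun a => b '' {i | δ i = d a}) _ (fun y hy => ?_) y fun a => by rw [← hb]; exact hy a
      choose w hw hw' using hy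
      obtain rfl : d = fun a => δ (w a) := funext fun a => (hw a).symm
      rw [← funext hw', eltMultilinear_apply, Submodule.mem_comap]
      refine (freeEquiv_elt_basis b δ hb n T w).symm ▸ unit_smul_mem _ _ ?_
      have := GenAlg.of_mem_grading (k := k) (nd := PTree.node) (dg := PTree.deg δ) (T.1.fill w)
      rwa [Tr.deg_fill, LTree.sum_eq_labelDeg] at this
    exact this hx
  · intro hx
    have : ColAlg.grading k m δ e ≤
        (freeGrading m 𝒴 e).comap (freeEquiv m b δ hb).symm.toLinearMap := by
      rw [ColAlg.grading, GenAlg.grading, Submodule.span_le]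
      rintro _ ⟨S, hS, rfl⟩
      have h1 : (freeEquiv m b δ hb).symm (ColAlg.of k m δ S) = ofPTree k 𝒴 b δ S := by
        rw [LinearEquiv.symm_apply_eq, freeEquiv_ofPTree]
      change (freeEquiv m b δ hb).symm (ColAlg.of k m δ S) ∈ freeGrading m 𝒴 e
      rw [h1, ofPTree]
      refine unit_smul_mem _ _ (Submodule.subset_span ⟨_, _, _, _,
        fun a => basis_mem b δ hb _, ?_, rfl⟩)
      rw [← LTree.sum_eq_labelDeg, ← Tr.deg_fill, S.fill_labelling]
      exact hS
    simpa using this hx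

variable (m) in
/-- The operations on the free algebra. -/
def freeLOp (hb : ∀ d, 𝒴 d = Submodule.span k (b '' {i | δ i = d})) (j : Arity m) :
    MultilinearMap k (fun _ : Fin j.1 => FreeL m 𝒴) (FreeL m 𝒴) :=
  (freeEquiv m b δ hb).symm.toLinearMap.compMultilinearMap
    ((ColAlg.op k m δ j).compLinearMap fun _ => (freeEquiv m b δ hb).toLinearMap)

theorem freeEquiv_freeLOp (hb : ∀ d, 𝒴 d = Submodule.span k (b '' {i | δ i = d})) (j : Arity m)
    (x : Fin j.1 → FreeL m 𝒴) : freeEquiv m b δ hb (freeLOp m b δ hb j x) =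
      ColAlg.op k m δ j fun a => freeEquiv m b δ hb (x a) :=
  (freeEquiv m b δ hb).apply_symm_apply _

theorem freeLOp_isLAlgebra [CharZero k] (hb : ∀ d, 𝒴 d = Submodule.span k (b '' {i | δ i = d})) :
    IsLAlgebra m (freeGrading m 𝒴) (freeLOp m b δ hb) :=
  IsLAlgebra.of_equiv (freeEquiv m b δ hb) (mem_freeGrading_iff b δ hb)
    (freeEquiv_freeLOp b δ hb) (ColAlg.isLAlgebra k m δ)

/-- The sign of a grafted tree is the shuffle sign times the signs of the pieces. The latter are the
signs by which `freeEquiv` acts on the inputs, so only the shuffle sign remains. -/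
theorem freeLOp_elt_basis (hb : ∀ d, 𝒴 d = Submodule.span k (b '' {i | δ i = d})) (j : Arity m)
    (n : Fin j.1 → ℕ+) (T : (i : Fin j.1) → LTree m (n i)) (w : (i : Fin j.1) → Fin (n i) → ι) :
    freeLOp m b δ hb j (fun i => elt m 𝒴 (n i) (treeClass k (T i)) fun a => b (w i a)) =
      shuffleSign (fun i => (T i).1.deg) (fun i => ∑ a, δ (w i a)) •
        elt m 𝒴 (sumPos j n) (treeClass k (LTree.graft j (fun i => (n i : ℕ)) T))
          (concat j n fun i a => b (w i a)) := by
  apply (freeEquiv m b δ hb).injective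
  have h1 := freeEquiv_elt_basis b δ hb (sumPos j n)
    (LTree.graft j (fun i => (n i : ℕ)) T) (concat j n w)
  have h2 : Tr.sgn (fun a => δ (concat j n w a)) (LTree.graft j (fun i => (n i : ℕ)) T).1 =
      shuffleSign (fun i => (T i).1.deg) (fun i => ∑ a, δ (w i a)) *
        ∏ i, Tr.sgn (fun a => δ (w i a)) (T i).1 := by
    have := LTree.sgn_graft j (fun i => (n i : ℕ)) T fun a => δ (concat j n w a)
    simp only [concat_apply] at this
    exact this
  rw [LTree.fill_graft, h2] at h1
  have h3 : freeEquiv m b δ hb (shuffleSign (fun i => (T i).1.deg) (fun i => ∑ a, δ (w i a)) •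
      elt m 𝒴 (sumPos j n) (treeClass k (LTree.graft j (fun i => (n i : ℕ)) T))
        (concat j n fun i a => b (w i a))) =
      shuffleSign (fun i => (T i).1.deg) (fun i => ∑ a, δ (w i a)) • freeEquiv m b δ hb
        (elt m 𝒴 (sumPos j n) (treeClass k (LTree.graft j (fun i => (n i : ℕ)) T))
          (concat j n fun i a => b (w i a))) := map_unit_smul (freeEquiv m b δ hb).toLinearMap _ _
  rw [freeEquiv_freeLOp, h3]
  refine Eq.trans ?_ (congrArg _ h1.symm)
  simp only [freeEquiv_elt_basis]
  simp_rw [unit_smul_eq_intCast_smul (k := k) (Tr.sgn _ _)]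
  rw [MultilinearMap.map_smul_univ, GenAlg.op_of, smul_smul, ← mul_assoc, Int.units_mul_self,
    one_mul, unit_smul_eq_intCast_smul (k := k) (∏ i, _)]
  congr 1
  rw [Units.coe_prod, Int.cast_prod]

end Isomorphism

/-! ### The free algebra -/

section FreeAlgebra

theorem exists_homogeneous_basis.{u, v} {k : Type u} [Field k] {Y : Type v} [AddCommGroup Y]
    [Module k Y] {𝒴 : ℤ → Submodule k Y} (h𝒴 : DirectSum.IsInternal 𝒴) :
    ∃ (ι : Type v) (b : Module.Basis ι k Y) (δ : ι → ℤ),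
      ∀ d, 𝒴 d = Submodule.span k (b '' {i | δ i = d}) := by
  let v := fun d => Module.Basis.ofVectorSpace k (𝒴 d)
  refine ⟨_, h𝒴.collectedBasis v, Sigma.fst, fun d => ?_⟩
  have h1 : (h𝒴.collectedBasis v) '' {i | i.1 = d} = (𝒴 d).subtype '' Set.range (v d) := by
    ext y
    constructor
    · rintro ⟨⟨_, i⟩, rfl, rfl⟩
      refine ⟨_, ⟨i, rfl⟩, ?_⟩
      rw [h𝒴.collectedBasis_coe]
      rfl
    · rintro ⟨_, ⟨i, rfl⟩, rfl⟩
      refine ⟨⟨d, i⟩, rfl, ?_⟩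
      rw [h𝒴.collectedBasis_coe]
      rfl
  rw [h1, Submodule.span_image, (v d).span_eq, Submodule.map_top, Submodule.range_subtype]

variable {k : Type*} [Field k] {m : ℕ∞} {Y : Type*} [AddCommGroup Y] [Module k Y]
  {𝒴 : ℤ → Submodule k Y}

theorem admissible_span (s : (n : ℕ) → AdmTree m n → {T : LTree m n // T.1.Admissible})
    (hs : ∀ (n : ℕ) (τ : AdmTree m n), (Quotient.mk (admSetoid m n) (s n τ) : AdmTree m n) = τ)
    (n : ℕ) : Submodule.span k (treeClass k '' {T : LTree m n | T.1.Admissible}) = ⊤ := by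
  rw [eq_top_iff, ← span_admissible_eq_top s hs n]
  refine Submodule.span_mono ?_
  rintro _ ⟨τ, rfl⟩
  exact ⟨_, (s n τ).2, rfl⟩

variable {ι : Type*} (b : Module.Basis ι k Y) (δ : ι → ℤ)

/-- With the degrees `d` fixed, the sign is constant and both sides are multilinear in all the
vectors `v i a` together, so basis vectors suffice. -/
theorem freeLOp_elt (hb : ∀ d, 𝒴 d = Submodule.span k (b '' {i | δ i = d})) (j : Arity m)
    (n : Fin j.1 → ℕ+) (T : (i : Fin j.1) → LTree m (n i)) (v : (i : Fin j.1) → Fin (n i) → Y)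
    (d : (i : Fin j.1) → Fin (n i) → ℤ) (hv : ∀ i a, v i a ∈ 𝒴 (d i a)) :
    freeLOp m b δ hb j (fun i => elt m 𝒴 (n i) (treeClass k (T i)) (v i)) =
      shuffleSign (fun i => (T i).1.deg) (fun i => ∑ a, d i a) •
        elt m 𝒴 (sumPos j n) (treeClass k (LTree.graft j (fun i => (n i : ℕ)) T))
          (concat j n v) := by
  let F : MultilinearMap k (fun _ : Σ i, Fin (n i : ℕ) => Y) (FreeL m 𝒴) :=
    (freeLOp m b δ hb j).compMultilinearMap fun i => eltMultilinear 𝒴 (n i) (treeClass k (T i))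
  let u := shuffleSign (fun i => (T i).1.deg) (fun i => ∑ a, d i a)
  let G : MultilinearMap k (fun _ : Σ i, Fin (n i : ℕ) => Y) (FreeL m 𝒴) :=
    ((u : ℤ) : k) • (eltMultilinear 𝒴 (sumPos j n)
      (treeClass k (LTree.graft j (fun i => (n i : ℕ)) T))).domDomCongr
        (finSigmaFinEquiv (n := fun i => (n i : ℕ))).symm
  have hF : ∀ x, F x = freeLOp m b δ hb j fun i =>
      elt m 𝒴 (n i) (treeClass k (T i)) fun a => x ⟨i, a⟩ := fun x => rfl
  have hG : ∀ x, G x = u • elt m 𝒴 (sumPos j n)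
      (treeClass k (LTree.graft j (fun i => (n i : ℕ)) T))
        (concat j n fun i a => x ⟨i, a⟩) := fun x => by
    simp only [G]
    rw [smul_apply, ← unit_smul_eq_intCast_smul]
    rfl
  have key := multilinear_eq_of_span (F := F) (G := G)
    (fun p => b '' {i | δ i = d p.1 p.2}) (fun x hx => ?_) (fun p => v p.1 p.2) fun p => by
      rw [← hb]; exact hv _ _
  · rw [hF, hG] at key
    exact key
  · choose w hw hw' using hx
    rw [hF, hG, ← funext hw']
    have hd : (fun i => ∑ a, d i a) = fun i => ∑ a, δ (w ⟨i, a⟩) :=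
      funext fun i => Finset.sum_congr rfl fun a _ => (hw ⟨i, a⟩).symm
    simp only [u, hd]
    exact freeLOp_elt_basis b δ hb j n T fun i a => w ⟨i, a⟩

theorem isGraftingRule_freeLOp (hb : ∀ d, 𝒴 d = Submodule.span k (b '' {i | δ i = d}))
    {s : (n : ℕ) → AdmTree m n → {T : LTree m n // T.1.Admissible}}
    {Ω : (n : ℕ) → LTree m n → (AdmTree m n →₀ k)} (hΩ : IsNormalization k s Ω) :
    IsGraftingRule 𝒴 s Ω (freeLOp m b δ hb) := by
  intro j n T v d _ hv
  exact (freeLOp_elt b δ hb j n T v d hv).trans (congrArg (fun f => shuffleSign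
    (fun i => (T i).1.deg) (fun i => ∑ a, d i a) • elt m 𝒴 (sumPos j n) f (concat j n v))
      (hΩ (sumPos j n) (LTree.graft j (fun i => (n i : ℕ)) T)).symm)

/-- The rule prescribes the operations on admissible trees tensored with basis words, and these
elements span. -/
theorem IsGraftingRule.eq {s : (n : ℕ) → AdmTree m n → {T : LTree m n // T.1.Admissible}}
    (hs : ∀ (n : ℕ) (τ : AdmTree m n), (Quotient.mk (admSetoid m n) (s n τ) : AdmTree m n) = τ)
    (hb : ∀ d, 𝒴 d = Submodule.span k (b '' {i | δ i = d}))
    {Ω : (n : ℕ) → LTree m n → (AdmTree m n →₀ k)}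
    {l l' : (j : Arity m) → MultilinearMap k (fun _ : Fin j.1 => FreeL m 𝒴) (FreeL m 𝒴)}
    (hl : IsGraftingRule 𝒴 s Ω l) (hl' : IsGraftingRule 𝒴 s Ω l') : l' = l := by
  funext j
  refine MultilinearMap.ext fun x => ?_
  refine multilinear_eq_of_span (fun _ => {z : FreeL m 𝒴 | ∃ (n : ℕ+) (f : LOperad k m n)
    (w : Fin n → ι), f ∈ treeClass k '' {T : LTree m n | T.1.Admissible} ∧
      z = elt m 𝒴 n f fun a => b (w a)}) (fun x hx => ?_) x fun i => by
    rw [span_elt b fun n : ℕ+ => admissible_span (k := k) s hs n]; trivial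
  choose n f w hf hx using hx
  choose T hT hT' using hf
  obtain rfl : (fun i => treeClass k (T i)) = f := funext hT'
  rw [funext hx, hl j n T (fun i a => b (w i a)) (fun i a => δ (w i a)) hT
    fun i a => basis_mem b δ hb _, hl' j n T (fun i a => b (w i a)) (fun i a => δ (w i a)) hT
    fun i a => basis_mem b δ hb _]

variable (m 𝒴) in
/-- The inclusion of the generators. -/
def freeUnit : Y →ₗ[k] FreeL m 𝒴 :=
  (eltMultilinear 𝒴 1 (treeClass k (LTree.unit m))).toLinearMap 0 0

theorem freeUnit_apply (y : Y) :
    freeUnit m 𝒴 y = elt m 𝒴 1 (treeClass k (LTree.unit m)) fun _ => y := by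
  rw [freeUnit, MultilinearMap.toLinearMap_apply, eltMultilinear_apply]
  congr 1
  funext a
  have : Subsingleton (Fin ((1 : ℕ+) : ℕ)) := inferInstanceAs (Subsingleton (Fin 1))
  rw [Subsingleton.elim a 0, Function.update_self]

theorem freeUnit_mem {d : ℤ} {y : Y} (hy : y ∈ 𝒴 d) : freeUnit m 𝒴 y ∈ freeGrading m 𝒴 d := by
  rw [freeUnit_apply]
  refine Submodule.subset_span ⟨1, LTree.unit m, fun _ => y, fun _ => d, fun _ => hy, ?_, rfl⟩
  change (0 : ℤ) + ∑ _ : Fin 1, d = d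
  simp

theorem freeEquiv_freeUnit (hb : ∀ d, 𝒴 d = Submodule.span k (b '' {i | δ i = d})) (i : ι) :
    freeEquiv m b δ hb (freeUnit m 𝒴 (b i)) = ColAlg.of k m δ (.leaf i) := by
  rw [freeUnit_apply]
  exact (freeEquiv_elt_basis b δ hb 1 (LTree.unit m) fun _ => i).trans (one_smul _ _)

theorem freeL_existsUnique_hom (hb : ∀ d, 𝒴 d = Submodule.span k (b '' {i | δ i = d}))
    {A : Type*} [AddCommGroup A] [Module k A] {𝒜 : ℤ → Submodule k A}
    {lA : (j : Arity m) → MultilinearMap k (fun _ : Fin j.1 => A) A} (hA : IsLAlgebra m 𝒜 lA)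
    (φ : Y →ₗ[k] A) (hφ : ∀ d, ∀ y ∈ 𝒴 d, φ y ∈ 𝒜 d) :
    ∃! Φ : FreeL m 𝒴 →ₗ[k] A,
      IsStrictHom (freeGrading m 𝒴) (freeLOp m b δ hb) 𝒜 lA Φ ∧
        ∀ y, Φ (freeUnit m 𝒴 y) = φ y := by
  let E := freeEquiv m b δ hb
  have hE := freeEquiv_freeLOp (m := m) b δ hb
  obtain ⟨Φ, ⟨hΦ, hΦ'⟩, huniq⟩ := ColAlg.existsUnique_hom (δ := δ) hA.lAxioms
    (φ := fun i => φ (b i)) fun i => hφ _ _ (basis_mem b δ hb i)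
  refine ⟨Φ ∘ₗ E.toLinearMap, ⟨⟨fun d x hx => hΦ.degree d _ ((mem_freeGrading_iff b δ hb d x).1 hx),
    fun j x => ?_⟩, ?_⟩, ?_⟩
  · rw [LinearMap.comp_apply]
    exact (congrArg Φ (hE j x)).trans (hΦ.map_op j _)
  · refine LinearMap.congr_fun (f := (Φ ∘ₗ E.toLinearMap) ∘ₗ freeUnit m 𝒴) (b.ext fun i => ?_)
    exact (congrArg Φ (freeEquiv_freeUnit b δ hb i)).trans (hΦ' i)
  · rintro Ψ ⟨hΨ, hΨ'⟩
    have h1 := huniq (Ψ ∘ₗ E.symm.toLinearMap) ⟨⟨fun d x hx => hΨ.degree d _ ?_, fun j x => ?_⟩,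
      fun i => ?_⟩
    · rw [← h1]
      ext x
      simp
    · rw [mem_freeGrading_iff b δ hb]
      exact (E.apply_symm_apply x).symm ▸ hx
    · have h2 : E.symm (ColAlg.op k m δ j x) = freeLOp m b δ hb j fun a => E.symm (x a) := by
        rw [LinearEquiv.symm_apply_eq]
        refine Eq.trans ?_ (hE j _).symm
        congr 1
        funext a
        exact (E.apply_symm_apply _).symm
      rw [LinearMap.comp_apply]
      exact (congrArg Ψ h2).trans (hΨ.map_op j _)
    · have h2 : E.symm (ColAlg.of k m δ (.leaf i)) = freeUnit m 𝒴 (b i) := by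
        rw [LinearEquiv.symm_apply_eq]
        exact (freeEquiv_freeUnit b δ hb i).symm
      rw [LinearMap.comp_apply]
      exact (congrArg Ψ h2).trans (hΨ' _)

end FreeAlgebra

end HomotopyLie

end

/-! ### The main theorem -/

open HomotopyLie in
theorem mainTheorem3 {k : Type*} [Field k] [CharZero k] (m : ℕ∞)
    {Y : Type*} [AddCommGroup Y] [Module k Y] (𝒴 : ℤ → Submodule k Y)
    (h𝒴 : DirectSum.IsInternal 𝒴)
    (s : (n : ℕ) → AdmTree m n → {T : LTree m n // T.1.Admissible})
    (hs : ∀ (n : ℕ) (τ : AdmTree m n), (Quotient.mk (admSetoid m n) (s n τ) : AdmTree m n) = τ) :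
    -- the admissible non-planar labelled trees form a basis of the operad
    (∀ n : ℕ, LinearIndependent k (fun τ : AdmTree m n => treeClass k (s n τ).1) ∧
      Submodule.span k (Set.range fun τ : AdmTree m n => treeClass k (s n τ).1) = ⊤) ∧
    -- existence and uniqueness of `Ω`
    (∃! Ω : (n : ℕ) → LTree m n → (AdmTree m n →₀ k), IsNormalization k s Ω) ∧
    ∀ Ω : (n : ℕ) → LTree m n → (AdmTree m n →₀ k), IsNormalization k s Ω →
      -- the grafting rule determines the operations
      ∃ l : (j : Arity m) → MultilinearMap k (fun _ : Fin j.1 => FreeL m 𝒴) (FreeL m 𝒴),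
        IsGraftingRule 𝒴 s Ω l ∧ (∀ l', IsGraftingRule 𝒴 s Ω l' → l' = l) ∧
        IsLAlgebra m (freeGrading m 𝒴) l ∧
        -- the resulting L(m)-algebra is free on `Y`
        ∃ η : Y →ₗ[k] FreeL m 𝒴,
          (∀ y, η y = elt m 𝒴 1 (treeClass k (LTree.unit m)) fun _ => y) ∧
          (∀ d, ∀ y ∈ 𝒴 d, η y ∈ freeGrading m 𝒴 d) ∧
          ∀ (A : Type*) [AddCommGroup A] [Module k A] (𝒜 : ℤ → Submodule k A)
            (lA : (j : Arity m) → MultilinearMap k (fun _ : Fin j.1 => A) A),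
            IsLAlgebra m 𝒜 lA →
            ∀ φ : Y →ₗ[k] A, (∀ d, ∀ y ∈ 𝒴 d, φ y ∈ 𝒜 d) →
              ∃! Φ : FreeL m 𝒴 →ₗ[k] A,
                IsStrictHom (freeGrading m 𝒴) l 𝒜 lA Φ ∧ ∀ y, Φ (η y) = φ y := by
  refine ⟨fun n => ⟨linearIndependent_admissible s hs n, span_admissible_eq_top s hs n⟩, ?_, ?_⟩
  -- Linear independence is injectivity of `admClass`, and spanning is its surjectivity; `Ω` is its
  -- inverse applied to the classes of trees.
  · have hbij : ∀ n, Function.Bijective (admClass k s n) := fun n =>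
      ⟨linearIndependent_admissible s hs n, fun x => by
        rw [← LinearMap.mem_range, admClass, Finsupp.range_linearCombination,
          span_admissible_eq_top s hs n]
        trivial⟩
    choose Ω hΩ using fun n (T : LTree m n) => (hbij n).2 (treeClass k T)
    refine ⟨Ω, hΩ, fun Ω' hΩ' => ?_⟩
    funext n T
    exact (hbij n).1 ((hΩ' n T).trans (hΩ n T).symm)
  · intro Ω hΩ
    -- The basis is auxiliary: the grafting rule does not mention it and determines the operations.
    obtain ⟨ι, b, δ, hb⟩ := exists_homogeneous_basis h𝒴
    have hrule := isGraftingRule_freeLOp b δ hb hΩ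
    exact ⟨freeLOp m b δ hb, hrule, fun l' hl' => hrule.eq b δ hs hb hl',
      freeLOp_isLAlgebra b δ hb, freeUnit m 𝒴, freeUnit_apply, fun d y hy => freeUnit_mem hy,
      fun A _ _ 𝒜 lA hA φ hφ => freeL_existsUnique_hom b δ hb hA φ hφ⟩
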